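/- Fix an integer $d\ge 1$ and let $[d]=\{1,\dots,d\}$. An environment $\omega=(q_k,r_k,p_k)_{k\in\mathbb Z}$ on the strip $\mathbb Z\times[d]$ is a sequence of triples of non-negative $d\times d$ matrices such that each $q_k+r_k+p_k$ is stochastic. Under $P_\omega^{(x,i)}$ the process $\xi_n=(X_n,Y_n)$ is the Markov chain on $\mathbb Z\times[d]$ started at $(x,i)$ that jumps from $(k,i)$ to $(k-1,j)$, $(k,j)$, $(k+1,j)$ with probability $q_k(i,j)$, $r_k(i,j)$, $p_k(i,j)$ respectively. For a probability distribution $\pi$ on $[d]$ put $P_\omega^\pi=\sum_i\pi(i)P_\omega^{(0,i)}$. Expectations are written $E_\omega^{(x,i)}$, $E_\omega^\pi$. Let $T_n=\inf\{m\ge 0: X_m=n\}\in[0,\infty]$, and for $\lambda\in\mathbb R$, $k\in\mathbb Z$ let $\Phi_k(\lambda)=\Phi_k(\lambda,\omega)$ be the $d\times d$ matrix with entries in $[0,\infty]$ $$\Phi_k(\lambda)(i,j)=E_\omega^{(k,i)}\bigl[e^{\lambda T_{k+1}}\mathbf 1\{T_{k+1}<\infty,\ Y_{T_{k+1}}=j\}\bigr].$$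 **Theorem 1.3.** Let $\eta$ be a probability measure on environments that is invariant and ergodic under the shift $(\theta\omega)_k=\omega_{k+1}$, and suppose that for some $\kappa>0$, for $\eta$-a.e. $\omega$, all $k\in\mathbb Z$ and all $i,j\in[d]$, $$\sum_{j'} q_k(i,j')\ge\kappa,\quad \sum_{j'} p_k(i,j')\ge\kappa,\quad ((I-r_k)^{-1}q_k)(i,j)\ge\kappa,\quad ((I-r_k)^{-1}p_k)(i,j)\ge\kappa .$$ Then the following hold. 1. For all $\omega$, $\pi$, $\lambda$ and $n\ge 0$, $E_\omega^\pi[e^{\lambda T_n}\mathbf 1\{T_n<\infty\}]=\pi\,\Phi_0(\lambda)\Phi_1(\lambda)\cdots\Phi_{n-1}(\lambda)\mathbf 1$ in $[0,\infty]$ (with $0\cdot\infty=0$). 2. Let $\lambda_{\rm crit}$ be the supremum of those $\lambda$ for which all entries of $\Phi_0(\lambda)$ are $\eta$-a.s. finite. Then $0\le\lambda_{\rm crit}<\infty$, and there is a deterministic function $\Lambda_\eta:\mathbb R\to(-\infty,\infty]$ such that for $\eta$-a.e. $\omega$, for every $\lambda\in\mathbb R$ and every distribution $\pi$ on $[d]$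 (which may depend on $\omega$), $$\lim_{n\to\infty}\frac1n\log E_\omega^\pi\bigl[e^{\lambda T_n}\mathbf 1\{T_n<\infty\}\bigr]=\Lambda_\eta(\lambda).$$ Moreover $\Lambda_\eta(\lambda)=\infty$ for $\lambda>\lambda_{\rm crit}$, while for $\lambda\le\lambda_{\rm crit}$ $$\Lambda_\eta(\lambda)=E_\eta\bigl[\log\bigl(\mu_0(\lambda)\Phi_0(\lambda)\mathbf 1\bigr)\bigr]\in\mathbb R,\qquad \mu_0(\lambda)=\lim_{m\to\infty}\frac{\pi\,\Phi_{-m}(\lambda)\cdots\Phi_{-1}(\lambda)}{\pi\,\Phi_{-m}(\lambda)\cdots\Phi_{-1}(\lambda)\mathbf 1},$$ where for $\eta$-a.e. $\omega$ the last limit exists for every $\pi$ and does not depend on $\pi$, and the logarithm is $\eta$-integrable. The function $\Lambda_\eta$ is differentiable on $(-\infty,\lambda_{\rm crit})$. 3. Let $J_\eta(t)=\sup_{\lambda\in\mathbb R}\{\lambda t-\Lambda_\eta(\lambda)\}$, $t\in\mathbb R$. For $\eta$-a.e. $\omega$ and every distribution $\pi$ on $[d]$ (which may depend on $\omega$), $T_n/n$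 satisfies a weak large deviation principle under $P_\omega^\pi$ with rate function $J_\eta$. That is, $J_\eta$ is lower semicontinuous with values in $[0,\infty]$; for every open $G\subseteq\mathbb R$, $$\liminf_{n\to\infty}\frac1n\log P_\omega^\pi(T_n/n\in G)\ge-\inf_{t\in G}J_\eta(t);$$ and for every compact $F\subseteq\mathbb R$, $$\limsup_{n\to\infty}\frac1n\log P_\omega^\pi(T_n/n\in F)\le-\inf_{t\in F}J_\eta(t).$$ -/

import Mathlib

open MeasureTheory ProbabilityTheory Filter Topology
open scoped ENNReal Matrix

noncomputable section

namespace StripRWRE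

/-- The transition probabilities `(q, r, p)` out of one level of the strip `ℤ × Fin d`: three
non-negative `d × d` matrices such that `q + r + p` is stochastic. The type carries the topology and
the Borel σ-algebra of a subset of Euclidean space. -/
abbrev LevelTransitions (d : ℕ) : Type :=
  {s : (Fin d → Fin d → ℝ) × (Fin d → Fin d → ℝ) × (Fin d → Fin d → ℝ) //
    (∀ i j, 0 ≤ s.1 i j ∧ 0 ≤ s.2.1 i j ∧ 0 ≤ s.2.2 i j) ∧
    ∀ i, ∑ j, (s.1 i j + s.2.1 i j + s.2.2 i j) = 1}

/-- Jump probabilities to the level on the left. -/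
def LevelTransitions.q {d : ℕ} (s : LevelTransitions d) : Matrix (Fin d) (Fin d) ℝ :=
  Matrix.of s.1.1

/-- Jump probabilities inside the level. -/
def LevelTransitions.r {d : ℕ} (s : LevelTransitions d) : Matrix (Fin d) (Fin d) ℝ :=
  Matrix.of s.1.2.1

/-- Jump probabilities to the level on the right. -/
def LevelTransitions.p {d : ℕ} (s : LevelTransitions d) : Matrix (Fin d) (Fin d) ℝ :=
  Matrix.of s.1.2.2

/-- Environments on the strip, with the product σ-algebra. -/
abbrev Env (d : ℕ) : Type := ℤ → LevelTransitions d

/-- The product σ-algebra on environments is the Borel σ-algebra of the product topology. -/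
theorem env_borelSpace (d : ℕ) : BorelSpace (Env d) := by
  have : BorelSpace (LevelTransitions d) := Subtype.borelSpace _
  infer_instance

/-- The left shift `(θ ω)_k = ω_{k+1}` of environments. -/
def shift {d : ℕ} (ω : Env d) : Env d := fun k => ω (k + 1)

/-- The ellipticity conditions with constant `κ` at one level. -/
def IsElliptic {d : ℕ} (κ : ℝ) (s : LevelTransitions d) : Prop :=
  (∀ i, κ ≤ ∑ j, s.q i j) ∧ (∀ i, κ ≤ ∑ j, s.p i j) ∧
  (∀ i j, κ ≤ ((1 - s.r)⁻¹ * s.q) i j) ∧ (∀ i j, κ ≤ ((1 - s.r)⁻¹ * s.p) i j)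

/-- The law of the next position of the walk at `x = (k, i)`: it is `(k - 1, j)`, `(k, j)`,
`(k + 1, j)` with probability `q_k(i, j)`, `r_k(i, j)`, `p_k(i, j)` respectively. -/
def stepMeasure {d : ℕ} (ω : Env d) (x : ℤ × Fin d) : Measure (ℤ × Fin d) :=
  ∑ j : Fin d,
    (ENNReal.ofReal ((ω x.1).q x.2 j) • Measure.dirac (x.1 - 1, j) +
     ENNReal.ofReal ((ω x.1).r x.2 j) • Measure.dirac (x.1, j) +
     ENNReal.ofReal ((ω x.1).p x.2 j) • Measure.dirac (x.1 + 1, j))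

/-- The one-step transition kernel of the walk in the environment `ω`. -/
def stepKernel {d : ℕ} (ω : Env d) : Kernel (ℤ × Fin d) (ℤ × Fin d) :=
  Kernel.ofFunOfCountable (stepMeasure ω)

instance {d : ℕ} (ω : Env d) : IsMarkovKernel (stepKernel ω) := by
  refine ⟨fun x => ⟨?_⟩⟩
  obtain ⟨h0, h1⟩ := (ω x.1).2
  have hq : ∀ j, 0 ≤ (ω x.1).q x.2 j := fun j => (h0 x.2 j).1
  have hr : ∀ j, 0 ≤ (ω x.1).r x.2 j := fun j => (h0 x.2 j).2.1
  have hp : ∀ j, 0 ≤ (ω x.1).p x.2 j := fun j => (h0 x.2 j).2.2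
  have hs : ∑ j, ((ω x.1).q x.2 j + (ω x.1).r x.2 j + (ω x.1).p x.2 j) = 1 := h1 x.2
  change stepMeasure ω x Set.univ = 1
  simp only [stepMeasure, Measure.coe_finsetSum, Finset.sum_apply, Measure.coe_add, Pi.add_apply,
    Measure.smul_apply, measure_univ, smul_eq_mul, mul_one]
  rw [← ENNReal.ofReal_one, ← hs, ENNReal.ofReal_sum_of_nonneg
    (fun j _ => add_nonneg (add_nonneg (hq j) (hr j)) (hp j))]
  refine Finset.sum_congr rfl fun j _ => ?_
  rw [ENNReal.ofReal_add (add_nonneg (hq j) (hr j)) (hp j), ENNReal.ofReal_add (hq j) (hr j)]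

/-- Trajectories of the walk. -/
abbrev Traj (d : ℕ) : Type := ℕ → ℤ × Fin d

/-- The quenched law `P_ω^x`: the law of the Markov chain with one-step kernel `stepKernel ω`
started at `x`. -/
def quenchedLaw {d : ℕ} (ω : Env d) (x : ℤ × Fin d) : Measure (Traj d) :=
  Kernel.trajMeasure (X := fun _ => ℤ × Fin d) (Measure.dirac x)
    (fun n => (stepKernel ω).comap
      (fun y : (i : Finset.Iic n) → ℤ × Fin d => y ⟨n, Finset.mem_Iic.2 le_rfl⟩)
      (measurable_pi_apply _))

/-- The quenched law `P_ω^π = ∑ i, π(i) P_ω^{(0, i)}` with random starting height in level `0`. -/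
def quenchedLawInit {d : ℕ} (ω : Env d) (π : PMF (Fin d)) : Measure (Traj d) :=
  ∑ i : Fin d, π i • quenchedLaw ω (0, i)

/-- The hitting time `T_n` of level `n`, equal to `⊤` if the level is never hit. -/
def hitTime {d : ℕ} (n : ℤ) (ξ : Traj d) : ℕ∞ :=
  ⨅ (m : ℕ) (_ : (ξ m).1 = n), (m : ℕ∞)

/-- The random variable `e^{l T_n} 1{T_n < ∞}`. -/
def expHit {d : ℕ} (l : ℝ) (n : ℤ) (ξ : Traj d) : ℝ≥0∞ :=
  open Classical in
  if hitTime n ξ = ⊤ then 0 else ENNReal.ofReal (Real.exp (l * ((hitTime n ξ).toNat : ℝ)))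

/-- The quenched moment generating function `E_ω^π[e^{l T_n}; T_n < ∞] ∈ [0, ∞]`. -/
def quenchedMGF {d : ℕ} (ω : Env d) (π : PMF (Fin d)) (l : ℝ) (n : ℕ) : ℝ≥0∞ :=
  ∫⁻ ξ, expHit l n ξ ∂(quenchedLawInit ω π)

/-- The matrix
`Φ_k(l)(i, j) = E_ω^{(k, i)}[e^{l T_{k+1}}; T_{k+1} < ∞, Y_{T_{k+1}} = j] ∈ [0, ∞]`. -/
def Phi {d : ℕ} (ω : Env d) (l : ℝ) (k : ℤ) : Matrix (Fin d) (Fin d) ℝ≥0∞ :=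
  Matrix.of fun i j =>
    ∫⁻ ξ, (open Classical in
      if (ξ ((hitTime (k + 1) ξ).toNat)).2 = j then expHit l (k + 1) ξ else 0)
      ∂(quenchedLaw ω (k, i))

/-- The product `Φ_m(l) Φ_{m+1}(l) ⋯ Φ_{m+n-1}(l)` of `n` matrices, in this order. -/
def PhiProd {d : ℕ} (ω : Env d) (l : ℝ) (m : ℤ) (n : ℕ) : Matrix (Fin d) (Fin d) ℝ≥0∞ :=
  ((List.range n).map fun k => Phi ω l (m + (k : ℤ))).prod

/-- The row vector `π Φ_{-m}(l) ⋯ Φ_{-1}(l)`, divided by the sum of its entries. -/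
def normalizedRow {d : ℕ} (ω : Env d) (π : PMF (Fin d)) (l : ℝ) (m : ℕ) : Fin d → ℝ≥0∞ :=
  fun j => ((fun i => π i) ᵥ* PhiProd ω l (-(m : ℤ)) m) j /
    ∑ k, ((fun i => π i) ᵥ* PhiProd ω l (-(m : ℤ)) m) k

/-- The event `T_n / n ∈ A` for a set `A` of (finite) real numbers. -/
def scaledHitEvent {d : ℕ} (n : ℕ) (A : Set ℝ) : Set (Traj d) :=
  {ξ | ∃ m : ℕ, hitTime (n : ℤ) ξ = (m : ℕ∞) ∧ (m : ℝ) / (n : ℝ) ∈ A}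

/-- The Legendre transform `J(t) = sup_l (l t - Λ(l))`. -/
def legendre (Λ : ℝ → EReal) (t : ℝ) : EReal :=
  ⨆ l : ℝ, (((l * t : ℝ) : EReal) - Λ l)

/-- A weak large deviation principle on `ℝ` with speed `n` and rate function `J`, where `prob n A`
is the probability that the `n`-th random variable lies in `A`. The upper bound is for compact sets;
the random variables may take the value `∞`, which lies in no subset of `ℝ`. -/
structure WeakLDP (prob : ℕ → Set ℝ → ℝ≥0∞) (J : ℝ → EReal) : Prop where
  rate_nonneg : ∀ t, 0 ≤ J t
  rate_lsc : LowerSemicontinuous J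
  lower : ∀ G : Set ℝ, IsOpen G →
    -(⨅ t ∈ G, J t) ≤ liminf (fun n : ℕ => ENNReal.log (prob n G) / (n : EReal)) atTop
  upper : ∀ F : Set ℝ, IsCompact F →
    limsup (fun n : ℕ => ENNReal.log (prob n F) / (n : EReal)) atTop ≤ -(⨅ t ∈ F, J t)

end StripRWRE

end

/-!
A walk that starts below level `n` reaches it only through the levels in between, and it restarts
afresh at each of them (`hitProb_decomposition`). Hence generating functions of hitting times
multiply, and the moment generating function of `T_n` is a product of passage matrices `Phi`
(`quenchedMGF_eq_dotProduct`). Everything is expressed through iterates of the transition operator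
killed on a level, to which the trajectory measure is reduced once (`lintegral_survival`).

*Free energy.* First-step analysis bounds the passage matrices from below by ellipticity. It also
shows that if they are finite at two consecutive levels then they are bounded by a constant depending
on the ellipticity alone (`Phi_le_of_finite`): otherwise the excursions to the left would be too
heavy. So for parameters in any interval `[-R, λ_crit]`, the critical one included by Fatou's lemma,
the matrices have entries in a compact subset of `(0, ∞)` (`exists_ae_PhiBounded`). Products of such matrices contract ratios of vectors (`ratio_contraction`),
which yields the common limit `rowLimit` of the normalized rows, and shows that the increments of
the logarithm of the moment generating function are, up to exponentially small errors, a stationary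
sequence (`log_quenchedMGF_succ`). The pointwise ergodic theorem, proved here for bounded functions,
gives the limit `freeEnergy`. Above the critical parameter ergodicity produces an infinite passage
matrix to the right of the origin, and all later moment generating functions are infinite.

*Differentiability.* The free energy is convex, so it suffices that its symmetric second differences
at distance `h` are `o(h)`. Up to an error `O(ρ ^ n)` with `ρ < 1` it equals the increment at `n` of
the expected logarithmic moment generating function, whose second differences are `O(n ^ 2 h ^ 2)`
(`log_expMoment_second_difference`); here `h` may go to zero exponentially fast in `n`.

*Large deviations.* Chernoff's bound on a finite cover of a compact set gives the upper bound
(`limsup_scaledMass_le`). For the lower bound at a point in the range of the derivative of the free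
energy one tilts exponentially. Points beyond this range on the right need another argument, as the
free energy need not be steep at the critical parameter `λ`. An infinite passage matrix
at a parameter just above `λ` means that the walk can loop below some level for a time `s` at a cost
close to `λ s` (`exists_expWeight_le_loopProb`). Repeating this loop delays `T_n` by any required
amount, at the price predicted by the Legendre transform, which is linear with slope `λ` there
(`le_liminf_of_delay`). Points to the left of the range of the derivative are either limits of the
range or have infinite rate.
-/

noncomputable section

namespace StripRWRE

/-! ### The pointwise ergodic theorem for bounded observables -/

section Birkhoff

variable {Ω : Type*}

/-- The running maximum `max_{0 ≤ n ≤ N} S_n f` of the Birkhoff sums of `f` along `T`, defined by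
the recursion that drives the proof of the maximal ergodic theorem. -/
def birkhoffMax (T : Ω → Ω) (f : Ω → ℝ) : ℕ → Ω → ℝ
  | 0, _ => 0
  | N + 1, x => max 0 (f x + birkhoffMax T f N (T x))

theorem birkhoffMax_nonneg (T : Ω → Ω) (f : Ω → ℝ) (N : ℕ) (x : Ω) : 0 ≤ birkhoffMax T f N x := by
  cases N
  · exact le_rfl
  · exact le_max_left _ _

theorem birkhoffMax_le_succ (T : Ω → Ω) (f : Ω → ℝ) (N : ℕ) (x : Ω) :
    birkhoffMax T f N x ≤ birkhoffMax T f (N + 1) x := by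
  induction N generalizing x with
  | zero => exact birkhoffMax_nonneg _ _ _ _
  | succ N ih => exact max_le_max le_rfl (by simpa using ih (T x))

theorem birkhoffSum_le_birkhoffMax (T : Ω → Ω) (f : Ω → ℝ) (n : ℕ) (x : Ω) :
    birkhoffSum T f n x ≤ birkhoffMax T f n x := by
  induction n generalizing x with
  | zero => simp [birkhoffMax]
  | succ n ih =>
    rw [birkhoffSum_succ']
    exact le_max_of_le_right (by simpa using ih (T x))

theorem birkhoffMax_le {T : Ω → Ω} {f : Ω → ℝ} {K : ℝ} (hK : 0 ≤ K) (hf : ∀ x, |f x| ≤ K) (N : ℕ)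
    (x : Ω) : birkhoffMax T f N x ≤ N * K := by
  induction N generalizing x with
  | zero => simp [birkhoffMax]
  | succ N ih =>
    refine max_le (by positivity) ?_
    push_cast
    linarith [ih (T x), le_of_abs_le (hf x)]

variable [MeasurableSpace Ω]

theorem measurable_birkhoffMax {T : Ω → Ω} (hT : Measurable T) {f : Ω → ℝ} (hf : Measurable f)
    (N : ℕ) : Measurable (birkhoffMax T f N) := by
  induction N with
  | zero => exact measurable_const
  | succ N ih => exact measurable_const.max (hf.add (ih.comp hT))

/-- The maximal ergodic inequality. -/
theorem integral_nonneg_of_birkhoffSum_pos {μ : Measure Ω} [IsProbabilityMeasure μ] {T : Ω → Ω}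
    (hT : MeasurePreserving T μ μ) {f : Ω → ℝ} (hf : Measurable f) {K : ℝ} (hK : ∀ x, |f x| ≤ K)
    (hpos : ∀ᵐ x ∂μ, ∃ n, 0 < birkhoffSum T f n x) : 0 ≤ ∫ x, f x ∂μ := by
  have hfi : Integrable f μ := Integrable.of_bound hf.aestronglyMeasurable K (ae_of_all _ hK)
  have hM := measurable_birkhoffMax hT.measurable hf
  have hK0 : 0 ≤ K := by
    obtain ⟨x⟩ : Nonempty Ω := nonempty_of_isProbabilityMeasure μ
    exact (abs_nonneg _).trans (hK x)
  have hMi : ∀ N, Integrable (birkhoffMax T f N) μ := fun N =>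
    Integrable.of_bound (hM N).aestronglyMeasurable (N * K) (ae_of_all _ fun x => by
      rw [Real.norm_eq_abs, abs_of_nonneg (birkhoffMax_nonneg _ _ _ _)]
      exact birkhoffMax_le hK0 hK N x)
  let E : ℕ → Set Ω := fun N => {x | 0 < birkhoffMax T f N x}
  have hE : ∀ N, MeasurableSet (E N) := fun N => measurableSet_lt measurable_const (hM N)
  have hEmono : Monotone E := monotone_nat_of_le_succ fun N x hx =>
    lt_of_lt_of_le hx (birkhoffMax_le_succ T f N x)
  have hEint : ∀ N, 0 ≤ ∫ x in E N, f x ∂μ := by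
    intro N
    cases N with
    | zero => simp [E, birkhoffMax]
    | succ N =>
      have hcomp : ∫ x, birkhoffMax T f (N + 1) (T x) ∂μ = ∫ x, birkhoffMax T f (N + 1) x ∂μ := by
        rw [← integral_map hT.measurable.aemeasurable (by
          rw [hT.map_eq]; exact (hM _).aestronglyMeasurable), hT.map_eq]
      have hci : Integrable (fun x => birkhoffMax T f (N + 1) (T x)) μ :=
        hT.integrable_comp_of_integrable (hMi (N + 1))
      have h1 : ∀ x ∈ E (N + 1), birkhoffMax T f (N + 1) x - birkhoffMax T f (N + 1) (T x) ≤ f x := by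
        intro x hx
        have hx' : 0 < max 0 (f x + birkhoffMax T f N (T x)) := hx
        have h2 : birkhoffMax T f (N + 1) x = f x + birkhoffMax T f N (T x) := by
          rcases lt_max_iff.1 hx' with h | h
          · exact absurd h (lt_irrefl _)
          · exact max_eq_right h.le
        linarith [birkhoffMax_le_succ T f N (T x)]
      have h3 : ∫ x in E (N + 1), birkhoffMax T f (N + 1) x ∂μ
          = ∫ x, birkhoffMax T f (N + 1) x ∂μ := by
        refine setIntegral_eq_integral_of_forall_compl_eq_zero fun x hx => ?_
        exact le_antisymm (not_lt.1 hx) (birkhoffMax_nonneg _ _ _ _)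
      have h4 : ∫ x in E (N + 1), birkhoffMax T f (N + 1) (T x) ∂μ
          ≤ ∫ x, birkhoffMax T f (N + 1) (T x) ∂μ :=
        setIntegral_le_integral hci (ae_of_all _ fun x => birkhoffMax_nonneg _ _ _ _)
      have h5 := setIntegral_mono_on ((hMi (N + 1)).sub hci).integrableOn hfi.integrableOn
        (hE (N + 1)) h1
      simp only [Pi.sub_apply] at h5
      rw [integral_sub (hMi (N + 1)).integrableOn hci.integrableOn] at h5
      linarith
  have hlim := tendsto_setIntegral_of_monotone hE hEmono (hfi.integrableOn (s := ⋃ N, E N))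
  have huniv : (⋃ N, E N : Set Ω) =ᵐ[μ] Set.univ := by
    rw [eventuallyEq_univ]
    filter_upwards [hpos] with x ⟨n, hn⟩
    exact Set.mem_iUnion.2 ⟨n, hn.trans_le (birkhoffSum_le_birkhoffMax T f n x)⟩
  rw [setIntegral_congr_set huniv, setIntegral_univ] at hlim
  exact ge_of_tendsto' hlim hEint

/-- Under an ergodic transformation the Birkhoff sums of a function of negative mean are bounded
above: the event that they are unbounded is invariant, and by the maximal ergodic inequality it is
not of full measure. -/
theorem ae_birkhoffSum_bddAbove {μ : Measure Ω} [IsProbabilityMeasure μ] {T : Ω → Ω}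
    (hT : Ergodic T μ) {f : Ω → ℝ} (hf : Measurable f) {K : ℝ} (hK : ∀ x, |f x| ≤ K)
    (hneg : ∫ x, f x ∂μ < 0) : ∀ᵐ x ∂μ, ∃ M : ℕ, ∀ n, birkhoffSum T f n x ≤ M := by
  let A : Set Ω := {x | ∀ M : ℕ, ∃ n, (M : ℝ) < birkhoffSum T f n x}
  have hS : ∀ n, Measurable (birkhoffSum T f n) := fun n => by
    unfold birkhoffSum
    exact Finset.measurable_sum _ fun i _ => hf.comp (hT.measurable.iterate i)
  have hA : MeasurableSet A := by
    have : A = ⋂ M : ℕ, ⋃ n, {x | (M : ℝ) < birkhoffSum T f n x} := by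
      ext x; simp [A]
    rw [this]
    exact MeasurableSet.iInter fun M => MeasurableSet.iUnion fun n =>
      measurableSet_lt measurable_const (hS n)
  have hK0 : 0 ≤ K := by
    obtain ⟨x⟩ : Nonempty Ω := nonempty_of_isProbabilityMeasure μ
    exact (abs_nonneg _).trans (hK x)
  -- Unboundedness of the Birkhoff sums is insensitive to dropping the first summand.
  have hinv : T ⁻¹' A = A := by
    ext x
    constructor
    · intro h M
      obtain ⟨n, hn⟩ := h (M + ⌈K⌉₊)
      refine ⟨n + 1, ?_⟩
      rw [birkhoffSum_succ']
      push_cast at hn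
      linarith [neg_le_of_abs_le (hK x), Nat.le_ceil K]
    · intro h M
      obtain ⟨n, hn⟩ := h (M + ⌈K⌉₊)
      push_cast at hn
      cases n with
      | zero =>
        simp only [birkhoffSum_zero] at hn
        linarith [Nat.le_ceil K, (Nat.cast_nonneg M : (0 : ℝ) ≤ M)]
      | succ n =>
        refine ⟨n, ?_⟩
        rw [birkhoffSum_succ'] at hn
        linarith [le_of_abs_le (hK x), Nat.le_ceil K]
  rcases hT.toPreErgodic.ae_empty_or_univ hA hinv with h | h
  · filter_upwards [eventuallyEq_empty.1 h] with x hx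
    simpa [A] using hx
  · refine absurd (integral_nonneg_of_birkhoffSum_pos hT.toMeasurePreserving hf hK ?_) hneg.not_ge
    filter_upwards [eventuallyEq_univ.1 h] with x hx
    simpa using hx 0

theorem ae_eventually_birkhoffAverage_le {μ : Measure Ω} [IsProbabilityMeasure μ] {T : Ω → Ω}
    (hT : Ergodic T μ) {f : Ω → ℝ} (hf : Measurable f) {K : ℝ} (hK : ∀ x, |f x| ≤ K) {ε : ℝ}
    (hε : 0 < ε) :
    ∀ᵐ x ∂μ, ∀ᶠ n : ℕ in atTop, birkhoffSum T f n x / n ≤ ∫ x, f x ∂μ + ε := by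
  set c := ∫ x, f x ∂μ with hc
  have hfi : Integrable f μ := Integrable.of_bound hf.aestronglyMeasurable K (ae_of_all _ hK)
  have h1 : ∫ x, (f x - (c + ε / 2)) ∂μ < 0 := by
    rw [integral_sub hfi (integrable_const _)]
    simp only [integral_const, probReal_univ, one_smul]
    linarith
  have h2 := ae_birkhoffSum_bddAbove hT (f := fun x => f x - (c + ε / 2))
    (hf.sub measurable_const) (K := K + |c + ε / 2|)
    (fun x => (abs_sub _ _).trans (add_le_add_left (hK x) _)) h1
  filter_upwards [h2] with x ⟨M, hM⟩
  have h3 : Tendsto (fun n : ℕ => (M : ℝ) / n) atTop (𝓝 0) :=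
    tendsto_const_div_atTop_nhds_zero_nat _
  filter_upwards [h3.eventually_le_const (half_pos hε), eventually_gt_atTop 0] with n hn hn0
  have hn' : (0 : ℝ) < n := Nat.cast_pos.2 hn0
  have h4 := hM n
  have h5 : birkhoffSum T (fun x => f x - (c + ε / 2)) n x
      = birkhoffSum T f n x - n * (c + ε / 2) := by
    simp [birkhoffSum, Finset.sum_sub_distrib, mul_add]
  rw [h5] at h4
  rw [div_le_iff₀ hn'] at hn ⊢
  nlinarith

/-- Birkhoff's pointwise ergodic theorem for bounded observables of an ergodic system. -/
theorem ae_tendsto_birkhoffSum_div {μ : Measure Ω} [IsProbabilityMeasure μ] {T : Ω → Ω}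
    (hT : Ergodic T μ) {f : Ω → ℝ} (hf : Measurable f) {K : ℝ} (hK : ∀ x, |f x| ≤ K) :
    ∀ᵐ x ∂μ, Tendsto (fun n : ℕ => birkhoffSum T f n x / n) atTop (𝓝 (∫ x, f x ∂μ)) := by
  have h1 : ∀ᵐ x ∂μ, ∀ k : ℕ, ∀ᶠ n : ℕ in atTop,
      birkhoffSum T f n x / n ≤ ∫ x, f x ∂μ + 1 / ((k : ℝ) + 1) := by
    rw [ae_all_iff]
    exact fun k => ae_eventually_birkhoffAverage_le hT hf hK (by positivity)
  have h2 : ∀ᵐ x ∂μ, ∀ k : ℕ, ∀ᶠ n : ℕ in atTop,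
      birkhoffSum T (fun x => -f x) n x / n ≤ ∫ x, -f x ∂μ + 1 / ((k : ℝ) + 1) := by
    rw [ae_all_iff]
    exact fun k => ae_eventually_birkhoffAverage_le hT hf.neg (K := K)
      (fun x => by simpa using hK x) (by positivity)
  filter_upwards [h1, h2] with x hx1 hx2
  rw [Metric.tendsto_nhds]
  intro ε hε
  obtain ⟨k, hk⟩ := exists_nat_one_div_lt hε
  filter_upwards [hx1 k, hx2 k] with n hn1 hn2
  have h3 : birkhoffSum T (fun x => -f x) n x = -birkhoffSum T f n x := by
    simp [birkhoffSum]
  rw [h3, integral_neg, neg_div] at hn2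
  rw [Real.dist_eq, abs_lt]
  constructor <;> linarith

end Birkhoff

/-! ### From the quenched law to iterates of the killed transition operator -/

section QuenchedLaw

variable {d : ℕ}

/-- The one-step transition operator of the walk acting on non-negative functions. -/
def stepOp (ω : Env d) (g : ℤ × Fin d → ℝ≥0∞) (x : ℤ × Fin d) : ℝ≥0∞ :=
  ∑ j, (ENNReal.ofReal ((ω x.1).q x.2 j) * g (x.1 - 1, j) +
    ENNReal.ofReal ((ω x.1).r x.2 j) * g (x.1, j) +
    ENNReal.ofReal ((ω x.1).p x.2 j) * g (x.1 + 1, j))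

/-- The transition operator of the walk killed on level `n`. -/
def killedOp (ω : Env d) (n : ℤ) (g : ℤ × Fin d → ℝ≥0∞) (x : ℤ × Fin d) : ℝ≥0∞ :=
  if x.1 = n then 0 else stepOp ω g x

/-- The probability `P_ω^x(T_n = N, Y_N = j)`, as the value at `x` of the `N`-th iterate of the
operator killed on level `n`. -/
def hitProb (ω : Env d) (n : ℤ) (N : ℕ) (x : ℤ × Fin d) (j : Fin d) : ℝ≥0∞ :=
  (killedOp ω n)^[N] (fun y => if y = (n, j) then 1 else 0) x

theorem lintegral_stepKernel (ω : Env d) (g : ℤ × Fin d → ℝ≥0∞) (x : ℤ × Fin d) :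
    ∫⁻ y, g y ∂(stepKernel ω x) = stepOp ω g x := by
  change ∫⁻ y, g y ∂(stepMeasure ω x) = _
  simp [stepMeasure, stepOp]

instance (ω : Env d) (x : ℤ × Fin d) : IsProbabilityMeasure (quenchedLaw ω x) := by
  unfold quenchedLaw
  infer_instance

theorem lintegral_quenchedLaw_zero (ω : Env d) (x : ℤ × Fin d) (g : ℤ × Fin d → ℝ≥0∞) :
    ∫⁻ ξ, g (ξ 0) ∂(quenchedLaw ω x) = g x := by
  let ι : Finset.Iic 0 := ⟨0, Finset.mem_Iic.2 le_rfl⟩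
  have hg : Measurable fun y : Finset.Iic 0 → ℤ × Fin d => g (y ι) := measurable_of_countable _
  have hr : Measurable (Preorder.frestrictLe (π := fun _ : ℕ => ℤ × Fin d) 0) := by fun_prop
  have h : (quenchedLaw ω x).map (Preorder.frestrictLe 0)
      = (Measure.dirac x).map
        (MeasurableEquiv.piUnique (fun _ : Finset.Iic 0 => ℤ × Fin d)).symm := by
    unfold quenchedLaw Kernel.trajMeasure
    rw [Measure.map_comp _ _ (by fun_prop), Kernel.traj_map_frestrictLe, Kernel.partialTraj_self,
      Measure.id_comp]
  calc ∫⁻ ξ, g (ξ 0) ∂(quenchedLaw ω x)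
      = ∫⁻ y, g (y ι) ∂((quenchedLaw ω x).map (Preorder.frestrictLe 0)) := by
        exact (lintegral_map hg hr).symm
    _ = g x := by
        rw [h, lintegral_map hg (MeasurableEquiv.measurable _), lintegral_dirac]
        rfl

/-- The Markov property at a deterministic time. -/
theorem lintegral_quenchedLaw_succ (ω : Env d) (x : ℤ × Fin d) (N : ℕ)
    (F : (Finset.Iic N → ℤ × Fin d) → ℝ≥0∞) (g : ℤ × Fin d → ℝ≥0∞) :
    ∫⁻ ξ, F (Preorder.frestrictLe N ξ) * g (ξ (N + 1)) ∂(quenchedLaw ω x)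
      = ∫⁻ ξ, F (Preorder.frestrictLe N ξ) * stepOp ω g (ξ N) ∂(quenchedLaw ω x) := by
  have hF : Measurable F := measurable_of_countable F
  have hg : Measurable g := measurable_of_countable g
  let ι : Finset.Iic N := ⟨N, Finset.mem_Iic.2 le_rfl⟩
  let κ := fun n : ℕ => (stepKernel ω).comap
      (fun y : (i : Finset.Iic n) → ℤ × Fin d => y ⟨n, Finset.mem_Iic.2 le_rfl⟩)
      (measurable_pi_apply _)
  have h : (quenchedLaw ω x).map (Preorder.frestrictLe N) ⊗ₘ κ N =
      (quenchedLaw ω x).map (fun ξ => (Preorder.frestrictLe N ξ, ξ (N + 1))) :=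
    Kernel.map_frestrictLe_trajMeasure_compProd_eq_map_trajMeasure (X := fun _ => ℤ × Fin d)
      (μ₀ := Measure.dirac x) (κ := κ)
  have hG : Measurable (fun z : (Finset.Iic N → ℤ × Fin d) × (ℤ × Fin d) => F z.1 * g z.2) :=
    measurable_of_countable _
  have hm : Measurable (fun ξ : Traj d => ((Preorder.frestrictLe N ξ : Finset.Iic N → ℤ × Fin d),
      ξ (N + 1))) := by fun_prop
  have h1 := lintegral_map (μ := quenchedLaw ω x) hG hm
  have h3 : Measurable fun y : Finset.Iic N → ℤ × Fin d => F y * stepOp ω g (y ι) :=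
    measurable_of_countable _
  have hr : Measurable (Preorder.frestrictLe (π := fun _ : ℕ => ℤ × Fin d) N) := by fun_prop
  rw [← h, Measure.lintegral_compProd hG] at h1
  refine h1.symm.trans (Eq.trans ?_ (lintegral_map (μ := quenchedLaw ω x) h3 hr))
  refine lintegral_congr fun y => ?_
  change ∫⁻ b, F y * g b ∂(stepKernel ω (y ι)) = _
  rw [lintegral_const_mul _ hg, lintegral_stepKernel]

/-- The expectation of `g (ξ_N)` on the event that level `n` is not visited before time `N`. -/
theorem lintegral_survival (ω : Env d) (x : ℤ × Fin d) (n : ℤ) (N : ℕ)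
    (g : ℤ × Fin d → ℝ≥0∞) :
    ∫⁻ ξ, (if ∀ m < N, (ξ m).1 ≠ n then g (ξ N) else 0) ∂(quenchedLaw ω x)
      = (killedOp ω n)^[N] g x := by
  induction N generalizing g with
  | zero => simpa using lintegral_quenchedLaw_zero ω x g
  | succ N ih =>
    classical
    let F : (Finset.Iic N → ℤ × Fin d) → ℝ≥0∞ := fun y => if ∀ m, (y m).1 ≠ n then 1 else 0
    have hF : ∀ ξ : Traj d, F (Preorder.frestrictLe N ξ)
        = if ∀ m < N + 1, (ξ m).1 ≠ n then 1 else 0 := by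
      intro ξ
      refine if_congr ⟨fun h m hm => ?_, fun h m => ?_⟩ rfl rfl
      · exact h ⟨m, Finset.mem_Iic.2 (Nat.lt_succ_iff.1 hm)⟩
      · exact h m (Nat.lt_succ_iff.2 (Finset.mem_Iic.1 m.2))
    have h1 := lintegral_quenchedLaw_succ ω x N F g
    simp only [hF] at h1
    rw [Function.iterate_succ_apply, ← ih]
    convert h1 using 2 with ξ ξ
    · funext ξ
      split_ifs <;> simp
    · funext ξ
      simp only [Nat.forall_lt_succ_right, killedOp]
      by_cases h2 : ∀ m < N, (ξ m).1 ≠ n <;> by_cases h3 : (ξ N).1 = n <;> simp [h2, h3]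

theorem hitTime_eq_coe_iff (n : ℤ) (ξ : Traj d) (N : ℕ) :
    hitTime n ξ = N ↔ (∀ m < N, (ξ m).1 ≠ n) ∧ (ξ N).1 = n := by
  have hle : ∀ m : ℕ, (ξ m).1 = n → hitTime n ξ ≤ m := fun m hm => iInf₂_le m hm
  constructor
  · intro h
    have h1 : ∀ m < N, (ξ m).1 ≠ n := by
      intro m hm hm'
      have := hle m hm'
      rw [h] at this
      exact absurd (Nat.cast_le.1 this) (not_le.2 hm)
    refine ⟨h1, ?_⟩
    by_contra hN
    have h2 : ((N + 1 : ℕ) : ℕ∞) ≤ hitTime n ξ := by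
      refine le_iInf₂ fun m hm => Nat.cast_le.2 ?_
      by_contra hlt
      rcases Nat.lt_succ_iff_lt_or_eq.1 (not_le.1 hlt) with h3 | h3
      · exact h1 m h3 hm
      · exact hN (h3 ▸ hm)
    rw [h] at h2
    exact absurd (Nat.cast_le.1 h2) (by omega)
  · rintro ⟨h1, h2⟩
    refine le_antisymm (hle N h2) (le_iInf₂ fun m hm => Nat.cast_le.2 ?_)
    by_contra hlt
    exact h1 m (not_le.1 hlt) hm

theorem measurableSet_hitTime_eq (n : ℤ) (N : ℕ) :
    MeasurableSet {ξ : Traj d | hitTime n ξ = N} := by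
  have : {ξ : Traj d | hitTime n ξ = N}
      = (⋂ m ∈ Set.Iio N, {ξ : Traj d | (ξ m).1 ≠ n}) ∩ {ξ | (ξ N).1 = n} := by
    ext ξ
    simp [hitTime_eq_coe_iff]
  rw [this]
  have hm : ∀ m : ℕ, MeasurableSet {ξ : Traj d | (ξ m).1 = n} := fun m =>
    (measurable_fst.comp (measurable_pi_apply m)) (measurableSet_singleton n)
  exact (MeasurableSet.biInter (Set.to_countable _) fun m _ => (hm m).compl).inter (hm N)

theorem lintegral_hitTime_eq (ω : Env d) (x : ℤ × Fin d) (n : ℤ) (N : ℕ) (j : Fin d) :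
    ∫⁻ ξ, (open Classical in if hitTime n ξ = N ∧ (ξ N).2 = j then 1 else 0) ∂(quenchedLaw ω x)
      = hitProb ω n N x j := by
  rw [hitProb, ← lintegral_survival]
  refine lintegral_congr fun ξ => ?_
  simp only [hitTime_eq_coe_iff]
  by_cases h1 : ∀ m < N, (ξ m).1 ≠ n
  · rw [if_pos h1]
    refine if_congr ?_ rfl rfl
    rw [Prod.ext_iff]
    exact ⟨fun h => ⟨h.1.2, h.2⟩, fun h => ⟨⟨h1, h.1⟩, h.2⟩⟩
  · rw [if_neg h1, if_neg fun h => h1 h.1.1]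

theorem sum_hitProb (ω : Env d) (x : ℤ × Fin d) (n : ℤ) (N : ℕ) :
    ∑ j, hitProb ω n N x j = quenchedLaw ω x {ξ | hitTime n ξ = N} := by
  classical
  rw [← lintegral_indicator_one (measurableSet_hitTime_eq n N)]
  simp_rw [← lintegral_hitTime_eq]
  rw [← lintegral_finsetSum]
  · refine lintegral_congr fun ξ => ?_
    by_cases h : hitTime n ξ = N <;> simp [h]
  · intro j _
    refine Measurable.ite ?_ measurable_const measurable_const
    exact (measurableSet_hitTime_eq n N).inter
      ((measurable_snd.comp (measurable_pi_apply N)) (measurableSet_singleton j))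

end QuenchedLaw

/-! ### Generating functions of hitting times -/

section HittingGeneratingFunction

variable {d : ℕ}

theorem stepOp_mono {ω : Env d} {g g' : ℤ × Fin d → ℝ≥0∞} {x : ℤ × Fin d}
    (h : ∀ y : ℤ × Fin d, y.1 ≤ x.1 + 1 → g y ≤ g' y) : stepOp ω g x ≤ stepOp ω g' x := by
  unfold stepOp
  gcongr with j
  · exact h _ (by simp only; omega)
  · exact h _ (by simp only; omega)
  · exact h _ (by simp only; omega)

theorem stepOp_congr {ω : Env d} {g g' : ℤ × Fin d → ℝ≥0∞} {x : ℤ × Fin d}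
    (h : ∀ y : ℤ × Fin d, y.1 ≤ x.1 + 1 → g y = g' y) : stepOp ω g x = stepOp ω g' x :=
  le_antisymm (stepOp_mono fun y hy => (h y hy).le) (stepOp_mono fun y hy => (h y hy).ge)

theorem stepOp_finset_sum {ι : Type*} (s : Finset ι) (ω : Env d) (g : ι → ℤ × Fin d → ℝ≥0∞)
    (x : ℤ × Fin d) : stepOp ω (fun y => ∑ i ∈ s, g i y) x = ∑ i ∈ s, stepOp ω (g i) x := by
  simp_rw [← lintegral_stepKernel]
  exact lintegral_finsetSum _ fun i _ => measurable_of_countable _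

theorem stepOp_tsum (ω : Env d) (g : ℕ → ℤ × Fin d → ℝ≥0∞)
    (x : ℤ × Fin d) : stepOp ω (fun y => ∑' i, g i y) x = ∑' i, stepOp ω (g i) x := by
  simp_rw [← lintegral_stepKernel]
  exact lintegral_tsum fun i => (measurable_of_countable _).aemeasurable

theorem stepOp_mul_const (ω : Env d) (g : ℤ × Fin d → ℝ≥0∞) (c : ℝ≥0∞)
    (x : ℤ × Fin d) : stepOp ω (fun y => g y * c) x = stepOp ω g x * c := by
  simp_rw [← lintegral_stepKernel]
  exact lintegral_mul_const _ (measurable_of_countable _)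

theorem stepOp_const_mul (ω : Env d) (g : ℤ × Fin d → ℝ≥0∞) (c : ℝ≥0∞)
    (x : ℤ × Fin d) : stepOp ω (fun y => c * g y) x = c * stepOp ω g x := by
  simp_rw [← lintegral_stepKernel]
  exact lintegral_const_mul _ (measurable_of_countable _)

theorem hitProb_zero (ω : Env d) (n : ℤ) (x : ℤ × Fin d) (j : Fin d) :
    hitProb ω n 0 x j = if x = (n, j) then 1 else 0 := rfl

theorem hitProb_succ (ω : Env d) (n : ℤ) (N : ℕ) (x : ℤ × Fin d) (j : Fin d) :
    hitProb ω n (N + 1) x j = if x.1 = n then 0 else stepOp ω (fun y => hitProb ω n N y j) x := by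
  rw [hitProb, Function.iterate_succ_apply']
  rfl

theorem killedOp_iterate_mono {ω : Env d} {n n' : ℤ} (hn : n ≤ n') {g g' : ℤ × Fin d → ℝ≥0∞}
    (hg : ∀ y : ℤ × Fin d, y.1 ≤ n → g y ≤ g' y) (s : ℕ) (x : ℤ × Fin d) (hx : x.1 ≤ n) :
    (killedOp ω n)^[s] g x ≤ (killedOp ω n')^[s] g' x := by
  induction s generalizing x with
  | zero => exact hg x hx
  | succ s ih =>
    rw [Function.iterate_succ_apply', Function.iterate_succ_apply']
    unfold killedOp
    split_ifs with h1 h2 h2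
    · exact le_rfl
    · exact zero_le
    · omega
    · exact stepOp_mono fun y hy => ih y (by omega)

theorem killedOp_iterate_mul_const (ω : Env d) (n : ℤ) (g : ℤ × Fin d → ℝ≥0∞) (c : ℝ≥0∞) (s : ℕ)
    (x : ℤ × Fin d) :
    (killedOp ω n)^[s] (fun y => g y * c) x = (killedOp ω n)^[s] g x * c := by
  induction s generalizing x with
  | zero => rfl
  | succ s ih =>
    rw [Function.iterate_succ_apply', Function.iterate_succ_apply', killedOp, killedOp]
    split_ifs
    · simp
    · rw [← stepOp_mul_const]
      exact stepOp_congr fun y _ => ih y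

theorem killedOp_iterate_sum {ι : Type*} (t : Finset ι) (ω : Env d) (n : ℤ)
    (g : ι → ℤ × Fin d → ℝ≥0∞) (s : ℕ) (x : ℤ × Fin d) :
    (killedOp ω n)^[s] (fun y => ∑ i ∈ t, g i y) x = ∑ i ∈ t, (killedOp ω n)^[s] (g i) x := by
  induction s generalizing x with
  | zero => rfl
  | succ s ih =>
    simp_rw [Function.iterate_succ_apply', killedOp]
    split_ifs
    · simp
    · rw [← stepOp_finset_sum]
      exact stepOp_congr fun y _ => ih y

/-- On level `k` itself the hitting time of level `k` vanishes. -/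
theorem hitProb_decomposition_self (ω : Env d) (k n : ℤ) (N : ℕ) (i₀ j : Fin d) :
    hitProb ω n N (k, i₀) j = ∑ p ∈ Finset.HasAntidiagonal.antidiagonal N,
      ∑ i, hitProb ω k p.1 (k, i₀) i * hitProb ω n p.2 (k, i) j := by
  have h0 : ∀ a i, hitProb ω k a (k, i₀) i = if a = 0 ∧ i = i₀ then 1 else 0 := by
    intro a i
    cases a with
    | zero => rw [hitProb_zero]; simp [eq_comm]
    | succ a => rw [hitProb_succ]; simp
  simp only [h0, ite_mul, one_mul, zero_mul]
  rw [Finset.sum_eq_single (0, N)]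
  · simp
  · rintro ⟨a, b⟩ hab hne
    have : a ≠ 0 := by
      rintro rfl
      simp only [Finset.HasAntidiagonal.mem_antidiagonal, zero_add] at hab
      exact hne (by rw [hab])
    simp [this]
  · simp

/-- A path that starts below level `k ≤ n` reaches level `n` only through level `k`, and the walk
restarts afresh when it first hits level `k`. -/
theorem hitProb_decomposition (ω : Env d) {k n : ℤ} (hkn : k ≤ n) (N : ℕ) (x : ℤ × Fin d)
    (hx : x.1 ≤ k) (j : Fin d) :
    hitProb ω n N x j = ∑ p ∈ Finset.HasAntidiagonal.antidiagonal N,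
      ∑ i, hitProb ω k p.1 x i * hitProb ω n p.2 (k, i) j := by
  obtain ⟨m, i₀⟩ := x
  simp only at hx
  rcases hx.eq_or_lt with rfl | hx
  · exact hitProb_decomposition_self ω m n N i₀ j
  · induction N generalizing m i₀ with
    | zero =>
      have h1 : m ≠ n := by omega
      simp [hitProb_zero, Prod.ext_iff, h1, hx.ne]
    | succ N ih =>
      rw [Finset.Nat.sum_antidiagonal_succ, hitProb_succ, if_neg (by simp only; omega)]
      have h1 : ∀ i, hitProb ω k 0 (m, i₀) i = 0 := fun i => by
        simp [hitProb_zero, Prod.ext_iff, hx.ne]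
      simp only [h1, zero_mul, Finset.sum_const_zero, zero_add]
      simp_rw [hitProb_succ, if_neg (hx.ne : (m, i₀).1 ≠ k), ← stepOp_mul_const]
      simp_rw [← stepOp_finset_sum]
      refine stepOp_congr fun y hy => ?_
      obtain ⟨m', i'⟩ := y
      simp only at hy
      rcases (show m' ≤ k by omega).eq_or_lt with rfl | h2
      · exact hitProb_decomposition_self ω m' n N i' j
      · exact ih m' i' h2.le h2

/-- The exponential weight `e^{l N}`. -/
def expWeight (l : ℝ) (N : ℕ) : ℝ≥0∞ := ENNReal.ofReal (Real.exp (l * N))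

theorem expWeight_add (l : ℝ) (a b : ℕ) : expWeight l (a + b) = expWeight l a * expWeight l b := by
  rw [expWeight, expWeight, expWeight, ← ENNReal.ofReal_mul (Real.exp_pos _).le, ← Real.exp_add]
  push_cast
  ring_nf

theorem expWeight_zero_right (l : ℝ) : expWeight l 0 = 1 := by simp [expWeight]

theorem expWeight_mono {l l' : ℝ} (h : l ≤ l') (N : ℕ) : expWeight l N ≤ expWeight l' N :=
  ENNReal.ofReal_le_ofReal (Real.exp_le_exp.2 (mul_le_mul_of_nonneg_right h N.cast_nonneg))

theorem expWeight_ne_top (l : ℝ) (N : ℕ) : expWeight l N ≠ ⊤ := ENNReal.ofReal_ne_top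

theorem expWeight_ne_zero (l : ℝ) (N : ℕ) : expWeight l N ≠ 0 :=
  (ENNReal.ofReal_pos.2 (Real.exp_pos _)).ne'

theorem ENNReal_tsum_mul_tsum (u v : ℕ → ℝ≥0∞) :
    (∑' a, u a) * ∑' b, v b = ∑' N, ∑ p ∈ Finset.HasAntidiagonal.antidiagonal N, u p.1 * v p.2 := by
  calc (∑' a, u a) * ∑' b, v b = ∑' p : ℕ × ℕ, u p.1 * v p.2 := by
        rw [ENNReal.tsum_prod (f := fun a b => u a * v b), ← ENNReal.tsum_mul_right]
        exact tsum_congr fun a => ENNReal.tsum_mul_left.symm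
    _ = ∑' p : Σ N : ℕ, Finset.HasAntidiagonal.antidiagonal N, u p.2.1.1 * v p.2.1.2 := by
        rw [← Finset.HasAntidiagonal.sigmaAntidiagonalEquivProd.tsum_eq]
        rfl
    _ = _ := by
        rw [ENNReal.tsum_sigma']
        refine tsum_congr fun N => ?_
        rw [tsum_fintype]
        exact Finset.sum_coe_sort (Finset.HasAntidiagonal.antidiagonal N) (fun p : ℕ × ℕ => u p.1 * v p.2)

/-- The generating function `E_ω^x[e^{l T_n}; T_n < ∞, Y_{T_n} = j]`. -/
def hitGen (ω : Env d) (l : ℝ) (n : ℤ) (x : ℤ × Fin d) (j : Fin d) : ℝ≥0∞ :=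
  ∑' N, expWeight l N * hitProb ω n N x j

theorem hitGen_mono (ω : Env d) {l l' : ℝ} (h : l ≤ l') (n : ℤ) (x : ℤ × Fin d) (j : Fin d) :
    hitGen ω l n x j ≤ hitGen ω l' n x j :=
  ENNReal.tsum_le_tsum fun N => mul_le_mul_left (expWeight_mono h N) _

theorem hitGen_decomposition (ω : Env d) (l : ℝ) {k n : ℤ} (hkn : k ≤ n) (x : ℤ × Fin d)
    (hx : x.1 ≤ k) (j : Fin d) :
    hitGen ω l n x j = ∑ i, hitGen ω l k x i * hitGen ω l n (k, i) j := by
  unfold hitGen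
  simp_rw [ENNReal_tsum_mul_tsum]
  rw [← Summable.tsum_finsetSum fun i _ => ENNReal.summable]
  refine tsum_congr fun N => ?_
  rw [hitProb_decomposition ω hkn N x hx j, Finset.mul_sum, Finset.sum_comm]
  refine Finset.sum_congr rfl fun p hp => ?_
  rw [Finset.mul_sum]
  refine Finset.sum_congr rfl fun i _ => ?_
  rw [← Finset.HasAntidiagonal.mem_antidiagonal.1 hp, expWeight_add]
  ring

theorem hitGen_self (ω : Env d) (l : ℝ) (n : ℤ) (i j : Fin d) :
    hitGen ω l n (n, i) j = if i = j then 1 else 0 := by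
  rw [hitGen, tsum_eq_single 0]
  · simp [hitProb_zero, expWeight_zero_right]
  · intro N hN
    obtain ⟨N, rfl⟩ := Nat.exists_eq_succ_of_ne_zero hN
    simp [hitProb_succ]

/-- First-step analysis for the generating function. -/
theorem hitGen_eq_stepOp (ω : Env d) (l : ℝ) {n : ℤ} {x : ℤ × Fin d} (hx : x.1 ≠ n) (j : Fin d) :
    hitGen ω l n x j = expWeight l 1 * stepOp ω (fun y => hitGen ω l n y j) x := by
  unfold hitGen
  rw [tsum_eq_zero_add' ENNReal.summable, hitProb_zero, if_neg (fun h => hx (by rw [h])), mul_zero,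
    zero_add, stepOp_tsum, ← ENNReal.tsum_mul_left]
  refine tsum_congr fun N => ?_
  rw [hitProb_succ, if_neg hx, stepOp_const_mul, add_comm N 1, expWeight_add, mul_assoc]

theorem expHit_eq_tsum (l : ℝ) (n : ℤ) (ξ : Traj d) :
    expHit l n ξ = ∑' N : ℕ, (open Classical in if hitTime n ξ = N then expWeight l N else 0) := by
  classical
  rw [expHit]
  split_ifs with h
  · symm
    simp [h]
  · obtain ⟨M, hM⟩ := ENat.ne_top_iff_exists.1 h
    rw [tsum_eq_single M]
    · simp [← hM, expWeight]
    · intro N hN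
      rw [if_neg]
      rw [← hM]
      exact fun h => hN (Nat.cast_inj.1 h).symm

theorem measurableSet_hitTime_eq_and (n : ℤ) (N : ℕ) (j : Fin d) :
    MeasurableSet {ξ : Traj d | hitTime n ξ = N ∧ (ξ N).2 = j} :=
  (measurableSet_hitTime_eq n N).inter
    ((measurable_snd.comp (measurable_pi_apply N)) (measurableSet_singleton j))

theorem Phi_apply (ω : Env d) (l : ℝ) (k : ℤ) (i j : Fin d) :
    Phi ω l k i j = hitGen ω l (k + 1) (k, i) j := by
  classical
  rw [Phi, Matrix.of_apply, hitGen]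
  simp_rw [← lintegral_hitTime_eq]
  have hm : ∀ N : ℕ, Measurable fun ξ : Traj d =>
      (if hitTime (k + 1) ξ = N ∧ (ξ N).2 = j then 1 else 0 : ℝ≥0∞) := fun N =>
    Measurable.ite (measurableSet_hitTime_eq_and _ N j) measurable_const measurable_const
  simp_rw [← lintegral_const_mul _ (hm _)]
  rw [← lintegral_tsum fun N => ((hm N).const_mul _).aemeasurable]
  refine lintegral_congr fun ξ => ?_
  rw [expHit_eq_tsum]
  by_cases h : hitTime (k + 1) ξ = ⊤
  · simp [h]
  · obtain ⟨M, hM⟩ := ENat.ne_top_iff_exists.1 h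
    rw [← hM]
    simp only [Nat.cast_inj, ENat.toNat_natCast]
    rw [tsum_eq_single M (fun N hN => if_neg hN.symm),
      tsum_eq_single M (fun N hN => by rw [if_neg fun h => hN h.1.symm, mul_zero])]
    by_cases h2 : (ξ M).2 = j <;> simp [h2]

theorem lintegral_expHit (ω : Env d) (l : ℝ) (n : ℤ) (x : ℤ × Fin d) :
    ∫⁻ ξ, expHit l n ξ ∂(quenchedLaw ω x) = ∑ j, hitGen ω l n x j := by
  classical
  unfold hitGen
  rw [← Summable.tsum_finsetSum fun i _ => ENNReal.summable]
  simp_rw [← Finset.mul_sum, sum_hitProb, expHit_eq_tsum]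
  have hm : ∀ N : ℕ, Measurable fun ξ : Traj d =>
      (if hitTime n ξ = N then expWeight l N else 0 : ℝ≥0∞) := fun N =>
    Measurable.ite (measurableSet_hitTime_eq _ N) measurable_const measurable_const
  rw [lintegral_tsum fun N => (hm N).aemeasurable]
  refine tsum_congr fun N => ?_
  rw [← lintegral_indicator_const (measurableSet_hitTime_eq n N)]
  refine lintegral_congr fun ξ => ?_
  simp [Set.indicator_apply]

theorem quenchedMGF_eq (ω : Env d) (π : PMF (Fin d)) (l : ℝ) (n : ℕ) :
    quenchedMGF ω π l n = ∑ i, π i * ∑ j, hitGen ω l n (0, i) j := by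
  rw [quenchedMGF, quenchedLawInit, lintegral_finsetSum_measure]
  simp_rw [lintegral_smul_measure, lintegral_expHit, smul_eq_mul]

theorem quenchedLaw_scaledHitEvent (ω : Env d) (x : ℤ × Fin d) (n : ℕ) (A : Set ℝ) :
    quenchedLaw ω x (scaledHitEvent n A) =
      ∑' N : ℕ, (open Classical in
        if (N : ℝ) / n ∈ A then ∑ j, hitProb ω n N x j else 0) := by
  classical
  have h : scaledHitEvent n A =
      ⋃ N : ℕ, (if (N : ℝ) / n ∈ A then {ξ : Traj d | hitTime n ξ = N} else ∅) := by
    ext ξ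
    simp only [scaledHitEvent, Set.mem_ofPred_eq, Set.mem_iUnion]
    refine exists_congr fun N => ?_
    split_ifs with h <;> simp [h]
  rw [h, measure_iUnion]
  · refine tsum_congr fun N => ?_
    split_ifs
    · rw [sum_hitProb]
    · simp
  · intro N N' hN
    refine Set.disjoint_left.2 fun ξ h1 h2 => hN ?_
    simp only at h1 h2
    split_ifs at h1 h2 <;> simp_all
  · intro N
    split_ifs
    · exact measurableSet_hitTime_eq _ _
    · exact MeasurableSet.empty

/-- The probability `P_ω^π(T_n = N)`. -/
def hitLaw (ω : Env d) (π : PMF (Fin d)) (n N : ℕ) : ℝ≥0∞ :=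
  ∑ i, π i * ∑ j, hitProb ω n N (0, i) j

theorem quenchedLawInit_scaledHitEvent (ω : Env d) (π : PMF (Fin d)) (n : ℕ) (A : Set ℝ) :
    quenchedLawInit ω π (scaledHitEvent n A) =
      ∑' N : ℕ, (open Classical in if (N : ℝ) / n ∈ A then hitLaw ω π n N else 0) := by
  classical
  rw [quenchedLawInit, Measure.finsetSum_apply]
  simp_rw [Measure.smul_apply, quenchedLaw_scaledHitEvent, smul_eq_mul, ← ENNReal.tsum_mul_left]
  rw [← Summable.tsum_finsetSum fun i _ => ENNReal.summable]
  refine tsum_congr fun N => ?_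
  split_ifs
  · rfl
  · simp

theorem quenchedMGF_eq_tsum (ω : Env d) (π : PMF (Fin d)) (l : ℝ) (n : ℕ) :
    quenchedMGF ω π l n = ∑' N, expWeight l N * hitLaw ω π n N := by
  rw [quenchedMGF_eq]
  unfold hitLaw hitGen
  simp_rw [← Summable.tsum_finsetSum (fun i _ => ENNReal.summable), ← ENNReal.tsum_mul_left]
  rw [← Summable.tsum_finsetSum fun i _ => ENNReal.summable]
  refine tsum_congr fun N => ?_
  rw [Finset.mul_sum]
  refine Finset.sum_congr rfl fun i _ => ?_
  rw [Finset.mul_sum, Finset.mul_sum, Finset.mul_sum]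
  exact Finset.sum_congr rfl fun j _ => by ring

theorem PhiProd_zero (ω : Env d) (l : ℝ) (m : ℤ) : PhiProd ω l m 0 = 1 := by
  simp [PhiProd]

theorem PhiProd_succ (ω : Env d) (l : ℝ) (m : ℤ) (n : ℕ) :
    PhiProd ω l m (n + 1) = PhiProd ω l m n * Phi ω l (m + n) := by
  simp [PhiProd, List.range_succ]

theorem PhiProd_apply (ω : Env d) (l : ℝ) (m : ℤ) (n : ℕ) (i j : Fin d) :
    PhiProd ω l m n i j = hitGen ω l (m + n) (m, i) j := by
  induction n generalizing j with
  | zero =>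
    rw [PhiProd_zero]
    simp only [Nat.cast_zero, add_zero, hitGen_self, Matrix.one_apply]
  | succ n ih =>
    rw [PhiProd_succ, Matrix.mul_apply]
    simp_rw [ih, Phi_apply]
    push_cast
    rw [← add_assoc, hitGen_decomposition ω l (k := m + n) (by omega) _ (by simp)]

theorem quenchedMGF_eq_dotProduct (ω : Env d) (π : PMF (Fin d)) (l : ℝ) (n : ℕ) :
    quenchedMGF ω π l n = (fun i => π i) ⬝ᵥ (PhiProd ω l 0 n *ᵥ (fun _ => 1)) := by
  rw [quenchedMGF_eq]
  simp [dotProduct, Matrix.mulVec, PhiProd_apply]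

theorem quenchedMGF_zero (ω : Env d) (π : PMF (Fin d)) (l : ℝ) : quenchedMGF ω π l 0 = 1 := by
  rw [quenchedMGF_eq_dotProduct, PhiProd_zero, Matrix.one_mulVec]
  have h := π.tsum_coe
  rw [tsum_fintype] at h
  simpa [dotProduct] using h

theorem sum_tsum_hitProb_le_one (ω : Env d) (n : ℤ) (x : ℤ × Fin d) :
    ∑' N, ∑ j, hitProb ω n N x j ≤ 1 := by
  simp_rw [sum_hitProb]
  rw [← measure_iUnion]
  · exact prob_le_one
  · intro N N' hN
    refine Set.disjoint_left.2 fun ξ h1 h2 => hN ?_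
    simp_all
  · exact fun N => measurableSet_hitTime_eq _ _

theorem sum_hitGen_le_one (ω : Env d) {l : ℝ} (hl : l ≤ 0) (n : ℤ) (x : ℤ × Fin d) :
    ∑ j, hitGen ω l n x j ≤ 1 := by
  unfold hitGen
  rw [← Summable.tsum_finsetSum fun i _ => ENNReal.summable]
  refine le_trans (ENNReal.tsum_le_tsum fun N => Finset.sum_le_sum fun j _ => ?_)
    (sum_tsum_hitProb_le_one ω n x)
  have h : expWeight l N ≤ 1 := by
    rw [expWeight, ENNReal.ofReal_le_one, Real.exp_le_one_iff]
    exact mul_nonpos_of_nonpos_of_nonneg hl N.cast_nonneg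
  exact mul_le_of_le_one_left zero_le h

/-- The environment `ω` seen from level `k`. -/
def translate (k : ℤ) (ω : Env d) : Env d := fun m => ω (m + k)

theorem stepOp_translate (k : ℤ) (ω : Env d) (g : ℤ × Fin d → ℝ≥0∞) (m : ℤ) (i : Fin d) :
    stepOp (translate k ω) (fun y => g (y.1 + k, y.2)) (m, i) = stepOp ω g (m + k, i) := by
  unfold stepOp translate
  refine Finset.sum_congr rfl fun j _ => ?_
  simp only
  rw [sub_add_eq_add_sub, add_right_comm m 1 k]

theorem hitProb_translate (k : ℤ) (ω : Env d) (n : ℤ) (N : ℕ) (m : ℤ) (i j : Fin d) :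
    hitProb (translate k ω) n N (m, i) j = hitProb ω (n + k) N (m + k, i) j := by
  induction N generalizing m i with
  | zero => simp [hitProb_zero]
  | succ N ih =>
    rw [hitProb_succ, hitProb_succ]
    simp only [add_left_inj]
    split_ifs
    · rfl
    · rw [← stepOp_translate]
      exact stepOp_congr fun y _ => ih y.1 y.2

theorem hitGen_translate (k : ℤ) (ω : Env d) (l : ℝ) (n m : ℤ) (i j : Fin d) :
    hitGen (translate k ω) l n (m, i) j = hitGen ω l (n + k) (m + k, i) j := by
  simp_rw [hitGen, hitProb_translate]

theorem Phi_translate (k : ℤ) (ω : Env d) (l : ℝ) (m : ℤ) :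
    Phi (translate k ω) l m = Phi ω l (m + k) := by
  ext i j
  rw [Phi_apply, Phi_apply, hitGen_translate, add_right_comm]

theorem measurable_stepOp {g : Env d → ℤ × Fin d → ℝ≥0∞} (hg : ∀ y, Measurable fun ω => g ω y)
    (x : ℤ × Fin d) : Measurable fun ω => stepOp ω (g ω) x := by
  unfold stepOp
  refine Finset.measurable_sum _ fun j _ => ?_
  have h1 : Measurable fun ω : Env d => (ω x.1).1 :=
    measurable_subtype_coe.comp (measurable_pi_apply x.1)
  have hq : Measurable fun ω : Env d => (ω x.1).q x.2 j :=
    (measurable_pi_apply j).comp ((measurable_pi_apply x.2).comp h1.fst)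
  have hr : Measurable fun ω : Env d => (ω x.1).r x.2 j :=
    (measurable_pi_apply j).comp ((measurable_pi_apply x.2).comp h1.snd.fst)
  have hp : Measurable fun ω : Env d => (ω x.1).p x.2 j :=
    (measurable_pi_apply j).comp ((measurable_pi_apply x.2).comp h1.snd.snd)
  exact ((hq.ennreal_ofReal.mul (hg _)).add (hr.ennreal_ofReal.mul (hg _))).add
    (hp.ennreal_ofReal.mul (hg _))

theorem measurable_hitProb (n : ℤ) (N : ℕ) (x : ℤ × Fin d) (j : Fin d) :
    Measurable fun ω => hitProb ω n N x j := by
  induction N generalizing x with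
  | zero => exact measurable_const
  | succ N ih =>
    simp_rw [hitProb_succ]
    split_ifs
    · exact measurable_const
    · exact measurable_stepOp ih x

theorem measurable_hitGen (l : ℝ) (n : ℤ) (x : ℤ × Fin d) (j : Fin d) :
    Measurable fun ω => hitGen ω l n x j :=
  Measurable.tsum fun N => (measurable_hitProb n N x j).const_mul _

theorem measurable_Phi (l : ℝ) (k : ℤ) (i j : Fin d) : Measurable fun ω => Phi ω l k i j := by
  simp_rw [Phi_apply]
  exact measurable_hitGen _ _ _ _

theorem measurable_PhiProd (l : ℝ) (m : ℤ) (n : ℕ) (i j : Fin d) :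
    Measurable fun ω => PhiProd ω l m n i j := by
  simp_rw [PhiProd_apply]
  exact measurable_hitGen _ _ _ _

end HittingGeneratingFunction

/-! ### Uniform bounds from ellipticity -/

section Ellipticity

variable {d : ℕ}

namespace IsElliptic

variable {κ : ℝ} {s : LevelTransitions d}

theorem r_row_sum_le (h : IsElliptic κ s) (i : Fin d) : ∑ j, s.r i j ≤ 1 - 2 * κ := by
  have h1 : ∑ j, (s.q i j + s.r i j + s.p i j) = 1 := s.2.2 i
  rw [Finset.sum_add_distrib, Finset.sum_add_distrib] at h1
  linarith [h.1 i, h.2.1 i]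

/-- The minimum principle for `1 - r`. -/
theorem nonneg_of_mulVec_nonneg (h : IsElliptic κ s) (hκ : 0 < κ) {x : Fin d → ℝ}
    (hx : ∀ i, 0 ≤ ((1 - s.r) *ᵥ x) i) (i : Fin d) : 0 ≤ x i := by
  obtain ⟨i₀, -, hi₀⟩ := Finset.exists_min_image Finset.univ x ⟨i, Finset.mem_univ i⟩
  refine le_trans ?_ (hi₀ i (Finset.mem_univ i))
  by_contra hneg
  have h1 := hx i₀
  rw [Matrix.sub_mulVec, Matrix.one_mulVec, Pi.sub_apply] at h1
  have h2 : (∑ j, s.r i₀ j) * x i₀ ≤ (s.r *ᵥ x) i₀ := by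
    rw [Finset.sum_mul]
    exact Finset.sum_le_sum fun j _ =>
      mul_le_mul_of_nonneg_left (hi₀ j (Finset.mem_univ j)) (s.2.1 i₀ j).2.1
  nlinarith [h.r_row_sum_le i₀]

theorem isUnit_det (h : IsElliptic κ s) (hκ : 0 < κ) : IsUnit (1 - s.r).det := by
  rw [← Matrix.isUnit_iff_isUnit_det, ← Matrix.mulVec_injective_iff_isUnit]
  intro x y hxy
  have h0 : (1 - s.r) *ᵥ (x - y) = 0 := by rw [Matrix.mulVec_sub]; exact sub_eq_zero.2 hxy
  have h0' : (1 - s.r) *ᵥ (y - x) = 0 := by rw [Matrix.mulVec_sub]; exact sub_eq_zero.2 hxy.symm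
  funext i
  have h1 := h.nonneg_of_mulVec_nonneg hκ (x := x - y) (fun i => by simp [h0]) i
  have h2 := h.nonneg_of_mulVec_nonneg hκ (x := y - x) (fun i => by simp [h0']) i
  simp only [Pi.sub_apply] at h1 h2
  linarith

/-- A supersolution of `x = r x + y` dominates the solution. -/
theorem inv_mulVec_le (h : IsElliptic κ s) (hκ : 0 < κ) {x y : Fin d → ℝ}
    (hx : ∀ i, (s.r *ᵥ x) i + y i ≤ x i) (i : Fin d) : ((1 - s.r)⁻¹ *ᵥ y) i ≤ x i := by
  have h1 := h.nonneg_of_mulVec_nonneg hκ (x := x - (1 - s.r)⁻¹ *ᵥ y) (fun i => by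
    rw [Matrix.mulVec_sub, Matrix.mulVec_mulVec, Matrix.mul_nonsing_inv _ (h.isUnit_det hκ),
      Matrix.one_mulVec, Matrix.sub_mulVec, Matrix.one_mulVec]
    simp only [Pi.sub_apply]
    linarith [hx i]) i
  simpa using h1

theorem inv_mulVec_eq (h : IsElliptic κ s) (hκ : 0 < κ) (y : Fin d → ℝ) (i : Fin d) :
    ((1 - s.r)⁻¹ *ᵥ y) i = (s.r *ᵥ ((1 - s.r)⁻¹ *ᵥ y)) i + y i := by
  have h1 : (1 - s.r) *ᵥ ((1 - s.r)⁻¹ *ᵥ y) = y := by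
    rw [Matrix.mulVec_mulVec, Matrix.mul_nonsing_inv _ (h.isUnit_det hκ), Matrix.one_mulVec]
  rw [Matrix.sub_mulVec, Matrix.one_mulVec] at h1
  have h2 := congrFun h1 i
  simp only [Pi.sub_apply] at h2
  linarith

end IsElliptic

theorem Phi_recursion (ω : Env d) (l : ℝ) (k : ℤ) (i j : Fin d) :
    Phi ω l k i j = expWeight l 1 * ∑ a,
      (ENNReal.ofReal ((ω k).q i a) * (∑ b, Phi ω l (k - 1) a b * Phi ω l k b j) +
       ENNReal.ofReal ((ω k).r i a) * Phi ω l k a j +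
       ENNReal.ofReal ((ω k).p i a) * if a = j then 1 else 0) := by
  rw [Phi_apply, hitGen_eq_stepOp ω l (by simp), stepOp]
  congr 1
  refine Finset.sum_congr rfl fun a _ => ?_
  simp only
  rw [hitGen_self, hitGen_decomposition ω l (k := k) (n := k + 1) (by omega) _ (by simp)]
  simp_rw [Phi_apply, sub_add_cancel]

/-- The first-step equation between finite passage matrices, in real numbers. -/
theorem toReal_Phi_recursion {ω : Env d} {l : ℝ} {k : ℤ} (hk : ∀ i j, Phi ω l k i j ≠ ⊤)
    (hk' : ∀ i j, Phi ω l (k - 1) i j ≠ ⊤) (i j : Fin d) :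
    (Phi ω l k i j).toReal = Real.exp l * ∑ a,
      ((ω k).q i a * (∑ b, (Phi ω l (k - 1) a b).toReal * (Phi ω l k b j).toReal) +
       (ω k).r i a * (Phi ω l k a j).toReal + (ω k).p i a * if a = j then 1 else 0) := by
  obtain ⟨φ, hφ⟩ : ∃ φ : Fin d → Fin d → ℝ, φ = fun i j => (Phi ω l k i j).toReal := ⟨_, rfl⟩
  obtain ⟨ψ, hψ⟩ : ∃ ψ : Fin d → Fin d → ℝ, ψ = fun i j => (Phi ω l (k - 1) i j).toReal :=
    ⟨_, rfl⟩
  have hφ0 : ∀ i j, 0 ≤ φ i j := fun i j => by rw [hφ]; exact ENNReal.toReal_nonneg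
  have hψ0 : ∀ i j, 0 ≤ ψ i j := fun i j => by rw [hψ]; exact ENNReal.toReal_nonneg
  have h1 : ∀ i j, Phi ω l k i j = ENNReal.ofReal (φ i j) := fun i j => by
    rw [hφ, ENNReal.ofReal_toReal (hk i j)]
  have h2 : ∀ i j, Phi ω l (k - 1) i j = ENNReal.ofReal (ψ i j) := fun i j => by
    rw [hψ, ENNReal.ofReal_toReal (hk' i j)]
  have hq : ∀ a, 0 ≤ (ω k).q i a := fun a => ((ω k).2.1 i a).1
  have hr : ∀ a, 0 ≤ (ω k).r i a := fun a => ((ω k).2.1 i a).2.1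
  have hp : ∀ a, 0 ≤ (ω k).p i a := fun a => ((ω k).2.1 i a).2.2
  have hS : ∀ a, 0 ≤ ∑ b, ψ a b * φ b j := fun a =>
    Finset.sum_nonneg fun b _ => mul_nonneg (hψ0 a b) (hφ0 b j)
  have hI : ∀ a, (0 : ℝ) ≤ if a = j then 1 else 0 := fun a => by split_ifs <;> simp
  have hT : ∀ a, 0 ≤ (ω k).q i a * (∑ b, ψ a b * φ b j) + (ω k).r i a * φ a j +
      (ω k).p i a * if a = j then 1 else 0 := fun a =>
    add_nonneg (add_nonneg (mul_nonneg (hq a) (hS a)) (mul_nonneg (hr a) (hφ0 a j)))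
      (mul_nonneg (hp a) (hI a))
  have hrec := Phi_recursion ω l k i j
  simp only [h1, h2] at hrec
  have hrhs : expWeight l 1 * ∑ a, (ENNReal.ofReal ((ω k).q i a) *
        (∑ b, ENNReal.ofReal (ψ a b) * ENNReal.ofReal (φ b j)) +
        ENNReal.ofReal ((ω k).r i a) * ENNReal.ofReal (φ a j) +
        ENNReal.ofReal ((ω k).p i a) * if a = j then 1 else 0) =
      ENNReal.ofReal (Real.exp l * ∑ a, ((ω k).q i a * (∑ b, ψ a b * φ b j) +
        (ω k).r i a * φ a j + (ω k).p i a * if a = j then 1 else 0)) := by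
    rw [ENNReal.ofReal_mul (Real.exp_pos l).le, ENNReal.ofReal_sum_of_nonneg fun a _ => hT a]
    congr 1
    · simp [expWeight]
    · refine Finset.sum_congr rfl fun a _ => ?_
      rw [ENNReal.ofReal_add (add_nonneg (mul_nonneg (hq a) (hS a)) (mul_nonneg (hr a) (hφ0 a j)))
        (mul_nonneg (hp a) (hI a)), ENNReal.ofReal_add (mul_nonneg (hq a) (hS a))
        (mul_nonneg (hr a) (hφ0 a j)), ENNReal.ofReal_mul (hq a), ENNReal.ofReal_mul (hr a),
        ENNReal.ofReal_mul (hp a), ENNReal.ofReal_sum_of_nonneg fun b _ =>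
          mul_nonneg (hψ0 a b) (hφ0 b j)]
      congr 2
      · congr 1
        exact Finset.sum_congr rfl fun b _ => (ENNReal.ofReal_mul (hψ0 a b)).symm
      · split_ifs <;> simp
  rw [hrhs, ENNReal.ofReal_eq_ofReal_iff (hφ0 i j) (mul_nonneg (Real.exp_pos l).le
    (Finset.sum_nonneg fun a _ => hT a))] at hrec
  rw [h1 i j, ENNReal.toReal_ofReal (hφ0 i j), hrec]
  simp only [h1, h2, ENNReal.toReal_ofReal (hφ0 _ _), ENNReal.toReal_ofReal (hψ0 _ _)]

/-- Dropping the excursions to the left from the first-step equation. -/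
theorem toReal_Phi_ge {ω : Env d} {l : ℝ} {k : ℤ} (hk : ∀ i j, Phi ω l k i j ≠ ⊤)
    (hk' : ∀ i j, Phi ω l (k - 1) i j ≠ ⊤) (i j : Fin d) :
    Real.exp l * (((ω k).r *ᵥ fun a => (Phi ω l k a j).toReal) i + (ω k).p i j) ≤
      (Phi ω l k i j).toReal := by
  rw [toReal_Phi_recursion hk hk' i j]
  refine mul_le_mul_of_nonneg_left ?_ (Real.exp_pos l).le
  rw [Finset.sum_add_distrib, Finset.sum_add_distrib]
  have h1 : 0 ≤ ∑ a, (ω k).q i a *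
      (∑ b, (Phi ω l (k - 1) a b).toReal * (Phi ω l k b j).toReal) :=
    Finset.sum_nonneg fun a _ => mul_nonneg ((ω k).2.1 i a).1
      (Finset.sum_nonneg fun b _ => mul_nonneg ENNReal.toReal_nonneg ENNReal.toReal_nonneg)
  have h2 : ∑ a, (ω k).p i a * (if a = j then 1 else 0) = (ω k).p i j := by simp
  rw [h2]
  have h3 : ((ω k).r *ᵥ fun a => (Phi ω l k a j).toReal) i
    = ∑ a, (ω k).r i a * (Phi ω l k a j).toReal := rfl
  rw [h3]
  linarith

theorem Phi_le_one (ω : Env d) {l : ℝ} (hl : l ≤ 0) (k : ℤ) (i j : Fin d) : Phi ω l k i j ≤ 1 := by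
  rw [Phi_apply]
  exact (Finset.single_le_sum (f := fun j => hitGen ω l (k + 1) (k, i) j)
    (fun _ _ => zero_le) (Finset.mem_univ j)).trans (sum_hitGen_le_one ω hl _ _)

theorem Phi_mono (ω : Env d) {l l' : ℝ} (h : l ≤ l') (k : ℤ) (i j : Fin d) :
    Phi ω l k i j ≤ Phi ω l' k i j := by
  rw [Phi_apply, Phi_apply]
  exact hitGen_mono ω h _ _ _

/-- For `l ≤ 0` the walk reaches the next level without visiting the previous one, within `N` steps
and at height `j`, with probability at least `κ - (1 - 2κ)^N`, and on this event the weight is at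
least `e^{l N}`. -/
theorem Phi_ge_of_nonpos {ω : Env d} {κ : ℝ} (hκ : 0 < κ) {k : ℤ} (h : IsElliptic κ (ω k)) {l : ℝ}
    (hl : l ≤ 0) (N : ℕ) (i j : Fin d) :
    ENNReal.ofReal (Real.exp (l * N) * (κ - (1 - 2 * κ) ^ N)) ≤ Phi ω l k i j := by
  have hfin : ∀ m i j, Phi ω l m i j ≠ ⊤ := fun m i j =>
    ((Phi_le_one ω hl m i j).trans_lt ENNReal.one_lt_top).ne
  set u : Fin d → ℝ := (1 - (ω k).r)⁻¹ *ᵥ fun a => (ω k).p a j with hu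
  have hκu : ∀ i, κ ≤ u i := fun i => h.2.2.2 i j
  have hp : ∀ i, 0 ≤ (ω k).p i j := fun i => ((ω k).2.1 i j).2.2
  have hr : ∀ i a, 0 ≤ (ω k).r i a := fun i a => ((ω k).2.1 i a).2.1
  have hq : ∀ i a, 0 ≤ (ω k).q i a := fun i a => ((ω k).2.1 i a).1
  have ha : 0 ≤ 1 - 2 * κ := (Finset.sum_nonneg fun a _ => hr i a).trans (h.r_row_sum_le i)
  have hu1 : ∀ i, u i ≤ 1 := fun i => h.inv_mulVec_le hκ (x := fun _ => 1) (fun i => by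
    have h1 : ∑ a, ((ω k).q i a + (ω k).r i a + (ω k).p i a) = 1 := (ω k).2.2 i
    rw [Finset.sum_add_distrib, Finset.sum_add_distrib] at h1
    have h2 : (ω k).p i j ≤ ∑ a, (ω k).p i a :=
      Finset.single_le_sum (f := fun a => (ω k).p i a) (fun a _ => ((ω k).2.1 i a).2.2)
        (Finset.mem_univ j)
    have h3 : ((ω k).r *ᵥ fun _ => (1 : ℝ)) i = ∑ a, (ω k).r i a := by
      simp [Matrix.mulVec, dotProduct]
    rw [h3]
    linarith [Finset.sum_nonneg fun a (_ : a ∈ Finset.univ) => hq i a]) i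
  have key : ∀ N : ℕ, ∀ i, Real.exp (l * N) * (u i - (1 - 2 * κ) ^ N) ≤
      (Phi ω l k i j).toReal := by
    intro N
    induction N with
    | zero =>
      intro i
      simp only [CharP.cast_eq_zero, mul_zero, Real.exp_zero, pow_zero, one_mul]
      linarith [hu1 i, (ENNReal.toReal_nonneg : 0 ≤ (Phi ω l k i j).toReal)]
    | succ N ih =>
      intro i
      refine le_trans ?_ (toReal_Phi_ge (hfin k) (hfin (k - 1)) i j)
      have h1 : Real.exp (l * (N + 1 : ℕ)) = Real.exp l * Real.exp (l * N) := by
        rw [← Real.exp_add]; push_cast; ring_nf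
      rw [h1, mul_assoc]
      refine mul_le_mul_of_nonneg_left ?_ (Real.exp_pos l).le
      have h2 : Real.exp (l * N) ≤ 1 :=
        Real.exp_le_one_iff.2 (mul_nonpos_of_nonpos_of_nonneg hl N.cast_nonneg)
      have h3 : ∑ a, (ω k).r i a * (Real.exp (l * N) * (u a - (1 - 2 * κ) ^ N)) ≤
          ((ω k).r *ᵥ fun a => (Phi ω l k a j).toReal) i :=
        Finset.sum_le_sum fun a _ => mul_le_mul_of_nonneg_left (ih a) (hr i a)
      have h4 : ∑ a, (ω k).r i a * (Real.exp (l * N) * (u a - (1 - 2 * κ) ^ N)) =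
          Real.exp (l * N) * (((ω k).r *ᵥ u) i - (∑ a, (ω k).r i a) * (1 - 2 * κ) ^ N) := by
        have : ((ω k).r *ᵥ u) i = ∑ a, (ω k).r i a * u a := rfl
        rw [this, Finset.sum_mul, ← Finset.sum_sub_distrib, Finset.mul_sum]
        exact Finset.sum_congr rfl fun a _ => by ring
      have h5 := h.inv_mulVec_eq hκ (fun a => (ω k).p a j) i
      rw [← hu] at h5
      have h6 : (∑ a, (ω k).r i a) * (1 - 2 * κ) ^ N ≤ (1 - 2 * κ) ^ (N + 1) := by
        rw [pow_succ, mul_comm]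
        exact mul_le_mul_of_nonneg_left (h.r_row_sum_le i) (pow_nonneg ha N)
      have h7 : Real.exp (l * N) * (ω k).p i j ≤ (ω k).p i j :=
        mul_le_of_le_one_left (hp i) h2
      have h8 := mul_le_mul_of_nonneg_left h6 (Real.exp_pos (l * N)).le
      rw [h5]
      nlinarith
  refine ENNReal.ofReal_le_of_le_toReal (le_trans ?_ (key N i))
  exact mul_le_mul_of_nonneg_left (by linarith [hκu i]) (Real.exp_pos _).le

/-- A lower bound for all passage matrices, uniform over elliptic environments and over parameters
`l ≥ -R`. -/
theorem exists_Phi_lower_bound {κ : ℝ} (hκ : 0 < κ) (hd : 0 < d) (R : ℝ) :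
    ∃ c : ℝ, 0 < c ∧ ∀ (ω : Env d) (k : ℤ), IsElliptic κ (ω k) → ∀ l : ℝ, -R ≤ l → ∀ i j,
      ENNReal.ofReal c ≤ Phi ω l k i j := by
  by_cases hκ2 : κ ≤ 1 / 2
  · obtain ⟨N, hN⟩ := exists_pow_lt_of_lt_one (half_pos hκ) (show 1 - 2 * κ < 1 by linarith)
    refine ⟨Real.exp (-|R| * N) * (κ / 2), by positivity, fun ω k h l hl i j => ?_⟩
    have h1 : -|R| ≤ min l 0 := le_min ((neg_le_neg (le_abs_self R)).trans hl)
      (neg_nonpos.2 (abs_nonneg R))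
    refine le_trans (ENNReal.ofReal_le_ofReal ?_)
      ((Phi_ge_of_nonpos hκ h (min_le_right l 0) N i j).trans (Phi_mono ω (min_le_left l 0) k i j))
    refine mul_le_mul (Real.exp_le_exp.2 (mul_le_mul_of_nonneg_right h1 N.cast_nonneg))
      (by linarith) (by positivity) (Real.exp_pos _).le
  · -- No environment is elliptic with a constant above `1/2`.
    refine ⟨1, one_pos, fun ω k h => ?_⟩
    have h1 := h.r_row_sum_le ⟨0, hd⟩
    have h2 : 0 ≤ ∑ j, (ω k).r ⟨0, hd⟩ j := Finset.sum_nonneg fun a _ => ((ω k).2.1 _ a).2.1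
    linarith

/-- For `l ≥ 0`, finiteness of the passage matrices at two consecutive levels forces a bound on the
lower one that depends only on the ellipticity constant: otherwise the excursions to the left alone
would make the matrix at the upper level infinite. -/
theorem Phi_le_of_finite {ω : Env d} {κ : ℝ} (hκ : 0 < κ) {k : ℤ} (h : IsElliptic κ (ω k)) {l : ℝ}
    (hl : 0 ≤ l) (hk : ∀ i j, Phi ω l k i j ≠ ⊤) (hk' : ∀ i j, Phi ω l (k - 1) i j ≠ ⊤)
    (i j : Fin d) : Phi ω l (k - 1) i j ≤ ENNReal.ofReal (1 / κ) := by
  set x : Fin d → ℝ := fun a => (Phi ω l k a j).toReal with hx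
  have hx0 : ∀ a, 0 ≤ x a := fun a => ENNReal.toReal_nonneg
  have hp : ∀ i, 0 ≤ (ω k).p i j := fun i => ((ω k).2.1 i j).2.2
  have hr : ∀ i a, 0 ≤ (ω k).r i a := fun i a => ((ω k).2.1 i a).2.1
  have hq : ∀ i a, 0 ≤ (ω k).q i a := fun i a => ((ω k).2.1 i a).1
  have hexp : 1 ≤ Real.exp l := Real.one_le_exp hl
  have hrx : ∀ i, 0 ≤ ((ω k).r *ᵥ x) i := fun i =>
    show 0 ≤ ∑ a, (ω k).r i a * x a from
      Finset.sum_nonneg fun a _ => mul_nonneg (hr i a) (hx0 a)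
  have hxκ : ∀ a, κ ≤ x a := by
    intro a
    have h1 := h.inv_mulVec_le hκ (x := x) (y := fun b => (ω k).p b j) (fun b => by
      refine le_trans ?_ (toReal_Phi_ge hk hk' b j)
      exact le_mul_of_one_le_left (add_nonneg (hrx b) (hp b)) hexp) a
    exact (h.2.2.2 a j).trans h1
  set F : Fin d → Fin d → ℝ := fun a b => (Phi ω l (k - 1) a b).toReal with hF
  have hF0 : ∀ a b, 0 ≤ F a b := fun a b => ENNReal.toReal_nonneg
  obtain ⟨b₀, -, hb₀⟩ := Finset.exists_min_image Finset.univ x ⟨i, Finset.mem_univ i⟩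
  have hFx : ∀ a, 0 ≤ ∑ b, F a b * x b := fun a =>
    Finset.sum_nonneg fun b _ => mul_nonneg (hF0 a b) (hx0 b)
  have hsup : ∀ b, ((ω k).r *ᵥ x) b + ((ω k).q *ᵥ fun a => ∑ c, F a c * x c) b ≤ x b := by
    intro b
    have hqF : 0 ≤ ((ω k).q *ᵥ fun a => ∑ c, F a c * x c) b :=
      show 0 ≤ ∑ a, (ω k).q b a * ∑ c, F a c * x c from
        Finset.sum_nonneg fun a _ => mul_nonneg (hq b a) (hFx a)
    have h1 := toReal_Phi_recursion hk hk' b j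
    rw [Finset.sum_add_distrib, Finset.sum_add_distrib] at h1
    have h2 : ∑ a, (ω k).p b a * (if a = j then 1 else 0) = (ω k).p b j := by simp
    rw [h2] at h1
    change x b = Real.exp l * (((ω k).q *ᵥ fun a => ∑ c, F a c * x c) b + ((ω k).r *ᵥ x) b
      + (ω k).p b j) at h1
    rw [h1]
    nlinarith [hrx b, hp b, mul_nonneg (sub_nonneg.2 hexp) (add_nonneg (add_nonneg hqF (hrx b))
      (hp b))]
  have h3 := h.inv_mulVec_le hκ hsup b₀
  rw [Matrix.mulVec_mulVec] at h3
  have h4 : κ * (F i j * x b₀) ≤ (((1 - (ω k).r)⁻¹ * (ω k).q) *ᵥ fun a => ∑ c, F a c * x c) b₀ := by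
    calc κ * (F i j * x b₀) ≤ κ * ∑ c, F i c * x c := by
          refine mul_le_mul_of_nonneg_left ?_ hκ.le
          exact (mul_le_mul_of_nonneg_left (hb₀ j (Finset.mem_univ j)) (hF0 i j)).trans
            (Finset.single_le_sum (f := fun c => F i c * x c)
              (fun c _ => mul_nonneg (hF0 i c) (hx0 c)) (Finset.mem_univ j))
      _ ≤ ((1 - (ω k).r)⁻¹ * (ω k).q) b₀ i * ∑ c, F i c * x c :=
          mul_le_mul_of_nonneg_right (h.2.2.1 b₀ i) (hFx i)
      _ ≤ _ := Finset.single_le_sum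
          (f := fun a => ((1 - (ω k).r)⁻¹ * (ω k).q) b₀ a * ∑ c, F a c * x c)
          (fun a _ => mul_nonneg (hκ.le.trans (h.2.2.1 b₀ a)) (hFx a)) (Finset.mem_univ i)
  have h5 : κ * F i j ≤ 1 := by
    have hpos : 0 < x b₀ := hκ.trans_le (hxκ b₀)
    by_contra hlt
    nlinarith [not_le.1 hlt]
  rw [← ENNReal.ofReal_toReal (hk' i j)]
  refine ENNReal.ofReal_le_ofReal ?_
  rw [le_div_iff₀ hκ, mul_comm]
  exact h5

/-- Bounds on passage matrices survive limits in the parameter. -/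
theorem Phi_le_of_tendsto {ω : Env d} {l : ℝ} {u : ℕ → ℝ} (hu : Tendsto u atTop (𝓝 l)) {C : ℝ≥0∞}
    {k : ℤ} {i j : Fin d} (h : ∀ n, Phi ω (u n) k i j ≤ C) : Phi ω l k i j ≤ C := by
  rw [Phi_apply, hitGen, ENNReal.tsum_eq_iSup_sum]
  refine iSup_le fun t => ?_
  have h1 : Tendsto (fun n => ∑ N ∈ t, expWeight (u n) N * hitProb ω (k + 1) N (k, i) j) atTop
      (𝓝 (∑ N ∈ t, expWeight l N * hitProb ω (k + 1) N (k, i) j)) := by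
    refine tendsto_finsetSum _ fun N _ => ?_
    refine ENNReal.Tendsto.mul_const ?_ (Or.inl (expWeight_ne_zero l N))
    exact ENNReal.tendsto_ofReal ((Real.continuous_exp.tendsto _).comp (hu.mul_const _))
  refine le_of_tendsto' h1 fun n => le_trans ?_ (h n)
  rw [Phi_apply, hitGen]
  exact ENNReal.sum_le_tsum t

/-- At least one step is needed to pass to the next level. -/
theorem expWeight_one_mul_Phi_zero_le (ω : Env d) {l : ℝ} (hl : 0 ≤ l) (k : ℤ) (i j : Fin d) :
    expWeight l 1 * Phi ω 0 k i j ≤ Phi ω l k i j := by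
  rw [Phi_apply, Phi_apply, hitGen_eq_stepOp ω l (by simp), hitGen_eq_stepOp ω 0 (by simp)]
  have h0 : expWeight 0 1 = 1 := by simp [expWeight]
  rw [h0, one_mul]
  gcongr
  exact stepOp_mono fun y _ => hitGen_mono ω hl _ _ _

end Ellipticity

/-! ### Contraction of products of positive matrices -/

section Contraction

variable {d : ℕ}

/-- One step of the contraction: applying a positive matrix to two vectors shrinks the range of
their componentwise ratio, because each new ratio is an average of the old ones with weights that
dominate `c / C` times a fixed probability vector. -/
theorem ratio_contraction (hd : 0 < d) {A : Matrix (Fin d) (Fin d) ℝ} {c C : ℝ} (hc : 0 < c)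
    (hA : ∀ i j, c ≤ A i j ∧ A i j ≤ C) {f g : Fin d → ℝ} (hg : ∀ i, 0 < g i) {lo hi : ℝ}
    (hlo : ∀ i, lo * g i ≤ f i) (hhi : ∀ i, f i ≤ hi * g i) :
    ∃ lo' hi', lo ≤ lo' ∧ hi' ≤ hi ∧ hi' - lo' = (1 - c / C) * (hi - lo) ∧
      ∀ i, lo' * (A *ᵥ g) i ≤ (A *ᵥ f) i ∧ (A *ᵥ f) i ≤ hi' * (A *ᵥ g) i := by
  have hC : 0 < C := hc.trans_le ((hA ⟨0, hd⟩ ⟨0, hd⟩).1.trans (hA ⟨0, hd⟩ ⟨0, hd⟩).2)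
  set β := ∑ a, g a with hβ
  have hβ0 : 0 < β := Finset.sum_pos (fun a _ => hg a) ⟨⟨0, hd⟩, Finset.mem_univ _⟩
  set s := (∑ a, f a) / β with hs
  have hsβ : s * β = ∑ a, f a := div_mul_cancel₀ _ hβ0.ne'
  have hlos : lo ≤ s := by
    rw [hs, le_div_iff₀ hβ0, hβ, Finset.mul_sum]
    exact Finset.sum_le_sum fun a _ => hlo a
  have hhis : s ≤ hi := by
    rw [hs, div_le_iff₀ hβ0, hβ, Finset.mul_sum]
    exact Finset.sum_le_sum fun a _ => hhi a
  have hδ : 0 < c / C := div_pos hc hC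
  have hgC : ∀ i, (A *ᵥ g) i ≤ C * β := fun i => by
    rw [hβ, Finset.mul_sum]
    change ∑ a, A i a * g a ≤ _
    exact Finset.sum_le_sum fun a _ => mul_le_mul_of_nonneg_right (hA i a).2 (hg a).le
  have hcC : ∀ t, 0 ≤ t → ∀ i, c / C * t * (A *ᵥ g) i ≤ c * (t * β) := fun t ht i => by
    calc c / C * t * (A *ᵥ g) i ≤ c / C * t * (C * β) :=
          mul_le_mul_of_nonneg_left (hgC i) (mul_nonneg hδ.le ht)
      _ = c * (t * β) := by field_simp
  have hl : ∀ i, c * ((s - lo) * β) ≤ (A *ᵥ f) i - lo * (A *ᵥ g) i := fun i => by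
    have h1 : (A *ᵥ f) i - lo * (A *ᵥ g) i = ∑ a, A i a * (f a - lo * g a) := by
      simp only [Matrix.mulVec, dotProduct]
      rw [Finset.mul_sum, ← Finset.sum_sub_distrib]
      exact Finset.sum_congr rfl fun a _ => by ring
    rw [h1, sub_mul, hsβ, hβ, Finset.mul_sum, ← Finset.sum_sub_distrib, Finset.mul_sum]
    exact Finset.sum_le_sum fun a _ =>
      mul_le_mul_of_nonneg_right (hA i a).1 (sub_nonneg.2 (hlo a))
  have hh : ∀ i, c * ((hi - s) * β) ≤ hi * (A *ᵥ g) i - (A *ᵥ f) i := fun i => by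
    have h1 : hi * (A *ᵥ g) i - (A *ᵥ f) i = ∑ a, A i a * (hi * g a - f a) := by
      simp only [Matrix.mulVec, dotProduct]
      rw [Finset.mul_sum, ← Finset.sum_sub_distrib]
      exact Finset.sum_congr rfl fun a _ => by ring
    rw [h1, sub_mul, hsβ, hβ, Finset.mul_sum, ← Finset.sum_sub_distrib, Finset.mul_sum]
    exact Finset.sum_le_sum fun a _ =>
      mul_le_mul_of_nonneg_right (hA i a).1 (sub_nonneg.2 (hhi a))
  refine ⟨lo + c / C * (s - lo), hi - c / C * (hi - s), ?_, ?_, by ring, fun i => ⟨?_, ?_⟩⟩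
  · linarith [mul_nonneg hδ.le (sub_nonneg.2 hlos)]
  · linarith [mul_nonneg hδ.le (sub_nonneg.2 hhis)]
  · linarith [hl i, hcC (s - lo) (sub_nonneg.2 hlos) i]
  · linarith [hh i, hcC (hi - s) (sub_nonneg.2 hhis) i]

/-- Along products of uniformly positive matrices the componentwise ratio of two vectors converges
exponentially fast to a constant. -/
theorem exists_ratio_limit (hd : 0 < d) {A : ℕ → Matrix (Fin d) (Fin d) ℝ} {c C : ℝ} (hc : 0 < c)
    (hA : ∀ m i j, c ≤ A m i j ∧ A m i j ≤ C) {f g : ℕ → Fin d → ℝ}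
    (hf : ∀ m, f (m + 1) = A m *ᵥ f m) (hg : ∀ m, g (m + 1) = A m *ᵥ g m) (hg0 : ∀ m i, 0 < g m i)
    {lo hi : ℝ} (hlo : ∀ i, lo * g 0 i ≤ f 0 i) (hhi : ∀ i, f 0 i ≤ hi * g 0 i) :
    ∃ s, lo ≤ s ∧ ∀ m i, |f m i - s * g m i| ≤ (1 - c / C) ^ m * (hi - lo) * g m i := by
  let P : ℕ → ℝ × ℝ → Prop := fun m p => ∀ i, p.1 * g m i ≤ f m i ∧ f m i ≤ p.2 * g m i
  have hstep : ∀ m (p : {p // P m p}), ∃ p' : {p // P (m + 1) p}, p.1.1 ≤ p'.1.1 ∧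
      p'.1.2 ≤ p.1.2 ∧ p'.1.2 - p'.1.1 = (1 - c / C) * (p.1.2 - p.1.1) := by
    rintro m ⟨⟨a, b⟩, hp⟩
    obtain ⟨a', b', h1, h2, h3, h4⟩ := ratio_contraction hd hc (hA m) (hg0 m)
      (fun i => (hp i).1) (fun i => (hp i).2)
    refine ⟨⟨(a', b'), fun i => ?_⟩, h1, h2, h3⟩
    rw [hf, hg]
    exact h4 i
  choose nxt hn1 hn2 hn3 using hstep
  let S : ∀ m, {p // P m p} := fun m =>
    Nat.rec (motive := fun m => {p // P m p}) ⟨(lo, hi), fun i => ⟨hlo i, hhi i⟩⟩ nxt m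
  have hS : ∀ m, S (m + 1) = nxt m (S m) := fun m => rfl
  have hmono : Monotone fun m => (S m).1.1 := monotone_nat_of_le_succ fun m => by
    rw [hS]; exact hn1 m (S m)
  have hanti : Antitone fun m => (S m).1.2 := antitone_nat_of_succ_le fun m => by
    rw [hS]; exact hn2 m (S m)
  have hgap : ∀ m, (S m).1.2 - (S m).1.1 = (1 - c / C) ^ m * (hi - lo) := fun m => by
    induction m with
    | zero => simp [S]
    | succ m ih => rw [hS, hn3, ih, pow_succ]; ring
  have hle : ∀ m, (S m).1.1 ≤ (S m).1.2 := fun m => by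
    have h := (S m).2 ⟨0, hd⟩
    exact le_of_mul_le_mul_right (h.1.trans h.2) (hg0 m _)
  have hle' : ∀ m n, (S m).1.1 ≤ (S n).1.2 := fun m n =>
    (hmono (le_max_left m n)).trans ((hle _).trans (hanti (le_max_right m n)))
  have hbdd : BddAbove (Set.range fun m => (S m).1.1) :=
    ⟨(S 0).1.2, by rintro _ ⟨m, rfl⟩; exact hle' m 0⟩
  refine ⟨⨆ m, (S m).1.1, le_ciSup hbdd 0, fun m i => ?_⟩
  have h1 : (S m).1.1 ≤ ⨆ m, (S m).1.1 := le_ciSup hbdd m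
  have h2 : ⨆ m, (S m).1.1 ≤ (S m).1.2 := ciSup_le fun n => hle' n m
  have h3 := (S m).2 i
  have h4 := mul_le_mul_of_nonneg_right h1 (hg0 m i).le
  have h5 := mul_le_mul_of_nonneg_right h2 (hg0 m i).le
  rw [← hgap, abs_le, sub_mul]
  constructor <;> linarith [h3.1, h3.2]

/-- All passage matrices of `ω` at the parameter `l` have their entries in `[c, C]`. -/
def PhiBounded (c C : ℝ) (ω : Env d) (l : ℝ) : Prop :=
  ∀ k i j, ENNReal.ofReal c ≤ Phi ω l k i j ∧ Phi ω l k i j ≤ ENNReal.ofReal C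

theorem PhiBounded.translate {c C : ℝ} {ω : Env d} {l : ℝ} (h : PhiBounded c C ω l) (k : ℤ) :
    PhiBounded c C (translate k ω) l := fun m i j => by
  rw [Phi_translate]
  exact h (m + k) i j

theorem PhiBounded.ne_top {c C : ℝ} {ω : Env d} {l : ℝ} (h : PhiBounded c C ω l) (k : ℤ)
    (i j : Fin d) : Phi ω l k i j ≠ ⊤ :=
  ((h k i j).2.trans_lt ENNReal.ofReal_lt_top).ne

theorem PhiBounded.toReal_mem {c C : ℝ} (hc : 0 < c) {ω : Env d} {l : ℝ}
    (h : PhiBounded c C ω l) (k : ℤ) (i j : Fin d) :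
    c ≤ (Phi ω l k i j).toReal ∧ (Phi ω l k i j).toReal ≤ C := by
  have h1 := (ENNReal.ofReal_le_iff_le_toReal (h.ne_top k i j)).1 (h k i j).1
  refine ⟨h1, ?_⟩
  have h2 := ENNReal.toReal_mono ENNReal.ofReal_ne_top (h k i j).2
  rcases le_total 0 C with hC | hC
  · rwa [ENNReal.toReal_ofReal hC] at h2
  · rw [ENNReal.ofReal_of_nonpos hC] at h2
    simp only [ENNReal.toReal_zero] at h2
    linarith

theorem PhiProd_ne_top {c C : ℝ} {ω : Env d} {l : ℝ} (h : PhiBounded c C ω l) (m : ℤ) (n : ℕ)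
    (i j : Fin d) : PhiProd ω l m n i j ≠ ⊤ := by
  induction n generalizing j with
  | zero =>
    rw [PhiProd_zero, Matrix.one_apply]
    split_ifs <;> simp
  | succ n ih =>
    rw [PhiProd_succ, Matrix.mul_apply]
    exact ENNReal.sum_ne_top.2 fun a _ => ENNReal.mul_ne_top (ih a) (h.ne_top _ _ _)

theorem PhiProd_succ_left (ω : Env d) (l : ℝ) (m : ℤ) (n : ℕ) :
    PhiProd ω l m (n + 1) = Phi ω l m * PhiProd ω l (m + 1) n := by
  induction n with
  | zero => simp [PhiProd_succ, PhiProd_zero]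
  | succ n ih =>
    rw [PhiProd_succ, ih, PhiProd_succ ω l (m + 1), Matrix.mul_assoc]
    push_cast
    ring_nf

/-- The real entries of `π Φ_{-m} ⋯ Φ_{-1}`. -/
def pastRow (ω : Env d) (π : PMF (Fin d)) (l : ℝ) (m : ℕ) (j : Fin d) : ℝ :=
  ∑ i, (π i).toReal * (PhiProd ω l (-(m : ℤ)) m i j).toReal

theorem pastRow_nonneg (ω : Env d) (π : PMF (Fin d)) (l : ℝ) (m : ℕ) (j : Fin d) :
    0 ≤ pastRow ω π l m j :=
  Finset.sum_nonneg fun _ _ => mul_nonneg ENNReal.toReal_nonneg ENNReal.toReal_nonneg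

theorem PMF_exists_pos (π : PMF (Fin d)) : ∃ i, π i ≠ 0 := by
  obtain ⟨i, hi⟩ := π.support_nonempty
  exact ⟨i, (π.mem_support_iff i).1 hi⟩

theorem ofReal_pastRow {c C : ℝ} {ω : Env d} {l : ℝ} (h : PhiBounded c C ω l) (π : PMF (Fin d))
    (m : ℕ) (j : Fin d) :
    ENNReal.ofReal (pastRow ω π l m j) = ((fun i => π i) ᵥ* PhiProd ω l (-(m : ℤ)) m) j := by
  rw [pastRow, ENNReal.ofReal_sum_of_nonneg fun i _ =>
    mul_nonneg ENNReal.toReal_nonneg ENNReal.toReal_nonneg]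
  refine Finset.sum_congr rfl fun i _ => ?_
  rw [ENNReal.ofReal_mul ENNReal.toReal_nonneg, ENNReal.ofReal_toReal (π.apply_ne_top i),
    ENNReal.ofReal_toReal (PhiProd_ne_top h _ _ _ _)]

/-- The rows of `Φ_{-m} ⋯ Φ_{-1}`, normalized, converge exponentially fast to a common limit. -/
theorem exists_row_limit (hd : 0 < d) {c C : ℝ} (hc : 0 < c) {ω : Env d} {l : ℝ}
    (h : PhiBounded c C ω l) :
    ∃ s : Fin d → ℝ, (∀ j, 0 ≤ s j) ∧ ∑ j, s j = 1 ∧ ∀ (π : PMF (Fin d)) (m : ℕ),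
      0 < ∑ k, pastRow ω π l m k ∧ ∀ j, |pastRow ω π l m j - s j * ∑ k, pastRow ω π l m k| ≤
        (1 - c / C) ^ m * ∑ k, pastRow ω π l m k := by
  let A : ℕ → Matrix (Fin d) (Fin d) ℝ := fun m =>
    Matrix.of fun i j => (Phi ω l (-((m + 1 : ℕ) : ℤ)) i j).toReal
  have hA : ∀ m i j, c ≤ A m i j ∧ A m i j ≤ C := fun m i j => h.toReal_mem hc _ i j
  let f : Fin d → ℕ → Fin d → ℝ := fun j m i => (PhiProd ω l (-(m : ℤ)) m i j).toReal
  have hf : ∀ j m, f j (m + 1) = A m *ᵥ f j m := by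
    intro j m
    funext i
    simp only [f, A]
    rw [PhiProd_succ_left, Matrix.mul_apply, ENNReal.toReal_sum fun a _ =>
      ENNReal.mul_ne_top (h.ne_top _ _ _) (PhiProd_ne_top h _ _ _ _)]
    refine Finset.sum_congr rfl fun a _ => ?_
    rw [ENNReal.toReal_mul]
    congr 4
    push_cast
    ring
  let g : ℕ → Fin d → ℝ := fun m i => ∑ j, f j m i
  have hg : ∀ m, g (m + 1) = A m *ᵥ g m := by
    intro m
    funext i
    simp only [g, hf, Matrix.mulVec, dotProduct]
    rw [Finset.sum_comm]
    exact Finset.sum_congr rfl fun a _ => by rw [Finset.mul_sum]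
  have hf0 : ∀ j i, f j 0 i = if i = j then 1 else 0 := by
    intro j i
    simp only [f, PhiProd_zero, Matrix.one_apply]
    split_ifs <;> simp
  have hg0 : ∀ m i, 0 < g m i := by
    intro m
    induction m with
    | zero => intro i; simp [g, hf0]
    | succ m ih =>
      intro i
      rw [hg]
      exact Finset.sum_pos (fun a _ => mul_pos (hc.trans_le (hA m i a).1) (ih a))
        ⟨⟨0, hd⟩, Finset.mem_univ _⟩
  have hg00 : ∀ i, g 0 i = 1 := fun i => by simp [g, hf0]
  have hex : ∀ j, ∃ s, 0 ≤ s ∧ ∀ m i, |f j m i - s * g m i| ≤ (1 - c / C) ^ m * (1 - 0) * g m i :=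
    fun j => exists_ratio_limit hd hc hA (hf j) hg hg0
      (fun i => by rw [hf0]; split_ifs <;> simp)
      (fun i => by rw [hf0, hg00]; split_ifs <;> simp)
  choose s hs0 hs using hex
  have hC : 0 < C := hc.trans_le ((hA 0 ⟨0, hd⟩ ⟨0, hd⟩).1.trans (hA 0 ⟨0, hd⟩ ⟨0, hd⟩).2)
  have hρ0 : 0 ≤ 1 - c / C := by
    rw [sub_nonneg, div_le_one hC]
    exact (hA 0 ⟨0, hd⟩ ⟨0, hd⟩).1.trans (hA 0 ⟨0, hd⟩ ⟨0, hd⟩).2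
  have hρ1 : 1 - c / C < 1 := by linarith [div_pos hc hC]
  refine ⟨s, hs0, ?_, fun π m => ?_⟩
  · have h1 : ∀ m : ℕ, |1 - ∑ j, s j| ≤ d * (1 - c / C) ^ m := by
      intro m
      have hgm := hg0 m ⟨0, hd⟩
      have h2 : (1 - ∑ j, s j) * g m ⟨0, hd⟩ = ∑ j, (f j m ⟨0, hd⟩ - s j * g m ⟨0, hd⟩) := by
        rw [Finset.sum_sub_distrib, ← Finset.sum_mul, sub_mul, one_mul]
      have h3 : |1 - ∑ j, s j| * g m ⟨0, hd⟩ ≤ d * (1 - c / C) ^ m * g m ⟨0, hd⟩ := by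
        rw [← abs_of_pos hgm, ← abs_mul, abs_of_pos hgm, h2]
        refine (Finset.abs_sum_le_sum_abs _ _).trans ?_
        refine (Finset.sum_le_sum fun j _ => hs j m ⟨0, hd⟩).trans ?_
        simp [mul_assoc]
      exact le_of_mul_le_mul_right h3 hgm
    have h2 : Tendsto (fun m : ℕ => (d : ℝ) * (1 - c / C) ^ m) atTop (𝓝 0) := by
      simpa using (tendsto_pow_atTop_nhds_zero_of_lt_one hρ0 hρ1).const_mul (d : ℝ)
    have h3 := ge_of_tendsto' h2 h1
    have h4 := abs_nonpos_iff.1 h3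
    linarith
  · have hrow : ∀ j, pastRow ω π l m j = ∑ i, (π i).toReal * f j m i := fun j => rfl
    have hsum : ∑ k, pastRow ω π l m k = ∑ i, (π i).toReal * g m i := by
      simp only [hrow, g, Finset.mul_sum]
      exact Finset.sum_comm
    constructor
    · rw [hsum]
      obtain ⟨i₀, hi₀⟩ := PMF_exists_pos π
      refine Finset.sum_pos' (fun i _ => mul_nonneg ENNReal.toReal_nonneg (hg0 m i).le)
        ⟨i₀, Finset.mem_univ _, mul_pos ?_ (hg0 m i₀)⟩
      exact ENNReal.toReal_pos hi₀ (π.apply_ne_top i₀)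
    · intro j
      rw [hsum, hrow]
      have h1 : ∑ i, (π i).toReal * f j m i - s j * ∑ i, (π i).toReal * g m i =
          ∑ i, (π i).toReal * (f j m i - s j * g m i) := by
        rw [Finset.mul_sum, ← Finset.sum_sub_distrib]
        exact Finset.sum_congr rfl fun i _ => by ring
      rw [h1, Finset.mul_sum]
      refine (Finset.abs_sum_le_sum_abs _ _).trans (Finset.sum_le_sum fun i _ => ?_)
      rw [abs_mul, abs_of_nonneg ENNReal.toReal_nonneg]
      have h2 := mul_le_mul_of_nonneg_left (hs j m i) (ENNReal.toReal_nonneg (a := π i))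
      linarith

/-- The candidate for `μ₀(l)`: the limit of the normalized rows started from `π₀`, written as an
upper limit so that it is measurable in the environment. -/
def rowLimit (π₀ : PMF (Fin d)) (l : ℝ) (ω : Env d) (j : Fin d) : ℝ≥0∞ :=
  limsup (fun m => normalizedRow ω π₀ l m j) atTop

theorem measurable_rowLimit (π₀ : PMF (Fin d)) (l : ℝ) (j : Fin d) :
    Measurable fun ω => rowLimit π₀ l ω j := by
  refine Measurable.limsup fun m => ?_
  have h1 : ∀ k, Measurable fun ω : Env d => ((fun i => π₀ i) ᵥ* PhiProd ω l (-(m : ℤ)) m) k :=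
    fun k => by
      simp only [Matrix.vecMul, dotProduct]
      exact Finset.measurable_sum _ fun i _ => (measurable_PhiProd _ _ _ _ _).const_mul _
  exact (h1 j).div (Finset.measurable_sum _ fun k _ => h1 k)

/-- The logarithmic growth `log (μ₀(l) Φ_0(l) 1)`. -/
def logGrowth (π₀ : PMF (Fin d)) (l : ℝ) (ω : Env d) : ℝ :=
  Real.log (rowLimit π₀ l ω ⬝ᵥ (Phi ω l 0 *ᵥ (fun _ => 1))).toReal

theorem measurable_logGrowth (π₀ : PMF (Fin d)) (l : ℝ) :
    Measurable fun ω => logGrowth π₀ l ω := by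
  refine Real.measurable_log.comp (Measurable.ennreal_toReal ?_)
  refine Finset.measurable_sum _ fun j _ => (measurable_rowLimit π₀ l j).mul ?_
  simp only [Matrix.mulVec, dotProduct]
  exact Finset.measurable_sum _ fun i _ => (measurable_Phi _ _ _ _).mul_const _

theorem tendsto_normalizedRow {c C : ℝ} (hc : 0 < c) (hcC : c ≤ C) {ω : Env d} {l : ℝ}
    (h : PhiBounded c C ω l) {s : Fin d → ℝ}
    (hs : ∀ (π : PMF (Fin d)) (m : ℕ),
      0 < ∑ k, pastRow ω π l m k ∧ ∀ j, |pastRow ω π l m j - s j * ∑ k, pastRow ω π l m k| ≤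
        (1 - c / C) ^ m * ∑ k, pastRow ω π l m k) (π : PMF (Fin d)) :
    Tendsto (fun m => normalizedRow ω π l m) atTop (𝓝 fun j => ENNReal.ofReal (s j)) := by
  have hC : 0 < C := hc.trans_le hcC
  have hρ0 : 0 ≤ 1 - c / C := by
    rw [sub_nonneg, div_le_one hC]
    exact hcC
  have hρ1 : 1 - c / C < 1 := by linarith [div_pos hc hC]
  rw [tendsto_pi_nhds]
  intro j
  have h1 : ∀ m, normalizedRow ω π l m j =
      ENNReal.ofReal (pastRow ω π l m j / ∑ k, pastRow ω π l m k) := by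
    intro m
    rw [ENNReal.ofReal_div_of_pos (hs π m).1, ENNReal.ofReal_sum_of_nonneg]
    · simp_rw [ofReal_pastRow h]
      rfl
    · exact fun k _ => pastRow_nonneg _ _ _ _ _
  simp_rw [h1]
  refine ENNReal.tendsto_ofReal ?_
  rw [tendsto_iff_norm_sub_tendsto_zero]
  refine squeeze_zero (fun _ => norm_nonneg _) (fun m => ?_)
    (tendsto_pow_atTop_nhds_zero_of_lt_one hρ0 hρ1)
  have hpos := (hs π m).1
  rw [Real.norm_eq_abs, div_sub' hpos.ne', abs_div, abs_of_pos hpos, div_le_iff₀ hpos, mul_comm _ (s j)]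
  exact (hs π m).2 j

theorem rowLimit_spec (hd : 0 < d) {c C : ℝ} (hc : 0 < c) (hcC : c ≤ C) {ω : Env d} {l : ℝ}
    (h : PhiBounded c C ω l) (π₀ : PMF (Fin d)) :
    ∃ s : Fin d → ℝ, (∀ j, 0 ≤ s j) ∧ ∑ j, s j = 1 ∧
      rowLimit π₀ l ω = (fun j => ENNReal.ofReal (s j)) ∧
      (∀ π, Tendsto (fun m => normalizedRow ω π l m) atTop (𝓝 (rowLimit π₀ l ω))) ∧
      ∀ (π : PMF (Fin d)) (m : ℕ),
        0 < ∑ k, pastRow ω π l m k ∧ ∀ j, |pastRow ω π l m j - s j * ∑ k, pastRow ω π l m k| ≤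
          (1 - c / C) ^ m * ∑ k, pastRow ω π l m k := by
  obtain ⟨s, hs0, hs1, hs⟩ := exists_row_limit hd hc h
  have h1 := tendsto_normalizedRow hc hcC h hs
  have h2 : rowLimit π₀ l ω = fun j => ENNReal.ofReal (s j) := by
    funext j
    exact (tendsto_pi_nhds.1 (h1 π₀) j).limsup_eq
  exact ⟨s, hs0, hs1, h2, fun π => h2 ▸ h1 π, hs⟩

end Contraction

/-! ### The quenched free energy in a single environment -/

section FreeEnergy

variable {d : ℕ}

theorem PhiProd_translate (k : ℤ) (ω : Env d) (l : ℝ) (m : ℤ) (n : ℕ) :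
    PhiProd (translate k ω) l m n = PhiProd ω l (m + k) n := by
  ext i j
  rw [PhiProd_apply, PhiProd_apply, hitGen_translate, add_right_comm]

/-- The quenched moment generating function at level `n`, seen from level `n`. -/
theorem quenchedMGF_eq_pastRow {c C : ℝ} {ω : Env d} {l : ℝ} (h : PhiBounded c C ω l)
    (π : PMF (Fin d)) (n : ℕ) :
    quenchedMGF ω π l n = ENNReal.ofReal (∑ k, pastRow (translate n ω) π l n k) := by
  rw [ENNReal.ofReal_sum_of_nonneg fun k _ => pastRow_nonneg _ _ _ _ _]
  simp_rw [ofReal_pastRow (h.translate n), quenchedMGF_eq_dotProduct, PhiProd_translate,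
    neg_add_cancel]
  rw [Matrix.dotProduct_mulVec]
  simp [dotProduct]

theorem quenchedMGF_succ_eq_pastRow {c C : ℝ} {ω : Env d} {l : ℝ} (h : PhiBounded c C ω l)
    (π : PMF (Fin d)) (n : ℕ) :
    quenchedMGF ω π l (n + 1) = ENNReal.ofReal (∑ k, pastRow (translate n ω) π l n k *
      ∑ j, (Phi (translate n ω) l 0 k j).toReal) := by
  have h0 : ∀ k, 0 ≤ pastRow (translate n ω) π l n k := fun k =>
    pastRow_nonneg _ _ _ _ _
  have h1 : ∀ k, 0 ≤ ∑ j, (Phi (translate n ω) l 0 k j).toReal := fun k =>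
    Finset.sum_nonneg fun i _ => ENNReal.toReal_nonneg
  rw [ENNReal.ofReal_sum_of_nonneg fun k _ => mul_nonneg (h0 k) (h1 k)]
  simp_rw [ENNReal.ofReal_mul (h0 _), ofReal_pastRow (h.translate n),
    ENNReal.ofReal_sum_of_nonneg (fun (j : Fin d) _ => ENNReal.toReal_nonneg),
    ENNReal.ofReal_toReal ((h.translate n).ne_top _ _ _), quenchedMGF_eq_dotProduct,
    PhiProd_translate, neg_add_cancel, PhiProd_succ, Phi_translate, zero_add]
  rw [← Matrix.mulVec_mulVec, Matrix.dotProduct_mulVec]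
  simp [dotProduct, Matrix.mulVec]

/-- The increment of the quenched free energy from level `n` to level `n + 1` is, up to an
exponentially small error, the logarithmic growth seen from level `n`. -/
theorem log_quenchedMGF_succ (hd : 0 < d) {c C : ℝ} (hc : 0 < c) (hcC : c ≤ C) {ω : Env d} {l : ℝ}
    (h : PhiBounded c C ω l) (π₀ π : PMF (Fin d)) (n : ℕ) :
    d * c * (quenchedMGF ω π l n).toReal ≤ (quenchedMGF ω π l (n + 1)).toReal ∧
    (quenchedMGF ω π l (n + 1)).toReal ≤ d * C * (quenchedMGF ω π l n).toReal ∧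
    0 < (quenchedMGF ω π l n).toReal ∧ quenchedMGF ω π l n ≠ ⊤ ∧
    |Real.log (quenchedMGF ω π l (n + 1)).toReal - Real.log (quenchedMGF ω π l n).toReal -
      logGrowth π₀ l (translate n ω)| ≤ d * C / c * (1 - c / C) ^ n ∧
    Real.log (d * c) ≤ logGrowth π₀ l (translate n ω) ∧
    logGrowth π₀ l (translate n ω) ≤ Real.log (d * C) := by
  have hdR : (0 : ℝ) < d := Nat.cast_pos.2 hd
  set ω' := translate n ω with hω'
  have h' : PhiBounded c C ω' l := h.translate n
  obtain ⟨s, hs0, hs1, hs2, -, hs⟩ := rowLimit_spec hd hc hcC h' π₀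
  obtain ⟨hpos, hrow⟩ := hs π n
  set S := ∑ k, pastRow ω' π l n k with hS
  set v : Fin d → ℝ := fun k => ∑ j, (Phi ω' l 0 k j).toReal with hv
  have hv1 : ∀ k, d * c ≤ v k := fun k => by
    have := Finset.card_nsmul_le_sum Finset.univ (fun j => (Phi ω' l 0 k j).toReal) c
      fun j _ => (h'.toReal_mem hc 0 k j).1
    simpa using this
  have hv2 : ∀ k, v k ≤ d * C := fun k => by
    have := Finset.sum_le_card_nsmul Finset.univ (fun j => (Phi ω' l 0 k j).toReal) C
      fun j _ => (h'.toReal_mem hc 0 k j).2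
    simpa using this
  have hr0 : ∀ k, 0 ≤ pastRow ω' π l n k := fun k =>
    pastRow_nonneg _ _ _ _ _
  have hv0 : ∀ k, 0 ≤ v k := fun k => (mul_nonneg hdR.le hc.le).trans (hv1 k)
  have hZ : (quenchedMGF ω π l n).toReal = S := by
    rw [quenchedMGF_eq_pastRow h, ENNReal.toReal_ofReal hpos.le]
  set S' := ∑ k, pastRow ω' π l n k * v k with hS'
  have hZ' : (quenchedMGF ω π l (n + 1)).toReal = S' := by
    rw [quenchedMGF_succ_eq_pastRow h, ENNReal.toReal_ofReal
      (Finset.sum_nonneg fun k _ => mul_nonneg (hr0 k) (hv0 k))]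
  have hL : d * c * S ≤ S' := by
    rw [hS, Finset.mul_sum]
    exact Finset.sum_le_sum fun k _ => by
      rw [mul_comm]; exact mul_le_mul_of_nonneg_left (hv1 k) (hr0 k)
  have hU : S' ≤ d * C * S := by
    rw [hS, Finset.mul_sum]
    exact Finset.sum_le_sum fun k _ => by
      rw [mul_comm (_ * _)]; exact mul_le_mul_of_nonneg_left (hv2 k) (hr0 k)
  set g := ∑ j, s j * v j with hg
  have hgr : logGrowth π₀ l ω' = Real.log g := by
    rw [logGrowth, hs2]
    congr 1
    have h1 : (fun j => ENNReal.ofReal (s j)) ⬝ᵥ (Phi ω' l 0 *ᵥ fun _ => 1) =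
        ENNReal.ofReal g := by
      rw [hg, ENNReal.ofReal_sum_of_nonneg fun j _ => mul_nonneg (hs0 j) (hv0 j)]
      refine Finset.sum_congr rfl fun j _ => ?_
      rw [ENNReal.ofReal_mul (hs0 j), hv, ENNReal.ofReal_sum_of_nonneg fun _ _ =>
        ENNReal.toReal_nonneg]
      simp_rw [ENNReal.ofReal_toReal (h'.ne_top _ _ _)]
      simp [Matrix.mulVec, dotProduct]
    rw [h1, ENNReal.toReal_ofReal (Finset.sum_nonneg fun j _ => mul_nonneg (hs0 j) (hv0 j))]
  have hg1 : d * c ≤ g := by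
    calc d * c = ∑ j, s j * (d * c) := by rw [← Finset.sum_mul, hs1, one_mul]
      _ ≤ g := Finset.sum_le_sum fun j _ => mul_le_mul_of_nonneg_left (hv1 j) (hs0 j)
  have hg2 : g ≤ d * C := by
    calc g ≤ ∑ j, s j * (d * C) :=
          Finset.sum_le_sum fun j _ => mul_le_mul_of_nonneg_left (hv2 j) (hs0 j)
      _ = d * C := by rw [← Finset.sum_mul, hs1, one_mul]
  have hdc : 0 < d * c := mul_pos hdR hc
  have hS'0 : 0 < S' := (mul_pos hdc hpos).trans_le hL
  have hg0 : 0 < g := hdc.trans_le hg1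
  refine ⟨by rw [hZ, hZ']; exact hL, by rw [hZ, hZ']; exact hU, by rw [hZ]; exact hpos, ?_, ?_,
    by rw [hgr]; exact Real.log_le_log hdc hg1, by rw [hgr]; exact Real.log_le_log hg0 hg2⟩
  · rw [quenchedMGF_eq_pastRow h]
    exact ENNReal.ofReal_ne_top
  · rw [hZ, hZ', hgr, ← Real.log_div hS'0.ne' hpos.ne']
    have hratio : |S' / S - g| ≤ d * (d * C) * (1 - c / C) ^ n := by
      rw [div_sub' hpos.ne', abs_div, abs_of_pos hpos, div_le_iff₀ hpos]
      have h1 : S' - S * g = ∑ j, v j * (pastRow ω' π l n j - s j * S) := by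
        rw [hS', hg, Finset.mul_sum, ← Finset.sum_sub_distrib]
        exact Finset.sum_congr rfl fun j _ => by ring
      rw [h1]
      refine (Finset.abs_sum_le_sum_abs _ _).trans ?_
      calc ∑ j, |v j * (pastRow ω' π l n j - s j * S)|
          ≤ ∑ j : Fin d, d * C * ((1 - c / C) ^ n * S) := by
            refine Finset.sum_le_sum fun j _ => ?_
            rw [abs_mul, abs_of_nonneg (hv0 j)]
            exact mul_le_mul (hv2 j) (hrow j) (abs_nonneg _) ((hv0 j).trans (hv2 j))
        _ = d * (d * C) * (1 - c / C) ^ n * S := by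
            rw [Finset.sum_const, Finset.card_univ, Fintype.card_fin, nsmul_eq_mul]
            ring
    have hR1 : d * c ≤ S' / S := by rw [le_div_iff₀ hpos]; exact hL
    -- The logarithm is Lipschitz with constant `1 / a` on `[a, ∞)`.
    have hlip : ∀ x y a : ℝ, 0 < a → a ≤ x → a ≤ y → Real.log x - Real.log y ≤ |x - y| / a := by
      intro x y a ha hx hy
      have hy0 : 0 < y := ha.trans_le hy
      rw [← Real.log_div (ha.trans_le hx).ne' hy0.ne']
      refine (Real.log_le_sub_one_of_pos (div_pos (ha.trans_le hx) hy0)).trans ?_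
      rw [div_sub_one hy0.ne']
      calc (x - y) / y ≤ |x - y| / y := div_le_div_of_nonneg_right (le_abs_self _) hy0.le
        _ ≤ |x - y| / a := div_le_div_of_nonneg_left (abs_nonneg _) ha hy
    have hfin : |Real.log (S' / S) - Real.log g| ≤ |S' / S - g| / (d * c) := by
      rw [abs_le]
      constructor
      · have := hlip g (S' / S) (d * c) hdc hg1 hR1
        rw [abs_sub_comm] at this
        linarith
      · exact hlip _ _ _ hdc hR1 hg1
    refine hfin.trans ?_
    rw [div_le_iff₀ hdc]
    refine hratio.trans (le_of_eq ?_)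
    field_simp

end FreeEnergy

/-! ### Stationary ergodic environments -/

section Stationary

variable {d : ℕ}

theorem measurable_translate (k : ℤ) : Measurable (translate k : Env d → Env d) :=
  measurable_pi_lambda _ fun m => measurable_pi_apply (m + k)

theorem shift_iterate (n : ℕ) (ω : Env d) : shift^[n] ω = translate n ω := by
  induction n with
  | zero => funext k; simp [translate]
  | succ n ih =>
    rw [Function.iterate_succ_apply', ih]
    funext k
    simp only [shift, translate]
    push_cast
    congr 1
    ring

theorem translate_translate (k m : ℤ) (ω : Env d) :
    translate k (translate m ω) = translate (m + k) ω := by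
  funext a
  simp only [translate]
  congr 1
  ring

variable {η : Measure (Env d)}

theorem measurePreserving_translate (h : MeasurePreserving shift η η) (k : ℤ) :
    MeasurePreserving (translate k) η η := by
  have hnat : ∀ n : ℕ, MeasurePreserving (translate (n : ℤ)) η η := fun n => by
    have := h.iterate n
    rwa [show (shift^[n] : Env d → Env d) = translate n from funext (shift_iterate n)] at this
  rcases Int.eq_nat_or_neg k with ⟨n, rfl | rfl⟩
  · exact hnat n
  · refine ⟨measurable_translate _, ?_⟩
    conv_lhs => rw [← (hnat n).map_eq]
    rw [Measure.map_map (measurable_translate _) (measurable_translate _)]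
    have : (translate (-(n : ℤ)) ∘ translate (n : ℤ) : Env d → Env d) = id := by
      funext ω
      rw [Function.comp_apply, translate_translate, add_neg_cancel]
      funext a
      simp [translate]
    rw [this, Measure.map_id]

theorem ae_forall_translate (h : MeasurePreserving shift η η) {p : Env d → Prop}
    (hp : ∀ᵐ ω ∂η, p ω) : ∀ᵐ ω ∂η, ∀ k : ℤ, p (translate k ω) :=
  ae_all_iff.2 fun k => (measurePreserving_translate h k).quasiMeasurePreserving.ae hp

/-- The parameters at which the passage matrices are almost surely finite. -/
def finiteParams (η : Measure (Env d)) : Set ℝ :=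
  {l : ℝ | ∀ᵐ ω ∂η, ∀ i j, Phi ω l 0 i j < ⊤}

theorem mem_finiteParams_of_le {l l' : ℝ} (h : l' ≤ l) (hl : l ∈ finiteParams η) :
    l' ∈ finiteParams η := by
  have hl' : ∀ᵐ ω ∂η, ∀ i j, Phi ω l 0 i j < ⊤ := hl
  change ∀ᵐ ω ∂η, ∀ i j, Phi ω l' 0 i j < ⊤
  filter_upwards [hl'] with ω hω i j
  exact (Phi_mono ω h 0 i j).trans_lt (hω i j)

theorem mem_finiteParams_of_nonpos {l : ℝ} (h : l ≤ 0) : l ∈ finiteParams η :=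
  ae_of_all _ fun ω i j => (Phi_le_one ω h 0 i j).trans_lt ENNReal.one_lt_top

theorem ae_Phi_ne_top (h : MeasurePreserving shift η η) {l : ℝ} (hl : l ∈ finiteParams η) :
    ∀ᵐ ω ∂η, ∀ k i j, Phi ω l k i j ≠ ⊤ := by
  filter_upwards [ae_forall_translate h hl] with ω hω k i j
  have := hω k i j
  rw [Phi_translate, zero_add] at this
  exact this.ne

variable {κ : ℝ}

theorem ae_Phi_le (h : MeasurePreserving shift η η) (hκ : 0 < κ)
    (hell : ∀ᵐ ω ∂η, ∀ n : ℤ, IsElliptic κ (ω n)) {l : ℝ} (hl : l ∈ finiteParams η) :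
    ∀ᵐ ω ∂η, ∀ k i j, Phi ω l k i j ≤ ENNReal.ofReal (max 1 (1 / κ)) := by
  rcases le_total l 0 with hl0 | hl0
  · refine ae_of_all _ fun ω k i j => (Phi_le_one ω hl0 k i j).trans ?_
    rw [← ENNReal.ofReal_one]
    exact ENNReal.ofReal_le_ofReal (le_max_left _ _)
  · filter_upwards [ae_Phi_ne_top h hl, hell] with ω hω hell k i j
    have h1 := Phi_le_of_finite hκ (hell (k + 1)) hl0 (hω (k + 1)) (hω (k + 1 - 1)) i j
    rw [add_sub_cancel_right] at h1
    exact h1.trans (ENNReal.ofReal_le_ofReal (le_max_right _ _))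

variable [IsProbabilityMeasure η]

theorem bddAbove_finiteParams (hd : 0 < d) (h : MeasurePreserving shift η η) (hκ : 0 < κ)
    (hell : ∀ᵐ ω ∂η, ∀ n : ℤ, IsElliptic κ (ω n)) : BddAbove (finiteParams η) := by
  obtain ⟨c, hc, hlow⟩ := exists_Phi_lower_bound hκ hd 0
  refine ⟨max 1 (1 / κ) / c, fun l hl => ?_⟩
  rcases le_total l 0 with hl0 | hl0
  · exact hl0.trans (by positivity)
  obtain ⟨ω, h1, h2⟩ := ((ae_Phi_le h hκ hell hl).and hell).exists
  have h3 := hlow ω 0 (h2 0) 0 (by simp) ⟨0, hd⟩ ⟨0, hd⟩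
  have h4 := (expWeight_one_mul_Phi_zero_le ω hl0 0 ⟨0, hd⟩ ⟨0, hd⟩).trans (h1 0 _ _)
  have h5 : ENNReal.ofReal (Real.exp l * c) ≤ ENNReal.ofReal (max 1 (1 / κ)) := by
    rw [ENNReal.ofReal_mul (Real.exp_pos l).le]
    refine le_trans ?_ h4
    have : expWeight l 1 = ENNReal.ofReal (Real.exp l) := by simp [expWeight]
    rw [this]
    gcongr
  have h6 := (ENNReal.ofReal_le_ofReal_iff (by positivity)).1 h5
  rw [le_div_iff₀ hc]
  nlinarith [Real.add_one_le_exp l]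

/-- The critical parameter `λ_crit`. -/
def critParam (η : Measure (Env d)) : ℝ := sSup (finiteParams η)

theorem isLUB_critParam (hd : 0 < d) (h : MeasurePreserving shift η η) (hκ : 0 < κ)
    (hell : ∀ᵐ ω ∂η, ∀ n : ℤ, IsElliptic κ (ω n)) : IsLUB (finiteParams η) (critParam η) :=
  isLUB_csSup ⟨0, mem_finiteParams_of_nonpos le_rfl⟩ (bddAbove_finiteParams hd h hκ hell)

theorem mem_finiteParams_of_lt (hd : 0 < d) (h : MeasurePreserving shift η η) (hκ : 0 < κ)
    (hell : ∀ᵐ ω ∂η, ∀ n : ℤ, IsElliptic κ (ω n)) {l : ℝ} (hl : l < critParam η) :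
    l ∈ finiteParams η := by
  obtain ⟨l', hl', hlt⟩ := (lt_isLUB_iff (isLUB_critParam hd h hκ hell)).1 hl
  exact mem_finiteParams_of_le hlt.le hl'

/-- The bound on the passage matrices extends to the critical parameter. -/
theorem ae_Phi_le_of_le_critParam (hd : 0 < d) (h : MeasurePreserving shift η η) (hκ : 0 < κ)
    (hell : ∀ᵐ ω ∂η, ∀ n : ℤ, IsElliptic κ (ω n)) {l : ℝ} (hl : l ≤ critParam η) :
    ∀ᵐ ω ∂η, ∀ k i j, Phi ω l k i j ≤ ENNReal.ofReal (max 1 (1 / κ)) := by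
  let u : ℕ → ℝ := fun n => l - 1 / ((n : ℝ) + 1)
  have hu : Tendsto u atTop (𝓝 l) := by
    simpa [u] using (tendsto_const_nhds (x := l)).sub tendsto_one_div_add_atTop_nhds_zero_nat
  have h1 : ∀ᵐ ω ∂η, ∀ n k i j, Phi ω (u n) k i j ≤ ENNReal.ofReal (max 1 (1 / κ)) := by
    rw [ae_all_iff]
    intro n
    refine ae_Phi_le h hκ hell (mem_finiteParams_of_lt hd h hκ hell (lt_of_lt_of_le ?_ hl))
    have : (0 : ℝ) < 1 / ((n : ℝ) + 1) := by positivity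
    simp only [u]
    linarith
  filter_upwards [h1] with ω hω k i j
  exact Phi_le_of_tendsto hu fun n => hω n k i j

theorem exists_ae_PhiBounded (hd : 0 < d) (h : MeasurePreserving shift η η) (hκ : 0 < κ)
    (hell : ∀ᵐ ω ∂η, ∀ n : ℤ, IsElliptic κ (ω n)) (R : ℝ) :
    ∃ c C : ℝ, 0 < c ∧ c ≤ C ∧ ∀ l, -R ≤ l → l ≤ critParam η → ∀ᵐ ω ∂η, PhiBounded c C ω l := by
  obtain ⟨c, hc, hlow⟩ := exists_Phi_lower_bound hκ hd R
  refine ⟨min c 1, max 1 (1 / κ), lt_min hc one_pos, (min_le_right _ _).trans (le_max_left _ _),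
    fun l hl hl' => ?_⟩
  filter_upwards [ae_Phi_le_of_le_critParam hd h hκ hell hl', hell] with ω h1 h2 k i j
  exact ⟨(ENNReal.ofReal_le_ofReal (min_le_left _ _)).trans (hlow ω k (h2 k) l hl i j), h1 k i j⟩

/-- Above the critical parameter some passage matrix to the right of the origin is infinite. -/
theorem ae_exists_Phi_eq_top (herg : Ergodic shift η) {l : ℝ} (hl : l ∉ finiteParams η) :
    ∀ᵐ ω ∂η, ∃ k : ℕ, ∃ i j, Phi ω l k i j = ⊤ := by
  let B : Set (Env d) := {ω | ∃ k : ℕ, ∃ i j, Phi ω l k i j = ⊤}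
  have hB : MeasurableSet B := by
    have : B = ⋃ k : ℕ, ⋃ i, ⋃ j, {ω | Phi ω l k i j = ⊤} := by ext ω; simp [B]
    rw [this]
    exact MeasurableSet.iUnion fun k => MeasurableSet.iUnion fun i => MeasurableSet.iUnion fun j =>
      measurable_Phi l k i j (measurableSet_singleton ⊤)
  have hsub : shift ⁻¹' B ⊆ B := by
    rintro ω ⟨k, i, j, hk⟩
    refine ⟨k + 1, i, j, ?_⟩
    have h1 : shift ω = translate 1 ω := rfl
    rw [h1, Phi_translate] at hk
    exact_mod_cast hk
  rcases herg.ae_empty_or_univ_of_preimage_ae_le hB.nullMeasurableSet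
    hsub.eventuallyLE with h | h
  · refine absurd ?_ hl
    filter_upwards [eventuallyEq_empty.1 h] with ω hω i j
    rw [lt_top_iff_ne_top]
    exact fun h => hω ⟨0, i, j, by exact_mod_cast h⟩
  · filter_upwards [eventuallyEq_univ.1 h] with ω hω using hω

/-- Clipping to `[-K, K]`. The ergodic theorem above is for functions bounded everywhere, while the
logarithmic growth is bounded only for typical environments. -/
def clip (K x : ℝ) : ℝ := max (-K) (min K x)

theorem abs_clip_le {K : ℝ} (hK : 0 ≤ K) (x : ℝ) : |clip K x| ≤ K :=
  abs_le.2 ⟨le_max_left _ _, max_le (by linarith) (min_le_left _ _)⟩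

theorem clip_of_abs_le {K x : ℝ} (h : |x| ≤ K) : clip K x = x := by
  rw [clip, min_eq_right (le_of_abs_le h), max_eq_right (neg_le_of_abs_le h)]

theorem abs_logGrowth_le (hd : 0 < d) {c C : ℝ} (hc : 0 < c) (hcC : c ≤ C) {ω : Env d} {l : ℝ}
    (h : PhiBounded c C ω l) (π₀ : PMF (Fin d)) :
    |logGrowth π₀ l ω| ≤ max |Real.log (d * c)| |Real.log (d * C)| := by
  obtain ⟨-, -, -, -, -, h1, h2⟩ := log_quenchedMGF_succ hd hc hcC h π₀ π₀ 0
  have h3 : translate ((0 : ℕ) : ℤ) ω = ω := by funext k; simp [translate]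
  rw [h3] at h1 h2
  exact abs_le_max_abs_abs h1 h2

/-- The quenched free energy `Λ(l)` for `l ≤ λ_crit`. -/
def freeEnergy (η : Measure (Env d)) (π₀ : PMF (Fin d)) (l : ℝ) : ℝ := ∫ ω, logGrowth π₀ l ω ∂η

theorem integrable_logGrowth (hd : 0 < d) {c C : ℝ} (hc : 0 < c) (hcC : c ≤ C) {l : ℝ}
    (h : ∀ᵐ ω ∂η, PhiBounded c C ω l) (π₀ : PMF (Fin d)) :
    Integrable (fun ω => logGrowth π₀ l ω) η := by
  refine Integrable.of_bound (measurable_logGrowth π₀ l).aestronglyMeasurable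
    (max |Real.log (d * c)| |Real.log (d * C)|) ?_
  filter_upwards [h] with ω hω
  exact abs_logGrowth_le hd hc hcC hω π₀

/-- The logarithmic moment generating function is a Birkhoff sum up to a bounded error. -/
theorem abs_log_quenchedMGF_sub_le (hd : 0 < d) {c C : ℝ} (hc : 0 < c) (hcC : c ≤ C) {ω : Env d}
    {l : ℝ} (h : PhiBounded c C ω l) (π₀ π : PMF (Fin d)) (n : ℕ) :
    |Real.log (quenchedMGF ω π l n).toReal - birkhoffSum shift (logGrowth π₀ l) n ω| ≤
      d * C / c * ∑ k ∈ Finset.range n, (1 - c / C) ^ k := by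
  induction n with
  | zero =>
    simp [quenchedMGF_zero]
  | succ n ih =>
    obtain ⟨-, -, -, -, h1, -, -⟩ := log_quenchedMGF_succ hd hc hcC h π₀ π n
    rw [birkhoffSum_succ, shift_iterate, Finset.sum_range_succ, mul_add]
    have := abs_add_le (Real.log (quenchedMGF ω π l n).toReal -
      birkhoffSum shift (logGrowth π₀ l) n ω) (Real.log (quenchedMGF ω π l (n + 1)).toReal -
      Real.log (quenchedMGF ω π l n).toReal - logGrowth π₀ l (translate n ω))
    refine le_trans (le_of_eq ?_) (this.trans (add_le_add ih h1))
    congr 1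
    ring

theorem ae_tendsto_log_quenchedMGF (hd : 0 < d) (herg : Ergodic shift η) {c C : ℝ} (hc : 0 < c)
    (hcC : c ≤ C) {l : ℝ} (h : ∀ᵐ ω ∂η, PhiBounded c C ω l) (π₀ : PMF (Fin d)) :
    ∀ᵐ ω ∂η, ∀ π : PMF (Fin d),
      Tendsto (fun n : ℕ => Real.log (quenchedMGF ω π l n).toReal / n) atTop
        (𝓝 (freeEnergy η π₀ l)) := by
  set K := max |Real.log (d * c)| |Real.log (d * C)| with hK
  have hK0 : 0 ≤ K := (abs_nonneg _).trans (le_max_left _ _)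
  have hC : 0 < C := hc.trans_le hcC
  have hρ0 : 0 ≤ 1 - c / C := by rw [sub_nonneg, div_le_one hC]; exact hcC
  have hρ1 : 1 - c / C < 1 := by linarith [div_pos hc hC]
  have hmeas : Measurable fun ω : Env d => clip K (logGrowth π₀ l ω) :=
    measurable_const.max (measurable_const.min (measurable_logGrowth π₀ l))
  have hB := ae_tendsto_birkhoffSum_div herg hmeas fun ω => abs_clip_le hK0 _
  have hint : ∫ ω, clip K (logGrowth π₀ l ω) ∂η = freeEnergy η π₀ l :=
    integral_congr_ae (by
      filter_upwards [h] with ω hω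
      exact clip_of_abs_le (abs_logGrowth_le hd hc hcC hω π₀))
  rw [hint] at hB
  filter_upwards [hB, h] with ω h1 h2 π
  have h3 : ∀ n, birkhoffSum shift (fun ω => clip K (logGrowth π₀ l ω)) n ω =
      birkhoffSum shift (logGrowth π₀ l) n ω := fun n =>
    Finset.sum_congr rfl fun k _ => by
      rw [shift_iterate]
      exact clip_of_abs_le (abs_logGrowth_le hd hc hcC (h2.translate k) π₀)
  simp_rw [h3] at h1
  have h4 : Tendsto (fun n : ℕ => (Real.log (quenchedMGF ω π l n).toReal -
      birkhoffSum shift (logGrowth π₀ l) n ω) / n) atTop (𝓝 0) := by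
    refine squeeze_zero_norm (a := fun n : ℕ => d * C / c * (1 - (1 - c / C))⁻¹ / n) (fun n => ?_)
      (tendsto_const_div_atTop_nhds_zero_nat _)
    rw [norm_div, Real.norm_natCast, Real.norm_eq_abs]
    refine div_le_div_of_nonneg_right ?_ n.cast_nonneg
    refine (abs_log_quenchedMGF_sub_le hd hc hcC h2 π₀ π n).trans ?_
    refine mul_le_mul_of_nonneg_left ?_ (by positivity)
    rw [← tsum_geometric_of_lt_one hρ0 hρ1]
    exact (summable_geometric_of_lt_one hρ0 hρ1).sum_le_tsum _ fun k _ => pow_nonneg hρ0 k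
  have h5 := h4.add h1
  rw [zero_add] at h5
  refine h5.congr fun n => ?_
  rw [← add_div, sub_add_cancel]

theorem measurable_quenchedMGF (π : PMF (Fin d)) (l : ℝ) (n : ℕ) :
    Measurable fun ω => quenchedMGF ω π l n := by
  simp_rw [quenchedMGF_eq]
  exact Finset.measurable_sum _ fun i _ =>
    (Finset.measurable_sum _ fun j _ => measurable_hitGen _ _ _ _).const_mul _

theorem abs_log_quenchedMGF_le (hd : 0 < d) {c C : ℝ} (hc : 0 < c) (hcC : c ≤ C) {ω : Env d}
    {l : ℝ} (h : PhiBounded c C ω l) (π : PMF (Fin d)) (n : ℕ) :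
    |Real.log (quenchedMGF ω π l n).toReal| ≤
      n * max |Real.log (d * c)| |Real.log (d * C)| + d * C / c * n := by
  have hC : 0 < C := hc.trans_le hcC
  have hρ0 : 0 ≤ 1 - c / C := by rw [sub_nonneg, div_le_one hC]; exact hcC
  have hρ1 : 1 - c / C ≤ 1 := by linarith [div_pos hc hC]
  have h1 := abs_log_quenchedMGF_sub_le hd hc hcC h π π n
  have h2 : |birkhoffSum shift (logGrowth π l) n ω| ≤
      n * max |Real.log (d * c)| |Real.log (d * C)| := by
    refine (Finset.abs_sum_le_sum_abs _ _).trans ?_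
    refine (Finset.sum_le_sum fun k _ => ?_).trans (b := ∑ k ∈ Finset.range n,
      max |Real.log (d * c)| |Real.log (d * C)|) (by simp)
    rw [shift_iterate]
    exact abs_logGrowth_le hd hc hcC (h.translate k) π
  have h3 : ∑ k ∈ Finset.range n, (1 - c / C) ^ k ≤ n := by
    refine (Finset.sum_le_sum fun k _ => pow_le_one₀ hρ0 hρ1).trans ?_
    simp
  have h4 := mul_le_mul_of_nonneg_left h3 (show 0 ≤ d * C / c by positivity)
  have h5 := abs_sub_abs_le_abs_sub (Real.log (quenchedMGF ω π l n).toReal)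
    (birkhoffSum shift (logGrowth π l) n ω)
  linarith

theorem integrable_log_quenchedMGF (hd : 0 < d) {c C : ℝ} (hc : 0 < c) (hcC : c ≤ C) {l : ℝ}
    (h : ∀ᵐ ω ∂η, PhiBounded c C ω l) (π : PMF (Fin d)) (n : ℕ) :
    Integrable (fun ω => Real.log (quenchedMGF ω π l n).toReal) η := by
  refine Integrable.of_bound (Real.measurable_log.comp
    (measurable_quenchedMGF π l n).ennreal_toReal).aestronglyMeasurable
    (n * max |Real.log (d * c)| |Real.log (d * C)| + d * C / c * n) ?_
  filter_upwards [h] with ω hω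
  exact abs_log_quenchedMGF_le hd hc hcC hω π n

/-- The annealed increments `E[log Z_{n+1}] - E[log Z_n]` converge to the free energy at a rate that
depends on the parameter only through the bounds on the passage matrices. -/
theorem abs_integral_log_increment_le (hd : 0 < d) (herg : Ergodic shift η) {c C : ℝ} (hc : 0 < c)
    (hcC : c ≤ C) {l : ℝ} (h : ∀ᵐ ω ∂η, PhiBounded c C ω l) (π₀ π : PMF (Fin d)) (n : ℕ) :
    |∫ ω, Real.log (quenchedMGF ω π l (n + 1)).toReal ∂η -
      ∫ ω, Real.log (quenchedMGF ω π l n).toReal ∂η - freeEnergy η π₀ l| ≤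
      d * C / c * (1 - c / C) ^ n := by
  have hmp := measurePreserving_translate herg.toMeasurePreserving n
  have h1 : freeEnergy η π₀ l = ∫ ω, logGrowth π₀ l (translate n ω) ∂η := by
    rw [freeEnergy, ← hmp.map_eq, integral_map (measurable_translate _).aemeasurable
      (measurable_logGrowth π₀ l).aestronglyMeasurable, hmp.map_eq]
  have hi : Integrable (fun ω => logGrowth π₀ l (translate n ω)) η :=
    hmp.integrable_comp_of_integrable (integrable_logGrowth hd hc hcC h π₀)
  have hi1 := integrable_log_quenchedMGF hd hc hcC h π n
  have hi2 := integrable_log_quenchedMGF hd hc hcC h π (n + 1)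
  have h3 := integral_sub (hi2.sub hi1) hi
  simp only [Pi.sub_apply] at h3
  rw [h1, ← integral_sub hi2 hi1, ← h3]
  have h2 := norm_integral_le_of_norm_le_const (μ := η) (C := d * C / c * (1 - c / C) ^ n)
    (f := fun ω => Real.log (quenchedMGF ω π l (n + 1)).toReal -
      Real.log (quenchedMGF ω π l n).toReal - logGrowth π₀ l (translate n ω)) (by
      filter_upwards [h] with ω hω
      exact (log_quenchedMGF_succ hd hc hcC hω π₀ π n).2.2.2.2.1)
  simpa using h2

end Stationary

/-! ### Exponential moments: convexity and second differences -/

section ExpMoment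

/-- The exponential moment `∑ N, e^{l N} w(N)` of a weight function `w` on `ℕ`. -/
def expMoment (w : ℕ → ℝ≥0∞) (l : ℝ) : ℝ≥0∞ := ∑' N, expWeight l N * w N

theorem expMoment_mono (w : ℕ → ℝ≥0∞) {l l' : ℝ} (h : l ≤ l') : expMoment w l ≤ expMoment w l' :=
  ENNReal.tsum_le_tsum fun N => mul_le_mul_left (expWeight_mono h N) _

theorem expMoment_eq_zero_iff (w : ℕ → ℝ≥0∞) (l : ℝ) : expMoment w l = 0 ↔ ∀ N, w N = 0 := by
  rw [expMoment, ENNReal.tsum_eq_zero]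
  exact forall_congr' fun N => by simp [expWeight_ne_zero]

theorem expMoment_toReal_pos {w : ℕ → ℝ≥0∞} {l l' : ℝ} (h : 0 < (expMoment w l).toReal)
    (h' : expMoment w l' ≠ ⊤) : 0 < (expMoment w l').toReal := by
  refine ENNReal.toReal_pos (fun h0 => ?_) h'
  rw [expMoment_eq_zero_iff, ← expMoment_eq_zero_iff w l] at h0
  simp [h0] at h

/-- Hölder's inequality: exponential moments are log-convex. -/
theorem expMoment_le_rpow_mul_rpow (w : ℕ → ℝ≥0∞) (l l' : ℝ) {a b : ℝ} (ha : 0 ≤ a) (hb : 0 ≤ b)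
    (hab : a + b = 1) :
    expMoment w (a * l + b * l') ≤ expMoment w l ^ a * expMoment w l' ^ b := by
  have h1 := ENNReal.lintegral_mul_norm_pow_le (μ := Measure.count)
    (f := fun N : ℕ => expWeight l N * w N) (g := fun N : ℕ => expWeight l' N * w N)
    (measurable_of_countable _).aemeasurable (measurable_of_countable _).aemeasurable ha hb hab
  simp only [lintegral_count] at h1
  refine le_trans (le_of_eq (tsum_congr fun N => ?_)) h1
  rw [ENNReal.mul_rpow_of_nonneg _ _ ha, ENNReal.mul_rpow_of_nonneg _ _ hb, mul_mul_mul_comm,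
    ← ENNReal.rpow_add_of_nonneg _ _ ha hb, hab, ENNReal.rpow_one]
  congr 1
  rw [expWeight, expWeight, expWeight, ENNReal.ofReal_rpow_of_pos (Real.exp_pos _),
    ENNReal.ofReal_rpow_of_pos (Real.exp_pos _), ← ENNReal.ofReal_mul (by positivity),
    ← Real.exp_mul, ← Real.exp_mul, ← Real.exp_add]
  congr 2
  ring

theorem log_expMoment_convex {w : ℕ → ℝ≥0∞} {l l' : ℝ} (hl : expMoment w l ≠ ⊤)
    (hl' : expMoment w l' ≠ ⊤) (hpos : 0 < (expMoment w l).toReal) {a b : ℝ} (ha : 0 ≤ a)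
    (hb : 0 ≤ b) (hab : a + b = 1) :
    Real.log (expMoment w (a * l + b * l')).toReal ≤
      a * Real.log (expMoment w l).toReal + b * Real.log (expMoment w l').toReal := by
  have h1 := expMoment_le_rpow_mul_rpow w l l' ha hb hab
  have hfin : expMoment w l ^ a * expMoment w l' ^ b ≠ ⊤ :=
    ENNReal.mul_ne_top (ENNReal.rpow_ne_top_of_nonneg ha hl) (ENNReal.rpow_ne_top_of_nonneg hb hl')
  have h2 := ENNReal.toReal_mono hfin h1
  have hpos' := expMoment_toReal_pos hpos hl'
  have hpos'' := expMoment_toReal_pos hpos (ne_top_of_le_ne_top hfin h1)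
  rw [ENNReal.toReal_mul, ← ENNReal.toReal_rpow, ← ENNReal.toReal_rpow] at h2
  refine (Real.log_le_log hpos'' h2).trans (le_of_eq ?_)
  rw [Real.log_mul (Real.rpow_pos_of_pos hpos a).ne' (Real.rpow_pos_of_pos hpos' b).ne',
    Real.log_rpow hpos, Real.log_rpow hpos']

/-- A second-order bound on `2 cosh x`. -/
theorem exp_add_exp_neg_le (x : ℝ) : Real.exp x + Real.exp (-x) ≤ 2 + x ^ 2 * Real.exp |x| := by
  wlog hx : 0 ≤ x generalizing x
  · have := this (-x) (by linarith)
    rw [neg_neg, abs_neg, neg_sq] at this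
    linarith
  rw [abs_of_nonneg hx]
  set y := x / 2 with hy
  have hxy : x = y + y := by rw [hy]; ring
  have hy0 : 0 ≤ y := by positivity
  have h1 : Real.exp y - Real.exp (-y) ≤ 2 * y * Real.exp y := by
    have h2 := Real.add_one_le_exp (-(2 * y))
    have h3 : Real.exp (-y) = Real.exp y * Real.exp (-(2 * y)) := by
      rw [← Real.exp_add]; ring_nf
    rw [h3]
    nlinarith [Real.exp_pos y]
  have h0 : 0 ≤ Real.exp y - Real.exp (-y) := sub_nonneg.2 (Real.exp_le_exp.2 (by linarith))
  have h2 : (Real.exp y - Real.exp (-y)) ^ 2 ≤ (2 * y * Real.exp y) ^ 2 :=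
    pow_le_pow_left₀ h0 h1 2
  have h3 : Real.exp y * Real.exp (-y) = 1 := by rw [← Real.exp_add]; simp
  have h4 : Real.exp x = Real.exp y ^ 2 := by rw [hxy, Real.exp_add]; ring
  have h5 : Real.exp (-x) = Real.exp (-y) ^ 2 := by rw [hxy, neg_add, Real.exp_add]; ring
  rw [h4, h5, hxy]
  nlinarith

theorem expWeight_second_difference (l : ℝ) {h δ : ℝ} (hδ : 0 < δ) (hh : |h| ≤ δ) (N : ℕ) :
    expWeight (l + h) N + expWeight (l - h) N ≤
      2 * expWeight l N + ENNReal.ofReal (2 * h ^ 2 / δ ^ 2) * expWeight (l + 2 * δ) N := by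
  have h2 : (2 : ℝ≥0∞) = ENNReal.ofReal 2 := by simp
  simp only [expWeight]
  rw [h2, ← ENNReal.ofReal_add (by positivity) (by positivity), ← ENNReal.ofReal_mul (by positivity),
    ← ENNReal.ofReal_mul (by positivity), ← ENNReal.ofReal_add (by positivity) (by positivity)]
  refine ENNReal.ofReal_le_ofReal ?_
  have hN : (0 : ℝ) ≤ N := N.cast_nonneg
  have e1 : Real.exp ((l + h) * N) = Real.exp (l * N) * Real.exp (h * N) := by
    rw [← Real.exp_add]; ring_nf
  have e2 : Real.exp ((l - h) * N) = Real.exp (l * N) * Real.exp (-(h * N)) := by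
    rw [← Real.exp_add]; ring_nf
  have e3 : Real.exp ((l + 2 * δ) * N) =
      Real.exp (l * N) * (Real.exp (δ * N) * Real.exp (δ * N)) := by
    rw [← Real.exp_add, ← Real.exp_add]; ring_nf
  have k1 := exp_add_exp_neg_le (h * N)
  have k2 : Real.exp |h * N| ≤ Real.exp (δ * N) := by
    rw [abs_mul, abs_of_nonneg hN]
    exact Real.exp_le_exp.2 (mul_le_mul_of_nonneg_right hh hN)
  have k3 : (h * N) ^ 2 ≤ 2 * h ^ 2 / δ ^ 2 * Real.exp (δ * N) := by
    have := Real.quadratic_le_exp_of_nonneg (show 0 ≤ δ * N by positivity)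
    have h4 : (δ * N) ^ 2 ≤ 2 * Real.exp (δ * N) := by nlinarith [mul_nonneg hδ.le hN]
    calc (h * N) ^ 2 = h ^ 2 / δ ^ 2 * (δ * N) ^ 2 := by field_simp
      _ ≤ h ^ 2 / δ ^ 2 * (2 * Real.exp (δ * N)) := mul_le_mul_of_nonneg_left h4 (by positivity)
      _ = _ := by ring
  have k4 : (h * N) ^ 2 * Real.exp |h * N| ≤
      2 * h ^ 2 / δ ^ 2 * Real.exp (δ * N) * Real.exp (δ * N) :=
    mul_le_mul k3 k2 (Real.exp_pos _).le (by positivity)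
  rw [e1, e2, e3]
  nlinarith [Real.exp_pos (l * N)]

theorem expMoment_second_difference (w : ℕ → ℝ≥0∞) (l : ℝ) {h δ : ℝ} (hδ : 0 < δ) (hh : |h| ≤ δ) :
    expMoment w (l + h) + expMoment w (l - h) ≤
      2 * expMoment w l + ENNReal.ofReal (2 * h ^ 2 / δ ^ 2) * expMoment w (l + 2 * δ) := by
  simp only [expMoment]
  rw [← ENNReal.tsum_add, ← ENNReal.tsum_mul_left, ← ENNReal.tsum_mul_left, ← ENNReal.tsum_add]
  refine ENNReal.tsum_le_tsum fun N => ?_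
  rw [← add_mul, ← mul_assoc, ← mul_assoc, ← add_mul]
  exact mul_le_mul_left (expWeight_second_difference l hδ hh N) _

/-- If the exponential moment grows by a factor of at most `M ^ n` when the parameter grows by `ε`,
then by log-convexity it grows by a factor of at most `M` over `ε / n`; this bounds the second
differences of its logarithm by a multiple of `n ^ 2`. -/
theorem log_expMoment_second_difference {w : ℕ → ℝ≥0∞} {l ε M : ℝ} {n : ℕ} (hn : 0 < n)
    (hε : 0 < ε) (hM : 0 ≤ M) (hfin : expMoment w (l + ε) ≠ ⊤) (hpos : 0 < (expMoment w l).toReal)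
    (hratio : (expMoment w (l + ε)).toReal ≤ M ^ n * (expMoment w l).toReal) {h : ℝ}
    (hh : |h| ≤ ε / (2 * n)) :
    Real.log (expMoment w (l + h)).toReal + Real.log (expMoment w (l - h)).toReal -
      2 * Real.log (expMoment w l).toReal ≤ 8 * M / ε ^ 2 * n ^ 2 * h ^ 2 := by
  have hn' : (0 : ℝ) < n := Nat.cast_pos.2 hn
  have hn1 : (1 : ℝ) ≤ n := Nat.one_le_cast.2 hn
  set δ := ε / (2 * n) with hδ
  have hδ0 : 0 < δ := by positivity
  have hδε : 2 * δ ≤ ε := by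
    rw [hδ]
    calc 2 * (ε / (2 * n)) = ε / n := by field_simp
      _ ≤ ε := div_le_self hε.le hn1
  have hfin' : ∀ l', l' ≤ l + ε → expMoment w l' ≠ ⊤ := fun l' hl' =>
    ne_top_of_le_ne_top hfin (expMoment_mono w hl')
  have hp := expMoment_toReal_pos hpos (hfin' (l + h) (by linarith [le_abs_self h]))
  have hm := expMoment_toReal_pos hpos (hfin' (l - h) (by linarith [neg_abs_le h]))
  have h1 := expMoment_second_difference w l hδ0 hh
  have hfl := hfin' l (by linarith)
  have hf2 := hfin' (l + 2 * δ) (by linarith)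
  have h2 := ENNReal.toReal_mono (ENNReal.add_ne_top.2 ⟨ENNReal.mul_ne_top (by simp) hfl,
    ENNReal.mul_ne_top ENNReal.ofReal_ne_top hf2⟩) h1
  rw [ENNReal.toReal_add (hfin' _ (by linarith [le_abs_self h]))
    (hfin' _ (by linarith [neg_abs_le h])), ENNReal.toReal_add (ENNReal.mul_ne_top (by simp) hfl)
    (ENNReal.mul_ne_top ENNReal.ofReal_ne_top hf2), ENNReal.toReal_mul, ENNReal.toReal_mul,
    ENNReal.toReal_ofReal (by positivity)] at h2
  have h3 : (expMoment w (l + 2 * δ)).toReal ≤ M * (expMoment w l).toReal := by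
    have ha : (0 : ℝ) ≤ 1 - 1 / n := by rw [sub_nonneg, div_le_one hn']; exact hn1
    have hb : (0 : ℝ) ≤ 1 / n := by positivity
    have h4 := expMoment_le_rpow_mul_rpow w l (l + ε) ha hb (by ring)
    have h5 : (1 - 1 / (n : ℝ)) * l + 1 / n * (l + ε) = l + 2 * δ := by
      rw [hδ]; field_simp; ring
    rw [h5] at h4
    have h6 := ENNReal.toReal_mono (ENNReal.mul_ne_top (ENNReal.rpow_ne_top_of_nonneg ha hfl)
      (ENNReal.rpow_ne_top_of_nonneg hb hfin)) h4
    rw [ENNReal.toReal_mul, ← ENNReal.toReal_rpow, ← ENNReal.toReal_rpow] at h6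
    refine h6.trans ?_
    calc (expMoment w l).toReal ^ (1 - 1 / (n : ℝ)) * (expMoment w (l + ε)).toReal ^ (1 / (n : ℝ))
        ≤ (expMoment w l).toReal ^ (1 - 1 / (n : ℝ)) *
          (M ^ n * (expMoment w l).toReal) ^ (1 / (n : ℝ)) :=
          mul_le_mul_of_nonneg_left (Real.rpow_le_rpow ENNReal.toReal_nonneg hratio hb)
            (Real.rpow_nonneg hpos.le _)
      _ = M * ((expMoment w l).toReal ^ (1 - 1 / (n : ℝ)) *
          (expMoment w l).toReal ^ (1 / (n : ℝ))) := by
          rw [Real.mul_rpow (by positivity) hpos.le, one_div, Real.pow_rpow_inv_natCast hM hn.ne']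
          ring
      _ = M * (expMoment w l).toReal := by
          rw [← Real.rpow_add hpos, sub_add_cancel, Real.rpow_one]
  set Z := (expMoment w l).toReal with hZ
  have h4 : Real.log (expMoment w (l + h)).toReal - Real.log Z ≤
      (expMoment w (l + h)).toReal / Z - 1 := by
    rw [← Real.log_div hp.ne' hpos.ne']
    exact Real.log_le_sub_one_of_pos (div_pos hp hpos)
  have h5 : Real.log (expMoment w (l - h)).toReal - Real.log Z ≤
      (expMoment w (l - h)).toReal / Z - 1 := by
    rw [← Real.log_div hm.ne' hpos.ne']
    exact Real.log_le_sub_one_of_pos (div_pos hm hpos)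
  have h6 : ((expMoment w (l + h)).toReal + (expMoment w (l - h)).toReal) / Z ≤
      2 + 2 * h ^ 2 / δ ^ 2 * M := by
    rw [div_le_iff₀ hpos]
    have h7 := mul_le_mul_of_nonneg_left h3 (show 0 ≤ 2 * h ^ 2 / δ ^ 2 by positivity)
    have h8 : (2 : ℝ≥0∞).toReal = 2 := by simp
    rw [h8] at h2
    linarith
  rw [add_div] at h6
  have h7 : 2 * h ^ 2 / δ ^ 2 * M = 8 * M / ε ^ 2 * n ^ 2 * h ^ 2 := by
    rw [hδ]; field_simp; ring
  linarith

end ExpMoment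

/-- A convex function is differentiable where its symmetric second differences are `o(h)` along
some sequence. -/
theorem differentiableAt_of_convexOn_of_second_difference {S : Set ℝ} {f : ℝ → ℝ}
    (hf : ConvexOn ℝ S f) {x : ℝ} (hx : x ∈ interior S) {h e : ℕ → ℝ} (hh : ∀ n, 0 < h n)
    (he : Tendsto e atTop (𝓝 0)) (hS : ∀ᶠ n in atTop, x + h n ∈ S ∧ x - h n ∈ S)
    (hdiff : ∀ᶠ n in atTop, f (x + h n) + f (x - h n) - 2 * f x ≤ e n * h n) :
    DifferentiableAt ℝ f x := by
  have hR := hf.hasDerivWithinAt_rightDeriv_of_mem_interior hx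
  have hL := hf.hasDerivWithinAt_leftDeriv_of_mem_interior hx
  have hLR := hf.leftDeriv_le_rightDeriv_of_mem_interior hx
  have hgap : derivWithin f (Set.Ioi x) x - derivWithin f (Set.Iio x) x ≤ 0 := by
    refine ge_of_tendsto he ?_
    filter_upwards [hS, hdiff] with n hSn hdn
    have h1 := hf.rightDeriv_le_slope_of_mem_interior hx hSn.1 (by linarith [hh n])
    have h2 := hf.slope_le_leftDeriv_of_mem_interior hSn.2 hx (by linarith [hh n])
    rw [slope_def_field, add_sub_cancel_left, le_div_iff₀ (hh n)] at h1
    rw [slope_def_field, sub_sub_cancel, div_le_iff₀ (hh n)] at h2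
    have h3 : (derivWithin f (Set.Ioi x) x - derivWithin f (Set.Iio x) x) * h n ≤ e n * h n := by
      linarith
    exact le_of_mul_le_mul_right h3 (hh n)
  have heq : derivWithin f (Set.Ioi x) x = derivWithin f (Set.Iio x) x := by linarith
  rw [heq] at hR
  have h1 := hL.Iic_of_Iio.union hR.Ici_of_Ioi
  rw [Set.Iic_union_Ici, hasDerivWithinAt_univ] at h1
  exact h1.differentiableAt

/-! ### Convexity and differentiability of the free energy -/

section FreeEnergyRegularity

variable {d : ℕ} {η : Measure (Env d)} {κ : ℝ} [IsProbabilityMeasure η]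

theorem quenchedMGF_eq_expMoment (ω : Env d) (π : PMF (Fin d)) (l : ℝ) (n : ℕ) :
    quenchedMGF ω π l n = expMoment (hitLaw ω π n) l :=
  quenchedMGF_eq_tsum ω π l n

theorem quenchedMGF_pow_bounds (hd : 0 < d) {c C : ℝ} (hc : 0 < c) (hcC : c ≤ C) {ω : Env d}
    {l : ℝ} (h : PhiBounded c C ω l) (π : PMF (Fin d)) (n : ℕ) :
    (d * c) ^ n ≤ (quenchedMGF ω π l n).toReal ∧
      (quenchedMGF ω π l n).toReal ≤ (d * C) ^ n := by
  have hdR : (0 : ℝ) < d := Nat.cast_pos.2 hd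
  induction n with
  | zero => simp [quenchedMGF_zero]
  | succ n ih =>
    obtain ⟨h1, h2, -⟩ := log_quenchedMGF_succ hd hc hcC h π π n
    rw [pow_succ', pow_succ']
    exact ⟨(mul_le_mul_of_nonneg_left ih.1 (mul_pos hdR hc).le).trans h1,
      h2.trans (mul_le_mul_of_nonneg_left ih.2 (mul_pos hdR (hc.trans_le hcC)).le)⟩

theorem convexOn_freeEnergy (hd : 0 < d) (herg : Ergodic shift η) (hκ : 0 < κ)
    (hell : ∀ᵐ ω ∂η, ∀ n : ℤ, IsElliptic κ (ω n)) (π₀ : PMF (Fin d)) :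
    ConvexOn ℝ (Set.Iic (critParam η)) (freeEnergy η π₀) := by
  refine ⟨convex_Iic _, fun x hx y hy a b ha hb hab => ?_⟩
  have hz : a * x + b * y ≤ critParam η := by
    have := convex_Iic (critParam η) hx hy ha hb hab
    simpa using this
  obtain ⟨c, C, hc, hcC, hbd⟩ := exists_ae_PhiBounded hd herg.toMeasurePreserving hκ hell
    (|x| + |y| + |a * x + b * y|)
  have bx := hbd x (by linarith [neg_abs_le x, abs_nonneg y, abs_nonneg (a * x + b * y)]) hx
  have bY := hbd y (by linarith [neg_abs_le y, abs_nonneg x, abs_nonneg (a * x + b * y)]) hy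
  have bz := hbd (a * x + b * y)
    (by linarith [neg_abs_le (a * x + b * y), abs_nonneg x, abs_nonneg y]) hz
  obtain ⟨ω, ⟨⟨⟨⟨tx, ty⟩, tz⟩, wx⟩, wy⟩⟩ :=
    (((((ae_tendsto_log_quenchedMGF hd herg hc hcC bx π₀).and
      (ae_tendsto_log_quenchedMGF hd herg hc hcC bY π₀)).and
      (ae_tendsto_log_quenchedMGF hd herg hc hcC bz π₀)).and bx).and bY).exists
  have hlim := ((tx π₀).const_mul a).add ((ty π₀).const_mul b)
  simp only [smul_eq_mul]
  refine le_of_tendsto_of_tendsto' (tz π₀) hlim fun n => ?_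
  obtain ⟨-, -, hpx, hfx, -⟩ := log_quenchedMGF_succ hd hc hcC wx π₀ π₀ n
  obtain ⟨-, -, -, hfy, -⟩ := log_quenchedMGF_succ hd hc hcC wy π₀ π₀ n
  rw [quenchedMGF_eq_expMoment] at hpx hfx hfy
  simp only [quenchedMGF_eq_expMoment]
  have := log_expMoment_convex hfx hfy hpx ha hb hab
  calc _ ≤ (a * Real.log (expMoment (hitLaw ω π₀ n) x).toReal +
        b * Real.log (expMoment (hitLaw ω π₀ n) y).toReal) / n :=
        div_le_div_of_nonneg_right this n.cast_nonneg
    _ = _ := by ring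

/-- The free energy is approximated by the increments of `E[log Z_n]` with an error that is
exponentially small in `n`, while the second differences of `E[log Z_n]` are only of order
`n ^ 2 h ^ 2`; so the second differences of the free energy are `o(h)`. -/
theorem differentiableAt_freeEnergy (hd : 0 < d) (herg : Ergodic shift η) (hκ : 0 < κ)
    (hell : ∀ᵐ ω ∂η, ∀ n : ℤ, IsElliptic κ (ω n)) (π₀ : PMF (Fin d)) {l : ℝ}
    (hl : l < critParam η) : DifferentiableAt ℝ (freeEnergy η π₀) l := by
  set ε := critParam η - l with hεdef
  have hε : 0 < ε := sub_pos.2 hl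
  obtain ⟨c, C, hc, hcC, hbd⟩ := exists_ae_PhiBounded hd herg.toMeasurePreserving hκ hell (ε - l)
  have hdR : (0 : ℝ) < d := Nat.cast_pos.2 hd
  have hC : 0 < C := hc.trans_le hcC
  set ρ := 1 - c / C with hρ
  have hρ0 : 0 ≤ ρ := by rw [hρ, sub_nonneg, div_le_one hC]; exact hcC
  have hρ1 : ρ < 1 := by linarith [div_pos hc hC]
  have hbd' : ∀ x, |x| ≤ ε → ∀ᵐ ω ∂η, PhiBounded c C ω (l + x) := fun x hx =>
    hbd _ (by linarith [neg_abs_le x]) (by linarith [le_abs_self x])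
  let L : ℕ → ℝ → ℝ := fun n x => ∫ ω, Real.log (quenchedMGF ω π₀ x n).toReal ∂η
  have hint : ∀ n x, |x| ≤ ε →
      Integrable (fun ω => Real.log (quenchedMGF ω π₀ (l + x) n).toReal) η := fun n x hx =>
    integrable_log_quenchedMGF hd hc hcC (hbd' x hx) π₀ n
  have hfree : ∀ n x, |x| ≤ ε → |L (n + 1) (l + x) - L n (l + x) - freeEnergy η π₀ (l + x)| ≤
      d * C / c * ρ ^ n := fun n x hx =>
    abs_integral_log_increment_le hd herg hc hcC (hbd' x hx) π₀ π₀ n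
  have habs0 : |(0 : ℝ)| ≤ ε := by simpa using hε.le
  have hint2 : ∀ n h, |h| ≤ ε → L n (l + h) + L n (l - h) - 2 * L n l =
      ∫ ω, (Real.log (quenchedMGF ω π₀ (l + h) n).toReal +
        Real.log (quenchedMGF ω π₀ (l - h) n).toReal -
        2 * Real.log (quenchedMGF ω π₀ l n).toReal) ∂η := by
    intro n h hh
    have i1 := hint n h hh
    have i2 := hint n (-h) (by rwa [abs_neg])
    have i3 := hint n 0 habs0
    rw [← sub_eq_add_neg] at i2
    rw [add_zero] at i3
    have e1 := integral_sub (i1.add i2) (i3.const_mul 2)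
    have e2 := integral_add i1 i2
    simp only [Pi.add_apply] at e1
    rw [e1, e2, integral_const_mul]
  have hupper : ∀ n h, |h| ≤ ε / (2 * (n + 1 : ℕ)) →
      L (n + 1) (l + h) + L (n + 1) (l - h) - 2 * L (n + 1) l ≤
        8 * (C / c) / ε ^ 2 * (n + 1 : ℕ) ^ 2 * h ^ 2 := by
    intro n h hh
    have hhε : |h| ≤ ε := hh.trans (div_le_self hε.le (by push_cast; linarith [(n.cast_nonneg : (0 : ℝ) ≤ n)]))
    rw [hint2 _ _ hhε]
    have i1 := hint (n + 1) h hhε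
    have i2 := hint (n + 1) (-h) (by rwa [abs_neg])
    have i3 := hint (n + 1) 0 habs0
    rw [← sub_eq_add_neg] at i2
    rw [add_zero] at i3
    have := integral_mono_ae ((i1.add i2).sub (i3.const_mul 2)) (integrable_const
      (8 * (C / c) / ε ^ 2 * (n + 1 : ℕ) ^ 2 * h ^ 2)) (by
        have b0 := hbd' 0 habs0
        rw [add_zero] at b0
        filter_upwards [b0, hbd' ε (abs_of_pos hε).le] with ω w0 w1
        obtain ⟨-, -, p0, -, -⟩ := log_quenchedMGF_succ hd hc hcC w0 π₀ π₀ (n + 1)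
        obtain ⟨-, -, -, f1, -⟩ := log_quenchedMGF_succ hd hc hcC w1 π₀ π₀ (n + 1)
        have hr : (quenchedMGF ω π₀ (l + ε) (n + 1)).toReal ≤
            (C / c) ^ (n + 1) * (quenchedMGF ω π₀ l (n + 1)).toReal := by
          refine (quenchedMGF_pow_bounds hd hc hcC w1 π₀ (n + 1)).2.trans ?_
          refine le_trans (le_of_eq ?_) (mul_le_mul_of_nonneg_left
            (quenchedMGF_pow_bounds hd hc hcC w0 π₀ (n + 1)).1 (by positivity))
          rw [← mul_pow]
          congr 1
          field_simp
        simp only [quenchedMGF_eq_expMoment] at p0 f1 hr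
        simp only [Pi.sub_apply, Pi.add_apply, quenchedMGF_eq_expMoment]
        exact log_expMoment_second_difference (Nat.succ_pos n) hε (by positivity) f1 p0 hr hh)
    simpa using this
  have hlower : ∀ n h, |h| ≤ ε → 0 ≤ L n (l + h) + L n (l - h) - 2 * L n l := by
    intro n h hh
    rw [hint2 _ _ hh]
    refine integral_nonneg_of_ae ?_
    filter_upwards [hbd' h hh, hbd' (-h) (by rwa [abs_neg])] with ω w1 w2
    rw [← sub_eq_add_neg] at w2
    obtain ⟨-, -, p1, f1, -⟩ := log_quenchedMGF_succ hd hc hcC w1 π₀ π₀ n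
    obtain ⟨-, -, -, f2, -⟩ := log_quenchedMGF_succ hd hc hcC w2 π₀ π₀ n
    simp only [quenchedMGF_eq_expMoment] at p1 f1 f2
    simp only [quenchedMGF_eq_expMoment, Pi.zero_apply]
    have := log_expMoment_convex f1 f2 p1 (a := 1 / 2) (b := 1 / 2) (by norm_num) (by norm_num)
      (by norm_num)
    have e : 1 / 2 * (l + h) + 1 / 2 * (l - h) = l := by ring
    rw [e] at this
    linarith
  -- Along `h = s ^ n` with `ρ < s < 1` both error terms are `o(h)`.
  obtain ⟨s, hs0, hs1, hρs⟩ : ∃ s : ℝ, 0 < s ∧ s < 1 ∧ ρ < s := by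
    obtain ⟨s, h1, h2⟩ := exists_between hρ1
    exact ⟨s, hρ0.trans_lt h1, h2, h1⟩
  have hconv := convexOn_freeEnergy hd herg hκ hell π₀
  let e : ℕ → ℝ := fun n => 8 * (C / c) / ε ^ 2 * (((n : ℝ) + 1) ^ 2 * s ^ n) +
    4 * (d * C / c) * (ρ / s) ^ n
  have hpoly : Tendsto (fun n : ℕ => ((n : ℝ) + 1) ^ 2 * s ^ n) atTop (𝓝 0) := by
    have h1 := (tendsto_pow_const_mul_const_pow_of_lt_one 2 hs0.le hs1).comp (tendsto_add_atTop_nat 1)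
    have h2 := h1.const_mul s⁻¹
    rw [mul_zero] at h2
    refine h2.congr fun n => ?_
    simp only [Function.comp_apply]
    push_cast
    field_simp
    ring
  have he : Tendsto e atTop (𝓝 0) := by
    have h1 := hpoly.const_mul (8 * (C / c) / ε ^ 2)
    have h2 := (tendsto_pow_atTop_nhds_zero_of_lt_one (div_nonneg hρ0 hs0.le)
      ((div_lt_one hs0).2 hρs)).const_mul (4 * (d * C / c))
    simpa using h1.add h2
  have hsmall : ∀ᶠ n : ℕ in atTop, s ^ n ≤ ε / (2 * (n + 1 : ℕ)) := by
    filter_upwards [hpoly.eventually_le_const (half_pos hε)] with n hn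
    have hn1 : (1 : ℝ) ≤ n + 1 := by linarith [(n.cast_nonneg : (0 : ℝ) ≤ n)]
    push_cast
    rw [le_div_iff₀ (by positivity)]
    have : ((n : ℝ) + 1) * s ^ n ≤ ((n : ℝ) + 1) ^ 2 * s ^ n :=
      mul_le_mul_of_nonneg_right (by nlinarith) (by positivity)
    linarith
  refine differentiableAt_of_convexOn_of_second_difference hconv (h := fun n => s ^ n) (e := e)
    (by rw [interior_Iic]; exact hl) (fun n => by positivity) he ?_ ?_
  · filter_upwards [hsmall] with n hn
    have hle : s ^ n ≤ ε := hn.trans (div_le_self hε.le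
      (by push_cast; linarith [(n.cast_nonneg : (0 : ℝ) ≤ n)]))
    have : 0 < s ^ n := by positivity
    exact ⟨by simp only [Set.mem_Iic]; linarith, by simp only [Set.mem_Iic]; linarith⟩
  · filter_upwards [hsmall] with n hn
    have hpos : 0 < s ^ n := by positivity
    have habs : |s ^ n| = s ^ n := abs_of_pos hpos
    have hle : |s ^ n| ≤ ε := by
      rw [habs]
      exact hn.trans (div_le_self hε.le (by push_cast; linarith [(n.cast_nonneg : (0 : ℝ) ≤ n)]))
    have u := hupper n (s ^ n) (by rw [habs]; exact hn)
    have v := hlower n (s ^ n) hle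
    have f1 := hfree n (s ^ n) hle
    have f2 := hfree n (-s ^ n) (by rwa [abs_neg])
    have f3 := hfree n 0 habs0
    rw [← sub_eq_add_neg] at f2
    rw [add_zero] at f3
    rw [abs_le] at f1 f2 f3
    have hexp : e n * s ^ n = 8 * (C / c) / ε ^ 2 * (n + 1 : ℕ) ^ 2 * (s ^ n) ^ 2 +
        4 * (d * C / c * ρ ^ n) := by
      simp only [e]
      rw [div_pow]
      push_cast
      field_simp
    rw [hexp]
    linarith [f1.1, f1.2, f2.1, f2.2, f3.1, f3.2]

end FreeEnergyRegularity

/-! ### Exponential rates -/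

section ExponentialRate

theorem expWeight_add_left (a b : ℝ) (n : ℕ) :
    expWeight (a + b) n = expWeight a n * expWeight b n := by
  rw [expWeight, expWeight, expWeight, ← ENNReal.ofReal_mul (Real.exp_pos _).le, ← Real.exp_add]
  ring_nf

theorem expWeight_zero_left (n : ℕ) : expWeight 0 n = 1 := by simp [expWeight]

theorem expWeight_neg_mul (a : ℝ) (n : ℕ) : expWeight (-a) n * expWeight a n = 1 := by
  rw [← expWeight_add_left, neg_add_cancel, expWeight_zero_left]

theorem expWeight_le_mul_iff (a b : ℝ) (n : ℕ) (x : ℝ≥0∞) :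
    expWeight a n ≤ expWeight b n * x ↔ expWeight (a - b) n ≤ x := by
  constructor
  · intro h
    calc expWeight (a - b) n = expWeight (-b) n * expWeight a n := by
          rw [← expWeight_add_left]; ring_nf
      _ ≤ expWeight (-b) n * (expWeight b n * x) := mul_le_mul_right h _
      _ = x := by rw [← mul_assoc, expWeight_neg_mul, one_mul]
  · intro h
    calc expWeight a n = expWeight b n * expWeight (a - b) n := by
          rw [← expWeight_add_left]; ring_nf
      _ ≤ _ := mul_le_mul_right h _

theorem eventually_const_mul_expWeight_le {K : ℝ≥0∞} (hK : K ≠ ⊤) {a b : ℝ} (hab : a < b) :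
    ∀ᶠ n : ℕ in atTop, K * expWeight a n ≤ expWeight b n := by
  have h1 : Tendsto (fun n : ℕ => Real.exp ((b - a) * n)) atTop atTop :=
    Real.tendsto_exp_atTop.comp
      (tendsto_natCast_atTop_atTop.const_mul_atTop (sub_pos.2 hab))
  filter_upwards [h1.eventually_ge_atTop K.toReal] with n hn
  have h2 : K ≤ expWeight (b - a) n := (ENNReal.le_ofReal_iff_toReal_le hK (Real.exp_pos _).le).2 hn
  calc K * expWeight a n ≤ expWeight (b - a) n * expWeight a n := mul_le_mul_left h2 _
    _ = expWeight b n := by rw [← expWeight_add_left, sub_add_cancel]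

theorem log_expWeight_div (a : ℝ) {n : ℕ} (hn : 0 < n) :
    ENNReal.log (expWeight a n) / (n : EReal) = a := by
  rw [expWeight, ENNReal.log_ofReal_of_pos (Real.exp_pos _), Real.log_exp, ← EReal.coe_natCast,
    ← EReal.coe_div, mul_div_cancel_right₀ _ (Nat.cast_pos.2 hn).ne']

theorem log_div_mono {x y : ℝ≥0∞} (h : x ≤ y) (n : ℕ) :
    ENNReal.log x / (n : EReal) ≤ ENNReal.log y / (n : EReal) :=
  EReal.div_le_div_right_of_nonneg (by positivity) (ENNReal.log_le_log h)

theorem eventually_expWeight_le {z : ℕ → ℝ≥0∞} {L a : ℝ}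
    (h : Tendsto (fun n : ℕ => ENNReal.log (z n) / (n : EReal)) atTop (𝓝 (L : EReal)))
    (ha : a < L) : ∀ᶠ n : ℕ in atTop, expWeight a n ≤ z n := by
  filter_upwards [h.eventually_const_lt (EReal.coe_lt_coe_iff.2 ha), eventually_gt_atTop 0]
    with n hn hn0
  by_contra hlt
  have h1 := log_div_mono (not_le.1 hlt).le n
  rw [log_expWeight_div a hn0] at h1
  exact absurd hn h1.not_gt

theorem eventually_le_expWeight {z : ℕ → ℝ≥0∞} {L a : ℝ}
    (h : Tendsto (fun n : ℕ => ENNReal.log (z n) / (n : EReal)) atTop (𝓝 (L : EReal)))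
    (ha : L < a) : ∀ᶠ n : ℕ in atTop, z n ≤ expWeight a n := by
  filter_upwards [h.eventually_lt_const (EReal.coe_lt_coe_iff.2 ha), eventually_gt_atTop 0]
    with n hn hn0
  by_contra hlt
  have h1 := log_div_mono (not_le.1 hlt).le n
  rw [log_expWeight_div a hn0] at h1
  exact absurd hn h1.not_gt

theorem le_liminf_of_eventually_expWeight_le {z : ℕ → ℝ≥0∞} {a : ℝ}
    (h : ∀ᶠ n : ℕ in atTop, expWeight a n ≤ z n) :
    (a : EReal) ≤ liminf (fun n : ℕ => ENNReal.log (z n) / (n : EReal)) atTop := by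
  refine le_liminf_of_le ?_ ?_
  · isBoundedDefault
  filter_upwards [h, eventually_gt_atTop 0] with n hn hn0
  rw [← log_expWeight_div a hn0]
  exact log_div_mono hn n

theorem limsup_le_of_eventually_le_expWeight {z : ℕ → ℝ≥0∞} {a : ℝ}
    (h : ∀ᶠ n : ℕ in atTop, z n ≤ expWeight a n) :
    limsup (fun n : ℕ => ENNReal.log (z n) / (n : EReal)) atTop ≤ a := by
  refine limsup_le_of_le ?_ ?_
  · isBoundedDefault
  filter_upwards [h, eventually_gt_atTop 0] with n hn hn0
  rw [← log_expWeight_div a hn0]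
  exact log_div_mono hn n

theorem tendsto_log_div_of_real {z : ℕ → ℝ≥0∞} {L : ℝ} (hz : ∀ n, 0 < (z n).toReal)
    (h : Tendsto (fun n : ℕ => Real.log (z n).toReal / n) atTop (𝓝 L)) :
    Tendsto (fun n : ℕ => ENNReal.log (z n) / (n : EReal)) atTop (𝓝 (L : EReal)) := by
  refine ((continuous_coe_real_ereal.tendsto L).comp h).congr fun n => ?_
  rw [Function.comp_apply, EReal.coe_div, EReal.coe_natCast, ENNReal.log_pos_real' (hz n)]

theorem tendsto_log_div_sub {z : ℕ → ℝ≥0∞} {L : ℝ}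
    (h : Tendsto (fun n : ℕ => ENNReal.log (z n) / (n : EReal)) atTop (𝓝 (L : EReal))) (k : ℕ) :
    Tendsto (fun n : ℕ => ENNReal.log (z (n - k)) / (n : EReal)) atTop (𝓝 (L : EReal)) := by
  have hcmp : ∀ a b : ℝ, ∀ᶠ n : ℕ in atTop, 0 < b - a → b * k ≤ (b - a) * n := fun a b => by
    rcases le_or_gt (b - a) 0 with hab | hab
    · exact Eventually.of_forall fun n h => absurd h hab.not_gt
    · filter_upwards [(tendsto_natCast_atTop_atTop.const_mul_atTop hab).eventually_ge_atTop (b * k)]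
        with n hn _ using hn
  refine tendsto_of_le_liminf_of_limsup_le ?_ ?_
  · refine EReal.ge_of_forall_gt_iff_ge.1 fun a ha => ?_
    obtain ⟨b, hab, hb⟩ := exists_between (EReal.coe_lt_coe_iff.1 ha)
    refine le_liminf_of_eventually_expWeight_le ?_
    filter_upwards [(tendsto_sub_atTop_nat k).eventually (eventually_expWeight_le h hb),
      hcmp a b, eventually_ge_atTop k] with n h1 h2 hn
    refine le_trans (ENNReal.ofReal_le_ofReal (Real.exp_le_exp.2 ?_)) h1
    rw [Nat.cast_sub hn]
    linarith [h2 (sub_pos.2 hab)]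
  · refine EReal.le_of_forall_lt_iff_le.1 fun a ha => ?_
    obtain ⟨b, hb, hba⟩ := exists_between (EReal.coe_lt_coe_iff.1 ha)
    refine limsup_le_of_eventually_le_expWeight ?_
    filter_upwards [(tendsto_sub_atTop_nat k).eventually (eventually_le_expWeight h hb),
      hcmp (-a) (-b), eventually_ge_atTop k] with n h1 h2 hn
    refine h1.trans (ENNReal.ofReal_le_ofReal (Real.exp_le_exp.2 ?_))
    rw [Nat.cast_sub hn]
    linarith [h2 (by linarith)]

/-- The mass that a weight function on `ℕ` gives to `{N | N / n ∈ A}`. -/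
def scaledMass (w : ℕ → ℝ≥0∞) (n : ℕ) (A : Set ℝ) : ℝ≥0∞ :=
  ∑' N : ℕ, (open Classical in if (N : ℝ) / n ∈ A then w N else 0)

theorem scaledMass_mono (w : ℕ → ℝ≥0∞) (n : ℕ) {A B : Set ℝ} (h : A ⊆ B) :
    scaledMass w n A ≤ scaledMass w n B := by
  refine ENNReal.tsum_le_tsum fun N => ?_
  split_ifs with h1 h2
  · exact le_rfl
  · exact absurd (h h1) h2
  · exact zero_le
  · exact le_rfl

theorem scaledMass_union_le (w : ℕ → ℝ≥0∞) (n : ℕ) (A B : Set ℝ) :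
    scaledMass w n (A ∪ B) ≤ scaledMass w n A + scaledMass w n B := by
  classical
  rw [scaledMass, scaledMass, scaledMass, ← ENNReal.tsum_add]
  refine ENNReal.tsum_le_tsum fun N => ?_
  by_cases h1 : (N : ℝ) / n ∈ A <;> by_cases h2 : (N : ℝ) / n ∈ B <;> simp [h1, h2]

theorem scaledMass_empty (w : ℕ → ℝ≥0∞) (n : ℕ) : scaledMass w n ∅ = 0 := by simp [scaledMass]

theorem scaledMass_univ (w : ℕ → ℝ≥0∞) (n : ℕ) : scaledMass w n Set.univ = ∑' N, w N := by
  simp [scaledMass]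

/-- Chernoff's bound. -/
theorem scaledMass_le (w : ℕ → ℝ≥0∞) {n : ℕ} (hn : 0 < n) {A : Set ℝ} {l β : ℝ}
    (hA : ∀ s ∈ A, β ≤ l * s) : scaledMass w n A ≤ expWeight (-β) n * expMoment w l := by
  have hn' : (0 : ℝ) < n := Nat.cast_pos.2 hn
  rw [scaledMass, expMoment, ← ENNReal.tsum_mul_left]
  refine ENNReal.tsum_le_tsum fun N => ?_
  split_ifs with h
  · rw [← mul_assoc]
    refine le_mul_of_one_le_left zero_le ?_
    rw [expWeight, expWeight, ← ENNReal.ofReal_mul (Real.exp_pos _).le, ← Real.exp_add,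
      ENNReal.one_le_ofReal, Real.one_le_exp_iff]
    have h1 := hA _ h
    rw [← mul_div_assoc, le_div_iff₀ hn'] at h1
    linarith
  · exact zero_le

theorem scaledMass_tilted_le (w : ℕ → ℝ≥0∞) {n : ℕ} (hn : 0 < n) {A : Set ℝ} {l β : ℝ}
    (hA : ∀ s ∈ A, l * s ≤ β) :
    scaledMass (fun N => expWeight l N * w N) n A ≤ expWeight β n * scaledMass w n A := by
  have hn' : (0 : ℝ) < n := Nat.cast_pos.2 hn
  rw [scaledMass, scaledMass, ← ENNReal.tsum_mul_left]
  refine ENNReal.tsum_le_tsum fun N => ?_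
  split_ifs with h
  · refine mul_le_mul_left (ENNReal.ofReal_le_ofReal (Real.exp_le_exp.2 ?_)) _
    have h1 := hA _ h
    rwa [← mul_div_assoc, div_le_iff₀ hn'] at h1
  · exact zero_le

theorem expMoment_tilted (w : ℕ → ℝ≥0∞) (l h : ℝ) :
    expMoment (fun N => expWeight l N * w N) h = expMoment w (l + h) := by
  refine tsum_congr fun N => ?_
  rw [← mul_assoc, ← expWeight_add_left, add_comm]

end ExponentialRate

/-! ### Large deviations from the limiting free energy -/

section LargeDeviations

/-- Upper bound for compact sets: each point has a neighbourhood on which Chernoff's bound with a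
suitable parameter beats any rate below the Legendre transform. -/
theorem limsup_scaledMass_le {w : ℕ → ℕ → ℝ≥0∞} {Λ : ℝ → EReal} (hbot : ∀ l, Λ l ≠ ⊥)
    (hlim : ∀ l, Tendsto (fun n : ℕ => ENNReal.log (expMoment (w n) l) / (n : EReal)) atTop
      (𝓝 (Λ l))) {F : Set ℝ} (hF : IsCompact F) :
    limsup (fun n : ℕ => ENNReal.log (scaledMass (w n) n F) / (n : EReal)) atTop ≤
      -(⨅ t ∈ F, legendre Λ t) := by
  refine EReal.le_neg_of_le_neg ?_
  refine EReal.ge_of_forall_gt_iff_ge.1 fun a ha => EReal.le_neg_of_le_neg ?_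
  have key : ∃ b > a, ∀ᶠ n : ℕ in atTop, scaledMass (w n) n F ≤ expWeight (-b) n := by
    refine hF.induction_on (p := fun s => ∃ b > a, ∀ᶠ n : ℕ in atTop,
      scaledMass (w n) n s ≤ expWeight (-b) n) ?_ ?_ ?_ ?_
    · exact ⟨a + 1, by simp, Eventually.of_forall fun n => by simp [scaledMass_empty]⟩
    · rintro s t hst ⟨b, hb, h⟩
      exact ⟨b, hb, h.mono fun n hn => (scaledMass_mono _ _ hst).trans hn⟩
    · rintro s t ⟨b, hb, h⟩ ⟨b', hb', h'⟩
      obtain ⟨m, hm1, hm2⟩ := exists_between (lt_min hb hb')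
      refine ⟨m, hm1, ?_⟩
      filter_upwards [h, h', eventually_const_mul_expWeight_le (K := 2) (by simp)
        (neg_lt_neg hm2)] with n h1 h2 h3
      refine (scaledMass_union_le _ _ _ _).trans (le_trans ?_ h3)
      rw [two_mul]
      exact add_le_add (h1.trans (expWeight_mono (neg_le_neg (min_le_left _ _)) n))
        (h2.trans (expWeight_mono (neg_le_neg (min_le_right _ _)) n))
    · intro t ht
      have h1 : (a : EReal) < legendre Λ t := ha.trans_le (iInf₂_le t ht)
      obtain ⟨l, hl⟩ := lt_iSup_iff.1 h1
      obtain ⟨L, hL⟩ : ∃ L : ℝ, Λ l = L := by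
        induction hΛ : Λ l with
        | bot => exact absurd hΛ (hbot l)
        | coe L => exact ⟨L, rfl⟩
        | top =>
          rw [hΛ, EReal.sub_top] at hl
          exact absurd hl not_lt_bot
      rw [hL, ← EReal.coe_sub, EReal.coe_lt_coe_iff] at hl
      obtain ⟨b, hab, hb⟩ := exists_between hl
      obtain ⟨c, hbc, hc⟩ := exists_between hb
      have hU : {s : ℝ | c + L < l * s} ∈ 𝓝 t :=
        (isOpen_lt continuous_const (continuous_const.mul continuous_id)).mem_nhds
          (by simp only [Set.mem_ofPred_eq]; simp; linarith)
      refine ⟨_, mem_nhdsWithin_of_mem_nhds hU, b, hab, ?_⟩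
      have hlim' := hlim l
      rw [hL] at hlim'
      filter_upwards [eventually_le_expWeight hlim' (show L < L + (c - b) by linarith),
        eventually_gt_atTop 0] with n hn hn0
      refine (scaledMass_le (w n) hn0 (l := l) (β := c + L) fun s hs => le_of_lt hs).trans ?_
      refine (mul_le_mul_right hn _).trans (le_of_eq ?_)
      rw [← expWeight_add_left]
      ring_nf
  obtain ⟨b, hb, h⟩ := key
  refine (limsup_le_of_eventually_le_expWeight h).trans ?_
  rw [← EReal.coe_neg]
  exact EReal.coe_le_coe_iff.2 (neg_le_neg hb.le)

/-- Local lower bound by exponential tilting: under the weights tilted by `l`, the scaled variable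
concentrates at the derivative of the free energy. -/
theorem eventually_le_scaledMass_Ioo {w : ℕ → ℕ → ℝ≥0∞} {L : ℝ → ℝ} {l t : ℝ}
    (hL : HasDerivAt L t l)
    (hlim : ∀ᶠ x in 𝓝 l, Tendsto (fun n : ℕ => ENNReal.log (expMoment (w n) x) / (n : EReal)) atTop
      (𝓝 (L x : EReal))) {ε a : ℝ} (hε : 0 < ε) (ha : a < L l - l * t - |l| * ε) :
    ∀ᶠ n : ℕ in atTop, expWeight a n ≤ scaledMass (w n) n (Set.Ioo (t - ε) (t + ε)) := by
  have h1 : ∀ᶠ x in 𝓝 (0 : ℝ), |L (l + x) - L l - x * t| ≤ ε / 2 * |x| := by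
    have := (hasDerivAt_iff_isLittleO_nhds_zero.1 hL).def (half_pos hε)
    simpa using this
  have h2 : ∀ᶠ x in 𝓝 (0 : ℝ),
      Tendsto (fun n : ℕ => ENNReal.log (expMoment (w n) (l + x)) / (n : EReal)) atTop
        (𝓝 (L (l + x) : EReal)) := by
    have hc : Tendsto (fun x : ℝ => l + x) (𝓝 0) (𝓝 l) := by
      have : Continuous fun x : ℝ => l + x := by fun_prop
      simpa using this.tendsto 0
    exact hc.eventually hlim
  obtain ⟨r, hr, hball⟩ := Metric.eventually_nhds_iff.1 (h1.and h2)
  set h := r / 2 with hh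
  have hh0 : 0 < h := half_pos hr
  have hp := hball (y := h) (by rw [Real.dist_0_eq_abs, abs_of_pos hh0]; linarith)
  have hm := hball (y := -h) (by rw [Real.dist_0_eq_abs, abs_neg, abs_of_pos hh0]; linarith)
  have h0 := (hball (y := 0) (by simpa using hr)).2
  rw [add_zero] at h0
  obtain ⟨hp1, hp2⟩ := hp
  obtain ⟨hm1, hm2⟩ := hm
  rw [abs_of_pos hh0] at hp1
  rw [abs_neg, abs_of_pos hh0] at hm1
  set β := l * t + |l| * ε with hβ
  -- A margin `γ` small compared with the Chernoff gain `h ε` and the gap in `ha`.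
  set γ := min (h * ε / 8) ((L l - β - a) / 2) with hγ
  have hγ0 : 0 < γ := lt_min (by positivity) (by linarith)
  have hγ1 : γ ≤ h * ε / 8 := min_le_left _ _
  have hγ2 : γ ≤ (L l - β - a) / 2 := min_le_right _ _
  filter_upwards [eventually_expWeight_le h0 (show L l - γ < L l by linarith),
    eventually_le_expWeight hp2 (show L (l + h) < L (l + h) + γ by linarith),
    eventually_le_expWeight hm2 (show L (l + -h) < L (l + -h) + γ by linarith),
    eventually_const_mul_expWeight_le (K := 3) (by simp)
      (show L l - 2 * γ < L l - γ by linarith), eventually_gt_atTop 0] with n e0 ep em e3 hn0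
  let v : ℕ → ℝ≥0∞ := fun N => expWeight l N * w n N
  have hA := scaledMass_tilted_le (w n) hn0 (A := Set.Ioo (t - ε) (t + ε)) (l := l) (β := β) (by
    intro s hs
    have h3 : l * (s - t) ≤ |l| * ε := by
      refine (le_abs_self _).trans ?_
      rw [abs_mul]
      refine mul_le_mul_of_nonneg_left ?_ (abs_nonneg l)
      exact abs_le.2 ⟨by linarith [hs.1], by linarith [hs.2]⟩
    rw [hβ]
    linarith)
  have hB : scaledMass v n (Set.Ici (t + ε)) ≤ expWeight (L l - 3 * γ) n := by
    refine (scaledMass_le v hn0 (l := h) (β := h * (t + ε)) fun s hs =>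
      mul_le_mul_of_nonneg_left hs hh0.le).trans ?_
    rw [expMoment_tilted]
    refine (mul_le_mul_right ep _).trans ?_
    rw [← expWeight_add_left]
    refine expWeight_mono ?_ n
    have := (abs_le.1 hp1).2
    nlinarith
  have hC : scaledMass v n (Set.Iic (t - ε)) ≤ expWeight (L l - 3 * γ) n := by
    refine (scaledMass_le v hn0 (l := -h) (β := -h * (t - ε)) fun s hs =>
      mul_le_mul_of_nonpos_left hs (neg_nonpos.2 hh0.le)).trans ?_
    rw [expMoment_tilted]
    refine (mul_le_mul_right em _).trans ?_
    rw [← expWeight_add_left]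
    refine expWeight_mono ?_ n
    have := (abs_le.1 hm1).2
    nlinarith
  have hZ : expMoment (w n) l ≤ scaledMass v n (Set.Ioo (t - ε) (t + ε)) +
      2 * expWeight (L l - 3 * γ) n := by
    have h3 : expMoment (w n) l = scaledMass v n Set.univ := by
      rw [scaledMass_univ]; rfl
    have h4 : (Set.univ : Set ℝ) =
        Set.Ioo (t - ε) (t + ε) ∪ (Set.Ici (t + ε) ∪ Set.Iic (t - ε)) := by
      ext s
      simp only [Set.mem_univ, Set.mem_union, Set.mem_Ioo, Set.mem_Ici, Set.mem_Iic, true_iff]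
      by_cases h5 : t + ε ≤ s
      · exact Or.inr (Or.inl h5)
      · by_cases h6 : s ≤ t - ε
        · exact Or.inr (Or.inr h6)
        · exact Or.inl ⟨not_le.1 h6, not_le.1 h5⟩
    rw [h3, h4, two_mul]
    exact (scaledMass_union_le _ _ _ _).trans (add_le_add le_rfl
      ((scaledMass_union_le _ _ _ _).trans (add_le_add hB hC)))
  have h5 : expWeight (L l - 2 * γ) n ≤ scaledMass v n (Set.Ioo (t - ε) (t + ε)) := by
    have h6 : expWeight (L l - 2 * γ) n + 2 * expWeight (L l - 3 * γ) n ≤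
        scaledMass v n (Set.Ioo (t - ε) (t + ε)) + 2 * expWeight (L l - 3 * γ) n := by
      calc _ ≤ expWeight (L l - 2 * γ) n + 2 * expWeight (L l - 2 * γ) n := by
            gcongr
            exact expWeight_mono (by linarith) n
        _ = 3 * expWeight (L l - 2 * γ) n := by ring
        _ ≤ _ := e3.trans (e0.trans hZ)
    exact (ENNReal.add_le_add_iff_right
      (ENNReal.mul_ne_top (by simp) (expWeight_ne_top _ _))).1 h6
  have h7 := (expWeight_le_mul_iff _ _ _ _).1 (h5.trans hA)
  exact (expWeight_mono (by linarith) n).trans h7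

theorem le_liminf_of_hasDerivAt {w : ℕ → ℕ → ℝ≥0∞} {L : ℝ → ℝ} {l t : ℝ} (hL : HasDerivAt L t l)
    (hlim : ∀ᶠ x in 𝓝 l, Tendsto (fun n : ℕ => ENNReal.log (expMoment (w n) x) / (n : EReal)) atTop
      (𝓝 (L x : EReal))) {G : Set ℝ} (hG : IsOpen G) (ht : t ∈ G) :
    ((L l - l * t : ℝ) : EReal) ≤
      liminf (fun n : ℕ => ENNReal.log (scaledMass (w n) n G) / (n : EReal)) atTop := by
  obtain ⟨ε, hε, hball⟩ := Metric.isOpen_iff.1 hG t ht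
  refine EReal.ge_of_forall_gt_iff_ge.1 fun a ha => ?_
  rw [EReal.coe_lt_coe_iff] at ha
  set δ := min ε ((L l - l * t - a) / (2 * (|l| + 1))) with hδ
  have hl1 : 0 < |l| + 1 := by positivity
  have hδ0 : 0 < δ := lt_min hε (div_pos (by linarith) (by positivity))
  have hδ2 : |l| * δ < L l - l * t - a := by
    have h1 : δ ≤ (L l - l * t - a) / (2 * (|l| + 1)) := min_le_right _ _
    rw [le_div_iff₀ (by positivity)] at h1
    nlinarith [abs_nonneg l]
  refine le_liminf_of_eventually_expWeight_le ?_
  filter_upwards [eventually_le_scaledMass_Ioo hL hlim hδ0 (show a < L l - l * t - |l| * δ by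
    linarith)] with n hn
  refine hn.trans (scaledMass_mono _ _ fun s hs => hball ?_)
  rw [Real.ball_eq_Ioo]
  exact ⟨by linarith [hs.1, min_le_left ε ((L l - l * t - a) / (2 * (|l| + 1)))],
    by linarith [hs.2, min_le_left ε ((L l - l * t - a) / (2 * (|l| + 1)))]⟩

/-- Beyond the range of the derivative of the free energy: the weights `w n` are bounded below by
weights `w' n` with the same free energy, delayed by an arbitrary multiple of `s₀` at an exponential
cost `x` per unit of time. -/
theorem le_liminf_of_delay {w w' : ℕ → ℕ → ℝ≥0∞} {L : ℝ → ℝ} {l t u x : ℝ} (hx : 0 ≤ x)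
    (hL : HasDerivAt L u l) (hut : u < t)
    (hlim : ∀ᶠ y in 𝓝 l, Tendsto (fun n : ℕ => ENNReal.log (expMoment (w' n) y) / (n : EReal)) atTop
      (𝓝 (L y : EReal))) {s₀ a₀ : ℕ} (hs₀ : 0 < s₀) {c : ℝ≥0∞} (hc : c ≠ 0) (hc_top : c ≠ ⊤)
    (hdelay : ∀ᶠ n in atTop, ∀ m b, c * expWeight (-x) (m * s₀) * w' n b ≤ w n (a₀ + m * s₀ + b))
    {G : Set ℝ} (hG : IsOpen G) (ht : t ∈ G) :
    ((L l - l * u - x * (t - u) : ℝ) : EReal) ≤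
      liminf (fun n : ℕ => ENNReal.log (scaledMass (w n) n G) / (n : EReal)) atTop := by
  classical
  obtain ⟨ε, hε, hball⟩ := Metric.isOpen_iff.1 hG t ht
  refine EReal.ge_of_forall_gt_iff_ge.1 fun a ha => ?_
  rw [EReal.coe_lt_coe_iff] at ha
  set τ := t - u with hτ
  have hτ0 : 0 < τ := sub_pos.2 hut
  set δ := min (ε / 2) ((L l - l * u - x * τ - a) / (2 * (|l| + 1))) with hδ
  have hl1 : 0 < |l| + 1 := by positivity
  have hδ0 : 0 < δ := lt_min (half_pos hε) (div_pos (by linarith) (by positivity))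
  have hδ1 : δ ≤ ε / 2 := min_le_left _ _
  have hδ2 : |l| * δ < L l - l * u - x * τ - a := by
    have h1 : δ ≤ (L l - l * u - x * τ - a) / (2 * (|l| + 1)) := min_le_right _ _
    rw [le_div_iff₀ (by positivity)] at h1
    nlinarith [abs_nonneg l]
  obtain ⟨a', ha1, ha2⟩ := exists_between (show a + x * τ < L l - l * u - |l| * δ by linarith)
  have hsmall : ∀ᶠ n : ℕ in atTop, ((a₀ : ℝ) + s₀) / n ≤ ε / 4 :=
    (tendsto_const_div_atTop_nhds_zero_nat _).eventually_le_const (by linarith)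
  refine le_liminf_of_eventually_expWeight_le ?_
  have hc' : c⁻¹ ≠ ⊤ := ENNReal.inv_ne_top.2 hc
  filter_upwards [eventually_le_scaledMass_Ioo hL hlim hδ0 ha2, hdelay, hsmall,
    eventually_const_mul_expWeight_le hc' (show a < a' - x * τ by linarith),
    eventually_gt_atTop 0] with n h1 h2 h3 h4 hn0
  have hn' : (0 : ℝ) < n := Nat.cast_pos.2 hn0
  have hs' : (0 : ℝ) < s₀ := Nat.cast_pos.2 hs₀
  -- The number of delays that shifts the typical value from `u n` to `t n`.
  set m := ⌊n * τ / s₀⌋₊ with hm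
  have hm1 : (m : ℝ) * s₀ ≤ n * τ := by
    rw [← le_div_iff₀ hs']
    exact Nat.floor_le (by positivity)
  have hm2 : (n : ℝ) * τ ≤ m * s₀ + s₀ := by
    have := (Nat.lt_floor_add_one (n * τ / s₀)).le
    rw [div_le_iff₀ hs'] at this
    rw [hm]
    linarith
  have h5 : c * expWeight (-x) (m * s₀) * scaledMass (w' n) n (Set.Ioo (u - δ) (u + δ)) ≤
      scaledMass (w n) n G := by
    rw [scaledMass, ← ENNReal.tsum_mul_left]
    refine le_trans (ENNReal.tsum_le_tsum fun b => ?_) (ENNReal.tsum_comp_le_tsum_of_injective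
      (f := fun b : ℕ => a₀ + m * s₀ + b) (fun b b' h => by simpa using h) _)
    by_cases hb : (b : ℝ) / n ∈ Set.Ioo (u - δ) (u + δ)
    · rw [if_pos hb, if_pos]
      · exact h2 m b
      · refine hball ?_
        rw [Real.ball_eq_Ioo]
        have e1 : ((a₀ + m * s₀ + b : ℕ) : ℝ) / n = a₀ / n + m * s₀ / n + b / n := by
          push_cast; ring
        have e2 : (m : ℝ) * s₀ / n ≤ τ := by rw [div_le_iff₀ hn']; linarith
        have e3 : τ ≤ m * s₀ / n + s₀ / n := by
          rw [← add_div, le_div_iff₀ hn']; linarith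
        have e4 : (0 : ℝ) ≤ a₀ / n := by positivity
        have e5 : (0 : ℝ) ≤ s₀ / n := by positivity
        rw [add_div] at h3
        rw [e1]
        constructor
        · linarith [hb.1]
        · linarith [hb.2]
    · rw [if_neg hb, mul_zero]
      exact zero_le
  have h6 : expWeight (-(x * τ)) n ≤ expWeight (-x) (m * s₀) := by
    refine ENNReal.ofReal_le_ofReal (Real.exp_le_exp.2 ?_)
    push_cast
    nlinarith
  calc expWeight a n = c * (c⁻¹ * expWeight a n) := by
        rw [← mul_assoc, ENNReal.mul_inv_cancel hc hc_top, one_mul]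
    _ ≤ c * expWeight (a' - x * τ) n := mul_le_mul_right h4 _
    _ = c * expWeight (-(x * τ)) n * expWeight a' n := by
        rw [mul_assoc, ← expWeight_add_left]; ring_nf
    _ ≤ c * expWeight (-x) (m * s₀) * scaledMass (w' n) n (Set.Ioo (u - δ) (u + δ)) := by
        gcongr
    _ ≤ _ := h5

theorem neg_legendre_le {Λ : ℝ → EReal} {l L : ℝ} (h : Λ l = L) (t : ℝ) :
    -legendre Λ t ≤ ((L - l * t : ℝ) : EReal) := by
  have h1 : ((l * t : ℝ) : EReal) - Λ l ≤ legendre Λ t :=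
    le_iSup (fun l : ℝ => ((l * t : ℝ) : EReal) - Λ l) l
  rw [h, ← EReal.coe_sub] at h1
  refine EReal.neg_le_of_neg_le ?_
  rw [← EReal.coe_neg, neg_sub]
  exact h1

/-- Lower bound for open sets. A point `t` in the range of the derivative of the free energy is
handled by tilting. If the derivative stays above `t`, then either some nearby point in its range
is as good, or the Legendre transform is infinite. If it stays below `t`, the difference is made up
by delays, at a cost per unit of time arbitrarily close to `lc`. -/
theorem le_liminf_scaledMass {w : ℕ → ℕ → ℝ≥0∞} {Λ : ℝ → EReal} {L : ℝ → ℝ} {lc : ℝ} (hlc : 0 ≤ lc)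
    (hΛ : ∀ l < lc, Λ l = L l) (hconv : ConvexOn ℝ (Set.Iio lc) L)
    (hdiff : ∀ l < lc, DifferentiableAt ℝ L l)
    (hlim : ∀ l < lc, Tendsto (fun n : ℕ => ENNReal.log (expMoment (w n) l) / (n : EReal)) atTop
      (𝓝 (L l : EReal)))
    (hdelay : ∀ x > lc, ∃ (w' : ℕ → ℕ → ℝ≥0∞) (s₀ a₀ : ℕ) (c : ℝ≥0∞),
      (∀ l < lc, Tendsto (fun n : ℕ => ENNReal.log (expMoment (w' n) l) / (n : EReal)) atTop
        (𝓝 (L l : EReal))) ∧ 0 < s₀ ∧ c ≠ 0 ∧ c ≠ ⊤ ∧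
      ∀ᶠ n in atTop, ∀ m b, c * expWeight (-x) (m * s₀) * w' n b ≤ w n (a₀ + m * s₀ + b))
    {G : Set ℝ} (hG : IsOpen G) :
    -(⨅ t ∈ G, legendre Λ t) ≤
      liminf (fun n : ℕ => ENNReal.log (scaledMass (w n) n G) / (n : EReal)) atTop := by
  refine EReal.neg_le_of_neg_le (le_iInf₂ fun t ht => EReal.neg_le_of_neg_le ?_)
  have hmono : MonotoneOn (deriv L) (Set.Iio lc) := hconv.monotoneOn_deriv fun l hl => hdiff l hl
  have hd : ∀ l < lc, HasDerivAt L (deriv L l) l := fun l hl => (hdiff l hl).hasDerivAt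
  by_cases hrange : ∃ l < lc, deriv L l = t
  · obtain ⟨l, hl, rfl⟩ := hrange
    exact (neg_legendre_le (hΛ l hl) _).trans (le_liminf_of_hasDerivAt (hd l hl)
      ((eventually_lt_nhds hl).mono hlim) hG ht)
  push Not at hrange
  rcases hasDerivWithinAt_forall_lt_or_forall_gt_of_forall_ne (convex_Iio lc)
    (fun l hl => (hd l hl).hasDerivWithinAt) hrange with hlt | hgt
  · -- The derivative stays below `t`.
    refine EReal.ge_of_forall_gt_iff_ge.1 fun a ha => ?_
    obtain ⟨b, hab, hb⟩ := EReal.lt_iff_exists_real_btwn.1 ha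
    rw [EReal.coe_lt_coe_iff] at hab
    have hu := hlt (lc - 1) (by simp)
    set u := deriv L (lc - 1) with hudef
    set ρ := min 1 ((b - a) / (2 * (t - u))) with hρ
    have hρ0 : 0 < ρ := lt_min one_pos (div_pos (by linarith) (by linarith))
    have hρ2 : 2 * ρ * (t - u) ≤ b - a := by
      have h1 : ρ ≤ (b - a) / (2 * (t - u)) := min_le_right _ _
      rw [le_div_iff₀ (by linarith)] at h1
      linarith
    have hρ1 : ρ ≤ 1 := min_le_left _ _
    have hl : lc - ρ < lc := by linarith
    obtain ⟨w', s₀, a₀, c, h1, hs₀, hc, hc', h2⟩ := hdelay (lc + ρ) (by simpa using hρ0)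
    have h3 := le_liminf_of_delay (by linarith) (hd _ hl) (hlt _ hl)
      ((eventually_lt_nhds hl).mono h1) hs₀ hc hc' h2 hG ht
    refine le_trans (EReal.coe_le_coe_iff.2 ?_) h3
    have h4 := (hb.trans_le (neg_legendre_le (hΛ _ hl) t)).le
    rw [EReal.coe_le_coe_iff] at h4
    have h5 : u ≤ deriv L (lc - ρ) :=
      hmono (show lc - 1 < lc by linarith) hl (by linarith)
    nlinarith
  · -- The derivative stays above `t`.
    obtain ⟨ε, hε, hball⟩ := Metric.isOpen_iff.1 hG t ht
    have hneg : (-1 : ℝ) < lc := by linarith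
    by_cases hnear : ∃ l < lc, deriv L l < t + ε
    · obtain ⟨l₁, hl₁, hl₁ε⟩ := hnear
      have hl : min l₁ (-1) < lc := (min_le_left _ _).trans_lt hl₁
      set l := min l₁ (-1) with hldef
      have h1 : deriv L l < t + ε := (hmono hl hl₁ (min_le_left _ _)).trans_lt hl₁ε
      have h2 := hgt l hl
      have h3 : l ≤ -1 := min_le_right _ _
      have h4 : deriv L l ∈ G := by
        refine hball ?_
        rw [Real.ball_eq_Ioo]
        exact ⟨by linarith, h1⟩
      refine (neg_legendre_le (hΛ l hl) t).trans (le_trans (EReal.coe_le_coe_iff.2 ?_)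
        (le_liminf_of_hasDerivAt (hd l hl) ((eventually_lt_nhds hl).mono hlim) hG h4))
      nlinarith
    · push Not at hnear
      have h1 : -legendre Λ t = ⊥ := by
        refine EReal.eq_bot_iff_forall_lt _ |>.2 fun a => ?_
        set K := L (-1) + t - a with hK
        set l := -1 - (|K| + 1) / ε with hldef
        have hl1 : l < -1 := by
          have : 0 < (|K| + 1) / ε := by positivity
          linarith
        have hl : l < lc := by linarith
        have h2 := hconv.le_slope_of_hasDerivAt (show l ∈ Set.Iio lc from hl)
          (show (-1 : ℝ) ∈ Set.Iio lc from hneg) hl1 (hd l hl)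
        have h3 := (hnear l hl).trans h2
        rw [slope_def_field, le_div_iff₀ (by linarith)] at h3
        have h4 : ε * (-1 - l) = |K| + 1 := by
          rw [hldef]; field_simp; ring
        refine (neg_legendre_le (hΛ l hl) t).trans_lt (EReal.coe_lt_coe_iff.2 ?_)
        have := le_abs_self K
        nlinarith
      rw [h1]
      exact bot_le

end LargeDeviations

/-! ### Excursions below a level -/

section Excursions

variable {d : ℕ}

/-- The probability of moving from `(k, i)` to `(k, j)` in `s` steps without visiting level
`k + 1`. -/
def loopProb (ω : Env d) (k : ℤ) (s : ℕ) (i j : Fin d) : ℝ≥0∞ :=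
  (killedOp ω (k + 1))^[s] (fun y => if y = (k, j) then 1 else 0) (k, i)

/-- Paths that are at `y` at time `s`, and have not visited level `n` before, are among all paths that
avoid level `n' ≥ n`. -/
theorem killedOp_iterate_mul_le {ω : Env d} {n n' : ℤ} (hn : n ≤ n') (g : ℤ × Fin d → ℝ≥0∞)
    (s u : ℕ) {x : ℤ × Fin d} (hx : x.1 ≤ n) (y : ℤ × Fin d) :
    (killedOp ω n)^[s] (fun z => if z = y then 1 else 0) x * (killedOp ω n')^[u] g y ≤
      (killedOp ω n')^[s + u] g x := by
  rw [← killedOp_iterate_mul_const, Function.iterate_add_apply]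
  refine killedOp_iterate_mono hn (fun z _ => ?_) s x hx
  split_ifs with h
  · rw [h, one_mul]
  · rw [zero_mul]; exact zero_le

theorem loopProb_mul_le (ω : Env d) (k : ℤ) (s u : ℕ) (i a j : Fin d) :
    loopProb ω k s i a * loopProb ω k u a j ≤ loopProb ω k (s + u) i j :=
  killedOp_iterate_mul_le le_rfl _ s u (by simp) (k, a)

theorem loopProb_mul_hitProb_le (ω : Env d) {k n : ℤ} (hn : k < n) (s b : ℕ) (i a j : Fin d) :
    loopProb ω k s i a * hitProb ω n b (k, a) j ≤ hitProb ω n (s + b) (k, i) j :=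
  killedOp_iterate_mul_le hn _ s b (by simp) (k, a)

theorem stepOp_le_one {ω : Env d} {g : ℤ × Fin d → ℝ≥0∞} (hg : ∀ y, g y ≤ 1) (x : ℤ × Fin d) :
    stepOp ω g x ≤ 1 := by
  rw [← lintegral_stepKernel]
  exact (lintegral_mono hg).trans (by simp)

/-- Level `k + 1` is entered from level `k`. -/
theorem hitProb_succ_le_sum_loopProb (ω : Env d) (k : ℤ) (s : ℕ) (i j : Fin d) :
    hitProb ω (k + 1) (s + 1) (k, i) j ≤ ∑ a, loopProb ω k s i a := by
  unfold loopProb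
  rw [← killedOp_iterate_sum, hitProb, Function.iterate_succ_apply]
  refine killedOp_iterate_mono le_rfl (fun y hy => ?_) s _ (by simp)
  obtain ⟨m, a⟩ := y
  simp only at hy
  rw [killedOp]
  split_ifs with h
  · exact zero_le
  simp only at h
  rcases (show m ≤ k by omega).eq_or_lt with rfl | hm
  · refine (stepOp_le_one (fun y => ?_) _).trans ?_
    · split_ifs <;> simp
    · simp
  · have h1 : stepOp ω (fun y => if y = (k + 1, j) then 1 else 0) (m, a) =
        stepOp ω (fun _ => 0) (m, a) := by
      refine stepOp_congr fun y hy => if_neg ?_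
      rintro rfl
      simp only at hy
      omega
    rw [h1]
    simp [stepOp]

theorem exists_tsum_loopProb_eq_top {ω : Env d} {l : ℝ} {k : ℤ} {i j : Fin d}
    (h : Phi ω l k i j = ⊤) : ∃ a, ∑' s, expWeight l s * loopProb ω k s i a = ⊤ := by
  by_contra! hne
  have h1 : Phi ω l k i j ≤ expWeight l 1 * ∑ a, ∑' s, expWeight l s * loopProb ω k s i a := by
    rw [Phi_apply, hitGen, tsum_eq_zero_add' ENNReal.summable, hitProb_zero,
      if_neg (by simp), mul_zero, zero_add,
      ← Summable.tsum_finsetSum (fun i _ => ENNReal.summable), ← ENNReal.tsum_mul_left]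
    refine ENNReal.tsum_le_tsum fun s => ?_
    rw [← Finset.mul_sum, add_comm s 1, expWeight_add, mul_assoc, add_comm 1 s]
    gcongr
    exact hitProb_succ_le_sum_loopProb ω k s i j
  rw [h, top_le_iff] at h1
  exact ENNReal.mul_ne_top (expWeight_ne_top _ _) (ENNReal.sum_ne_top.2 fun a _ => hne a) h1

variable {κ : ℝ}

theorem Phi_ne_zero (hd : 0 < d) (hκ : 0 < κ) {ω : Env d} {k : ℤ} (h : IsElliptic κ (ω k)) (l : ℝ)
    (i j : Fin d) : Phi ω l k i j ≠ 0 := by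
  obtain ⟨c, hc, hlow⟩ := exists_Phi_lower_bound hκ hd (-l)
  have h1 := hlow ω k h l (by simp) i j
  have h2 : 0 < ENNReal.ofReal c := ENNReal.ofReal_pos.2 hc
  exact (h2.trans_le h1).ne'

theorem PhiProd_succ_ne_zero (hd : 0 < d) (hκ : 0 < κ) {ω : Env d}
    (hell : ∀ n : ℤ, IsElliptic κ (ω n)) (l : ℝ) (m : ℤ) (n : ℕ) (i j : Fin d) :
    PhiProd ω l m (n + 1) i j ≠ 0 := by
  have hstep : ∀ n a j, PhiProd ω l m n i a ≠ 0 → PhiProd ω l m (n + 1) i j ≠ 0 := by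
    intro n a j ha
    rw [PhiProd_succ, Matrix.mul_apply]
    refine fun h0 => mul_ne_zero ha (Phi_ne_zero hd hκ (hell (m + n)) l a j) ?_
    exact Finset.sum_eq_zero_iff.1 h0 a (Finset.mem_univ a)
  induction n generalizing j with
  | zero => exact hstep 0 i j (by rw [PhiProd_zero]; simp)
  | succ n ih => exact hstep (n + 1) i j (ih i)

/-- Within one level every height is reachable from every other: step to the level below and
return. -/
theorem exists_loopProb_ne_zero (hd : 0 < d) (hκ : 0 < κ) {ω : Env d}
    (hell : ∀ n : ℤ, IsElliptic κ (ω n)) (k : ℤ) (i j : Fin d) :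
    ∃ u > 0, loopProb ω k u i j ≠ 0 := by
  obtain ⟨a, ha⟩ : ∃ a, 0 < (ω k).q i a := by
    by_contra! hneg
    have h1 := (hell k).1 i
    have h2 := Finset.sum_nonpos fun a (_ : a ∈ Finset.univ) => hneg a
    linarith
  obtain ⟨b, hb⟩ : ∃ b, hitProb ω k b (k - 1, a) j ≠ 0 := by
    by_contra! hneg
    refine Phi_ne_zero hd hκ (hell (k - 1)) 0 a j ?_
    rw [Phi_apply, hitGen, sub_add_cancel]
    simp [hneg]
  refine ⟨1 + b, by omega, fun h0 => ?_⟩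
  have h1 := killedOp_iterate_mul_le (ω := ω) (le_refl (k + 1))
    (fun y => if y = (k, j) then 1 else 0) 1 b (x := (k, i)) (by simp) (k - 1, a)
  change _ ≤ loopProb ω k (1 + b) i j at h1
  rw [h0, nonpos_iff_eq_zero, mul_eq_zero] at h1
  rcases h1 with h1 | h1
  · rw [Function.iterate_one, killedOp, if_neg (by simp), stepOp] at h1
    have h2 := Finset.sum_eq_zero_iff.1 h1 a (Finset.mem_univ a)
    rw [add_eq_zero, add_eq_zero, if_pos rfl, mul_one] at h2
    exact (ENNReal.ofReal_pos.2 ha).ne' h2.1.1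
  · have h2 := killedOp_iterate_mono (ω := ω) (show k ≤ k + 1 by omega)
      (g := fun y => if y = (k, j) then 1 else 0) (fun y _ => le_rfl) b (k - 1, a) (by simp)
    rw [h1, nonpos_iff_eq_zero] at h2
    exact hb h2

theorem tsum_expWeight_ne_top {a : ℝ} (ha : a < 0) : ∑' s : ℕ, expWeight a s ≠ ⊤ := by
  have h1 : ∀ s : ℕ, expWeight a s = expWeight a 1 ^ s := fun s => by
    induction s with
    | zero => rw [expWeight_zero_right, pow_zero]
    | succ s ih => rw [expWeight_add, ih, pow_succ]
  have h2 : expWeight a 1 < 1 := by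
    rw [expWeight, ENNReal.ofReal_lt_one, Real.exp_lt_one_iff]
    simpa using ha
  rw [tsum_congr h1]
  rw [ENNReal.tsum_geometric]
  exact ENNReal.inv_ne_top.2 (tsub_pos_of_lt h2).ne'

/-- An infinite passage matrix at parameter `l` forces loops of exponential cost below any
`x > l` per unit of time. -/
theorem exists_expWeight_le_loopProb (hd : 0 < d) (hκ : 0 < κ) {ω : Env d}
    (hell : ∀ n : ℤ, IsElliptic κ (ω n)) {l x : ℝ} (hlx : l < x) {k : ℤ} {i j : Fin d}
    (h : Phi ω l k i j = ⊤) : ∃ s > 0, expWeight (-x) s ≤ loopProb ω k s i i := by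
  by_contra! hneg
  obtain ⟨a, ha⟩ := exists_tsum_loopProb_eq_top h
  obtain ⟨u, hu, hau⟩ := exists_loopProb_ne_zero hd hκ hell k a i
  have h1 : (∑' s, expWeight l s * loopProb ω k s i a) * loopProb ω k u a i ≤
      expWeight (-x) u * ∑' s : ℕ, expWeight (l - x) s := by
    rw [← ENNReal.tsum_mul_right, ← ENNReal.tsum_mul_left]
    refine ENNReal.tsum_le_tsum fun s => ?_
    calc _ ≤ expWeight l s * loopProb ω k (s + u) i i := by
          rw [mul_assoc]
          gcongr
          exact loopProb_mul_le ω k s u i a i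
      _ ≤ expWeight l s * expWeight (-x) (s + u) := by
          gcongr
          exact (hneg (s + u) (by omega)).le
      _ = _ := by
          rw [expWeight_add, sub_eq_add_neg, expWeight_add_left]
          ring
  rw [ha, ENNReal.top_mul hau, top_le_iff] at h1
  exact ENNReal.mul_ne_top (expWeight_ne_top _ _) (tsum_expWeight_ne_top (sub_neg.2 hlx)) h1

theorem expWeight_mul_hitProb_le {ω : Env d} {x : ℝ} {k n : ℤ} (hn : k < n) {s : ℕ} {i : Fin d}
    (hs : expWeight (-x) s ≤ loopProb ω k s i i) (m b : ℕ) (j : Fin d) :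
    expWeight (-x) (m * s) * hitProb ω n b (k, i) j ≤ hitProb ω n (m * s + b) (k, i) j := by
  induction m with
  | zero => simp [expWeight_zero_right]
  | succ m ih =>
    have h1 : (m + 1) * s = s + m * s := by ring
    rw [h1, expWeight_add, mul_assoc, add_assoc]
    exact (mul_le_mul' hs ih).trans (loopProb_mul_hitProb_le ω hn _ _ _ _ _)

theorem hitLaw_translate_pure (ω : Env d) (k n b : ℕ) (hkn : k ≤ n) (i : Fin d) :
    hitLaw (translate k ω) (PMF.pure i) (n - k) b = ∑ j, hitProb ω n b (k, i) j := by
  classical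
  rw [hitLaw, Finset.sum_eq_single i]
  · rw [PMF.pure_apply_self, one_mul]
    refine Finset.sum_congr rfl fun j _ => ?_
    rw [Nat.cast_sub hkn, hitProb_translate, sub_add_cancel, zero_add]
  · intro a _ ha
    rw [PMF.pure_apply_of_ne _ _ ha, zero_mul]
  · simp

/-- The law of `T_n` dominates that of `T_n` started at level `k`, delayed by any number of loops
below level `k + 1`. -/
theorem mul_hitLaw_translate_le {ω : Env d} (π : PMF (Fin d)) {x : ℝ} {k n : ℕ} (hkn : k < n)
    {s : ℕ} {i : Fin d} (hs : expWeight (-x) s ≤ loopProb ω k s i i) (i₀ : Fin d) (a m b : ℕ) :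
    π i₀ * hitProb ω k a (0, i₀) i * expWeight (-x) (m * s) *
        hitLaw (translate k ω) (PMF.pure i) (n - k) b ≤ hitLaw ω π n (a + m * s + b) := by
  rw [hitLaw_translate_pure ω k n b hkn.le, hitLaw]
  refine le_trans ?_ (Finset.single_le_sum (f := fun i => π i * ∑ j,
    hitProb ω n (a + m * s + b) (0, i) j) (fun _ _ => zero_le) (Finset.mem_univ i₀))
  rw [mul_assoc, mul_assoc]
  gcongr
  rw [Finset.mul_sum, Finset.mul_sum]
  refine Finset.sum_le_sum fun j _ => ?_
  have hkn' : (k : ℤ) < n := by exact_mod_cast hkn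
  refine (mul_le_mul_right (expWeight_mul_hitProb_le hkn' hs m b j) _).trans ?_
  rw [hitProb_decomposition ω hkn'.le _ (0, i₀) (by simp)]
  refine le_trans ?_ (Finset.single_le_sum (f := fun p : ℕ × ℕ => ∑ i,
    hitProb ω k p.1 (0, i₀) i * hitProb ω n p.2 (k, i) j) (fun _ _ => zero_le)
    (a := (a, m * s + b)) (by simp [add_assoc]))
  exact Finset.single_le_sum (f := fun i => hitProb ω k a (0, i₀) i *
    hitProb ω n (m * s + b) (k, i) j) (fun _ _ => zero_le) (Finset.mem_univ i)

theorem exists_hitProb_ne_zero (hd : 0 < d) (hκ : 0 < κ) {ω : Env d}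
    (hell : ∀ n : ℤ, IsElliptic κ (ω n)) (k : ℕ) (i j : Fin d) :
    ∃ a, hitProb ω ((k + 1 : ℕ) : ℤ) a (0, i) j ≠ 0 := by
  by_contra! hneg
  refine PhiProd_succ_ne_zero hd hκ hell 0 0 k i j ?_
  rw [PhiProd_apply, hitGen, zero_add]
  exact ENNReal.tsum_eq_zero.2 fun a => by rw [hneg, mul_zero]

/-- An infinite entry spreads to all later products, because all passage matrices are positive. -/
theorem quenchedMGF_eq_top (hd : 0 < d) (hκ : 0 < κ) {ω : Env d}
    (hell : ∀ n : ℤ, IsElliptic κ (ω n)) {l : ℝ} {k : ℕ} {i j : Fin d}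
    (h : Phi ω l ((k + 1 : ℕ) : ℤ) i j = ⊤) (π : PMF (Fin d)) {n : ℕ} (hn : k + 2 ≤ n) :
    quenchedMGF ω π l n = ⊤ := by
  obtain ⟨i₀, hi₀⟩ := PMF_exists_pos π
  have hmul : ∀ n (a b : Fin d), PhiProd ω l 0 n i₀ a * Phi ω l n a b = ⊤ →
      PhiProd ω l 0 (n + 1) i₀ b = ⊤ := by
    intro n a b hab
    rw [PhiProd_succ, Matrix.mul_apply, zero_add]
    exact ENNReal.sum_eq_top.2 ⟨a, Finset.mem_univ a, hab⟩
  have htop : ∃ b, PhiProd ω l 0 n i₀ b = ⊤ := by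
    induction n, hn using Nat.le_induction with
    | base =>
      refine ⟨j, hmul (k + 1) i j ?_⟩
      rw [h, ENNReal.mul_top (PhiProd_succ_ne_zero hd hκ hell _ _ _ _ _)]
    | succ n hn ih =>
      obtain ⟨b, hb⟩ := ih
      refine ⟨b, hmul n b b ?_⟩
      rw [hb, ENNReal.top_mul (Phi_ne_zero hd hκ (hell n) l b b)]
  obtain ⟨b, hb⟩ := htop
  rw [quenchedMGF_eq_dotProduct]
  refine ENNReal.sum_eq_top.2 ⟨i₀, Finset.mem_univ i₀, ENNReal.mul_eq_top.2 (Or.inl ⟨hi₀, ?_⟩)⟩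
  exact ENNReal.sum_eq_top.2 ⟨b, Finset.mem_univ b, (mul_one _).trans hb⟩

end Excursions

/-! ### The quenched free energy for all parameters -/

section LogMGFLimit

variable {d : ℕ} {η : Measure (Env d)}

/-- The limit `Λ_η` of the scaled logarithmic moment generating functions: the free energy up to the
critical parameter, and `⊤` above it. -/
def logMGFLimit (η : Measure (Env d)) (π₀ : PMF (Fin d)) (l : ℝ) : EReal :=
  open Classical in if l ≤ critParam η then (freeEnergy η π₀ l : EReal) else ⊤

theorem logMGFLimit_of_le {π₀ : PMF (Fin d)} {l : ℝ} (hl : l ≤ critParam η) :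
    logMGFLimit η π₀ l = (freeEnergy η π₀ l : EReal) := if_pos hl

theorem logMGFLimit_of_lt {π₀ : PMF (Fin d)} {l : ℝ} (hl : critParam η < l) :
    logMGFLimit η π₀ l = ⊤ := if_neg hl.not_ge

theorem logMGFLimit_ne_bot (π₀ : PMF (Fin d)) (l : ℝ) : logMGFLimit η π₀ l ≠ ⊥ := by
  unfold logMGFLimit
  split_ifs <;> simp

variable [IsProbabilityMeasure η] {κ : ℝ}

/-- Almost surely the convergence holds for all parameters up to the critical one: monotonicity in
the parameter and continuity of the limit reduce this to countably many parameters. -/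
theorem ae_forall_tendsto_log_quenchedMGF (hd : 0 < d) (herg : Ergodic shift η) (hκ : 0 < κ)
    (hell : ∀ᵐ ω ∂η, ∀ n : ℤ, IsElliptic κ (ω n)) (π₀ : PMF (Fin d)) :
    ∀ᵐ ω ∂η, ∀ π : PMF (Fin d), ∀ l ≤ critParam η,
      Tendsto (fun n : ℕ => ENNReal.log (quenchedMGF ω π l n) / (n : EReal)) atTop
        (𝓝 (freeEnergy η π₀ l : EReal)) := by
  have hone : ∀ l ≤ critParam η, ∀ᵐ ω ∂η, ∀ π : PMF (Fin d),
      Tendsto (fun n : ℕ => ENNReal.log (quenchedMGF ω π l n) / (n : EReal)) atTop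
        (𝓝 (freeEnergy η π₀ l : EReal)) := by
    intro l hl
    obtain ⟨c, C, hc, hcC, hbd⟩ := exists_ae_PhiBounded hd herg.toMeasurePreserving hκ hell (-l)
    have hbd' := hbd l (by simp) hl
    filter_upwards [ae_tendsto_log_quenchedMGF hd herg hc hcC hbd' π₀, hbd'] with ω h1 h2 π
    exact tendsto_log_div_of_real (fun n => (log_quenchedMGF_succ hd hc hcC h2 π₀ π n).2.2.1) (h1 π)
  have hrat : ∀ᵐ ω ∂η, ∀ q : ℚ, (q : ℝ) ≤ critParam η → ∀ π : PMF (Fin d),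
      Tendsto (fun n : ℕ => ENNReal.log (quenchedMGF ω π q n) / (n : EReal)) atTop
        (𝓝 (freeEnergy η π₀ q : EReal)) := by
    refine ae_all_iff.2 fun q => ?_
    by_cases hq : (q : ℝ) ≤ critParam η
    · filter_upwards [hone q hq] with ω h _ using h
    · exact ae_of_all _ fun ω h => absurd h hq
  filter_upwards [hrat, hone _ le_rfl] with ω h1 h2 π l hl
  rcases hl.eq_or_lt with rfl | hl
  · exact h2 π
  have hcont : Tendsto (fun x => (freeEnergy η π₀ x : EReal)) (𝓝 l)
      (𝓝 (freeEnergy η π₀ l : EReal)) :=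
    (continuous_coe_real_ereal.tendsto _).comp
      (differentiableAt_freeEnergy hd herg hκ hell π₀ hl).continuousAt
  have hmono : ∀ {x y : ℝ}, x ≤ y → ∀ n : ℕ, ENNReal.log (quenchedMGF ω π x n) / (n : EReal) ≤
      ENNReal.log (quenchedMGF ω π y n) / (n : EReal) := by
    intro x y hxy n
    refine log_div_mono ?_ n
    rw [quenchedMGF_eq_expMoment, quenchedMGF_eq_expMoment]
    exact expMoment_mono _ hxy
  refine tendsto_order.2 ⟨fun a ha => ?_, fun a ha => ?_⟩
  · obtain ⟨r, hr, hball⟩ := Metric.eventually_nhds_iff.1 (hcont.eventually_const_lt ha)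
    obtain ⟨q, hq1, hq2⟩ := exists_rat_btwn (show l - r < l by linarith)
    have h3 := hball (y := q) (by rw [Real.dist_eq, abs_lt]; constructor <;> linarith)
    filter_upwards [(h1 q (hq2.trans hl).le π).eventually_const_lt h3] with n hn
    exact hn.trans_le (hmono hq2.le n)
  · obtain ⟨r, hr, hball⟩ := Metric.eventually_nhds_iff.1 (hcont.eventually_lt_const ha)
    obtain ⟨q, hq1, hq2⟩ := exists_rat_btwn
      (show l < min (l + r) (critParam η) from lt_min (by linarith) hl)
    have h4 := hq2.trans_le (min_le_left _ _)
    have h3 := hball (y := q) (by rw [Real.dist_eq, abs_lt]; constructor <;> linarith)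
    filter_upwards [(h1 q (hq2.le.trans (min_le_right _ _)) π).eventually_lt_const h3] with n hn
    exact (hmono hq1.le n).trans_lt hn

/-- Almost surely, for each parameter above the critical one, some passage matrix strictly to the
right of the origin is infinite. -/
theorem ae_forall_exists_Phi_eq_top (hd : 0 < d) (herg : Ergodic shift η) (hκ : 0 < κ)
    (hell : ∀ᵐ ω ∂η, ∀ n : ℤ, IsElliptic κ (ω n)) :
    ∀ᵐ ω ∂η, ∀ x > critParam η, ∃ l < x, ∃ (k : ℕ) (i j : Fin d),
      Phi ω l ((k + 1 : ℕ) : ℤ) i j = ⊤ := by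
  have h1 : ∀ᵐ ω ∂η, ∀ m : ℕ, ∃ (k : ℕ) (i j : Fin d),
      Phi ω (critParam η + 1 / ((m : ℝ) + 1)) ((k + 1 : ℕ) : ℤ) i j = ⊤ := by
    refine ae_all_iff.2 fun m => ?_
    have hm : critParam η + 1 / ((m : ℝ) + 1) ∉ finiteParams η := fun hmem => by
      have h2 := (isLUB_critParam hd herg.toMeasurePreserving hκ hell).1 hmem
      have h3 : (0 : ℝ) < 1 / ((m : ℝ) + 1) := by positivity
      linarith
    filter_upwards [ae_forall_translate herg.toMeasurePreserving (ae_exists_Phi_eq_top herg hm)]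
      with ω hω
    obtain ⟨k, i, j, hk⟩ := hω 1
    refine ⟨k, i, j, ?_⟩
    rw [Phi_translate] at hk
    exact_mod_cast hk
  filter_upwards [h1] with ω hω x hx
  obtain ⟨m, hm⟩ := exists_nat_one_div_lt (sub_pos.2 hx)
  exact ⟨_, by linarith, hω m⟩

theorem critParam_nonneg (hd : 0 < d) (herg : Ergodic shift η) (hκ : 0 < κ)
    (hell : ∀ᵐ ω ∂η, ∀ n : ℤ, IsElliptic κ (ω n)) : 0 ≤ critParam η :=
  (isLUB_critParam hd herg.toMeasurePreserving hκ hell).1 (mem_finiteParams_of_nonpos le_rfl)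

theorem quenchedMGF_zero_param_le_one (ω : Env d) (π : PMF (Fin d)) (n : ℕ) :
    quenchedMGF ω π 0 n ≤ 1 := by
  rw [quenchedMGF_eq]
  have h := π.tsum_coe
  rw [tsum_fintype] at h
  rw [← h]
  exact Finset.sum_le_sum fun i _ => mul_le_of_le_one_right' (sum_hitGen_le_one ω le_rfl _ _)

theorem lowerSemicontinuous_legendre {Λ : ℝ → EReal} (hbot : ∀ l, Λ l ≠ ⊥) :
    LowerSemicontinuous (legendre Λ) := by
  refine lowerSemicontinuous_iSup fun l => Continuous.lowerSemicontinuous ?_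
  induction hΛ : Λ l with
  | bot => exact absurd hΛ (hbot l)
  | coe L =>
    have h1 : Continuous fun t : ℝ => ((l * t - L : ℝ) : EReal) :=
      continuous_coe_real_ereal.comp (by fun_prop)
    simpa only [EReal.coe_sub] using h1
  | top =>
    simp only [EReal.sub_top]
    exact continuous_const

/-- The limit of the logarithmic moment generating functions and the weak large deviation principle
in a typical environment. -/
theorem ae_tendsto_and_weakLDP (hd : 0 < d) (herg : Ergodic shift η) (hκ : 0 < κ)
    (hell : ∀ᵐ ω ∂η, ∀ n : ℤ, IsElliptic κ (ω n)) (π₀ : PMF (Fin d)) :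
    ∀ᵐ ω ∂η, ∀ π : PMF (Fin d),
      (∀ l : ℝ, Tendsto (fun n : ℕ => ENNReal.log (quenchedMGF ω π l n) / (n : EReal)) atTop
        (𝓝 (logMGFLimit η π₀ l))) ∧
      WeakLDP (fun n A => quenchedLawInit ω π (scaledHitEvent n A))
        (legendre (logMGFLimit η π₀)) := by
  filter_upwards [ae_forall_translate herg.toMeasurePreserving
    (ae_forall_tendsto_log_quenchedMGF hd herg hκ hell π₀),
    ae_forall_exists_Phi_eq_top hd herg hκ hell, hell] with ω hlim htop hω π
  have hzero : translate 0 ω = ω := by funext k; simp [translate]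
  have hlim0 := hlim 0 π
  rw [hzero] at hlim0
  have hall : ∀ l : ℝ, Tendsto (fun n : ℕ => ENNReal.log (quenchedMGF ω π l n) / (n : EReal)) atTop
      (𝓝 (logMGFLimit η π₀ l)) := by
    intro l
    rcases le_or_gt l (critParam η) with hl | hl
    · rw [logMGFLimit_of_le hl]
      exact hlim0 l hl
    · rw [logMGFLimit_of_lt hl]
      obtain ⟨l', hl', k, i, j, hk⟩ := htop l hl
      have hk' : Phi ω l ((k + 1 : ℕ) : ℤ) i j = ⊤ :=
        top_le_iff.1 (hk.symm.le.trans (Phi_mono ω hl'.le _ _ _))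
      refine tendsto_const_nhds.congr' ?_
      filter_upwards [eventually_ge_atTop (k + 2)] with n hn
      rw [quenchedMGF_eq_top hd hκ hω hk' π hn, ENNReal.log_top]
      exact (EReal.top_div_of_pos_ne_top (by exact_mod_cast (show 0 < n by omega))
        (EReal.natCast_ne_top n)).symm
  have hmass : ∀ A : Set ℝ, (fun n : ℕ =>
      ENNReal.log (quenchedLawInit ω π (scaledHitEvent n A)) / (n : EReal)) =
      fun n : ℕ => ENNReal.log (scaledMass (hitLaw ω π n) n A) / (n : EReal) := fun A => by
    funext n
    rw [quenchedLawInit_scaledHitEvent, scaledMass]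
  have hexp : ∀ l : ℝ, Tendsto
      (fun n : ℕ => ENNReal.log (expMoment (hitLaw ω π n) l) / (n : EReal)) atTop
      (𝓝 (logMGFLimit η π₀ l)) := fun l => by
    simpa only [quenchedMGF_eq_expMoment] using hall l
  refine ⟨hall, ?_, lowerSemicontinuous_legendre (logMGFLimit_ne_bot π₀), ?_, ?_⟩
  · intro t
    have h1 : logMGFLimit η π₀ 0 ≤ 0 := by
      refine le_of_tendsto' (hall 0) fun n => ?_
      have h2 := log_div_mono (quenchedMGF_zero_param_le_one ω π n) n
      simpa using h2
    refine le_trans ?_ (le_iSup (fun l : ℝ => ((l * t : ℝ) : EReal) - logMGFLimit η π₀ l) 0)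
    simpa using h1
  · intro G hG
    rw [hmass G]
    refine le_liminf_scaledMass (L := freeEnergy η π₀) (critParam_nonneg hd herg hκ hell)
      (fun l hl => logMGFLimit_of_le hl.le)
      ((convexOn_freeEnergy hd herg hκ hell π₀).subset Set.Iio_subset_Iic_self (convex_Iio _))
      (fun l hl => differentiableAt_freeEnergy hd herg hκ hell π₀ hl)
      (fun l hl => by simpa only [logMGFLimit_of_le hl.le] using hexp l) ?_ hG
    intro x hx
    obtain ⟨l, hlx, k, i, j, hk⟩ := htop x hx
    obtain ⟨s, hs0, hs⟩ := exists_expWeight_le_loopProb hd hκ hω hlx hk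
    obtain ⟨i₀, hi₀⟩ := PMF_exists_pos π
    obtain ⟨a, ha⟩ := exists_hitProb_ne_zero hd hκ hω k i₀ i
    refine ⟨fun n => hitLaw (translate ((k + 1 : ℕ) : ℤ) ω) (PMF.pure i) (n - (k + 1)), s, a,
      min 1 (π i₀ * hitProb ω ((k + 1 : ℕ) : ℤ) a (0, i₀) i), fun y hy => ?_, hs0, ?_, ?_, ?_⟩
    · -- The delayed walk starts afresh at level `k + 1`, in a translated environment.
      simp_rw [← quenchedMGF_eq_expMoment]
      exact tendsto_log_div_sub (hlim _ _ y hy.le) (k + 1)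
    · exact (lt_min one_pos (pos_iff_ne_zero.2 (mul_ne_zero hi₀ ha))).ne'
    · exact ((min_le_left _ _).trans_lt ENNReal.one_lt_top).ne
    · filter_upwards [eventually_gt_atTop (k + 1)] with n hn m b
      refine le_trans ?_ (mul_hitLaw_translate_le π hn hs i₀ a m b)
      gcongr
      exact min_le_right _ _
  · intro F hF
    rw [hmass F]
    exact limsup_scaledMass_le (logMGFLimit_ne_bot π₀) hexp hF

end LogMGFLimit

end StripRWRE

end

theorem theorem1p3 {d : ℕ} (hd : 0 < d)
    (η : Measure (StripRWRE.Env d)) [IsProbabilityMeasure η]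
    (hergodic : Ergodic StripRWRE.shift η)
    (helliptic : ∃ κ : ℝ, 0 < κ ∧ ∀ᵐ ω ∂η, ∀ n : ℤ, StripRWRE.IsElliptic κ (ω n)) :
    (∀ (ω : StripRWRE.Env d) (π : PMF (Fin d)) (l : ℝ) (n : ℕ),
      StripRWRE.quenchedMGF ω π l n =
        (fun i => π i) ⬝ᵥ (StripRWRE.PhiProd ω l 0 n *ᵥ (fun _ => 1))) ∧
    ∃ (Λ : ℝ → EReal) (lcrit : ℝ),
      0 ≤ lcrit ∧
      IsLUB {l : ℝ | ∀ᵐ ω ∂η, ∀ i j, StripRWRE.Phi ω l 0 i j < ⊤} lcrit ∧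
      (∀ l, lcrit < l → Λ l = ⊤) ∧
      (∀ l, l ≤ lcrit → ∃ μ₀ : StripRWRE.Env d → Fin d → ℝ≥0∞,
        (∀ᵐ ω ∂η, ∀ π : PMF (Fin d),
          Tendsto (fun m : ℕ => StripRWRE.normalizedRow ω π l m) atTop (𝓝 (μ₀ ω))) ∧
        Integrable (fun ω =>
          Real.log (μ₀ ω ⬝ᵥ (StripRWRE.Phi ω l 0 *ᵥ (fun _ => 1))).toReal) η ∧
        Λ l = ((∫ ω,
          Real.log (μ₀ ω ⬝ᵥ (StripRWRE.Phi ω l 0 *ᵥ (fun _ => 1))).toReal ∂η : ℝ) : EReal)) ∧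
      DifferentiableOn ℝ (fun l => (Λ l).toReal) (Set.Iio lcrit) ∧
      ∀ᵐ ω ∂η, ∀ π : PMF (Fin d),
        (∀ l : ℝ, Tendsto
          (fun n : ℕ => ENNReal.log (StripRWRE.quenchedMGF ω π l n) / (n : EReal))
          atTop (𝓝 (Λ l))) ∧
        StripRWRE.WeakLDP
          (fun n A => StripRWRE.quenchedLawInit ω π (StripRWRE.scaledHitEvent n A))
          (StripRWRE.legendre Λ) := by
  obtain ⟨κ, hκ, hell⟩ := helliptic
  have hmp := hergodic.toMeasurePreserving
  -- Any distribution serves to select a version of the limit `μ₀`.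
  let π₀ : PMF (Fin d) := PMF.pure ⟨0, hd⟩
  refine ⟨StripRWRE.quenchedMGF_eq_dotProduct, StripRWRE.logMGFLimit η π₀, StripRWRE.critParam η,
    StripRWRE.critParam_nonneg hd hergodic hκ hell,
    StripRWRE.isLUB_critParam hd hmp hκ hell, fun l hl => StripRWRE.logMGFLimit_of_lt hl,
    fun l hl => ⟨StripRWRE.rowLimit π₀ l, ?_⟩, fun l hl => ?_,
    StripRWRE.ae_tendsto_and_weakLDP hd hergodic hκ hell π₀⟩
  · obtain ⟨c, C, hc, hcC, hbd⟩ := StripRWRE.exists_ae_PhiBounded hd hmp hκ hell (-l)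
    have hbd' := hbd l (by simp) hl
    refine ⟨?_, StripRWRE.integrable_logGrowth hd hc hcC hbd' π₀, StripRWRE.logMGFLimit_of_le hl⟩
    filter_upwards [hbd'] with ω hω
    obtain ⟨s, -, -, -, h, -⟩ := StripRWRE.rowLimit_spec hd hc hcC hω π₀
    exact h
  · refine DifferentiableAt.differentiableWithinAt ?_
    refine (StripRWRE.differentiableAt_freeEnergy hd hergodic hκ hell π₀ hl).congr_of_eventuallyEq ?_
    filter_upwards [eventually_lt_nhds hl] with x hx
    rw [StripRWRE.logMGFLimit_of_le hx.le, EReal.toReal_coe]
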